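/- \textbf{Setting.} An episodic loop-free Markov persuasion process consists of finite sets $X$ (states), $\Omega$ (outcomes), $A$ (actions); a partition of $X$ into layers $X_0=\{x_0\},X_1,\dots,X_L=\{x_L\}$, with $k(x)$ the layer index of $x$; a prior $\mu(\cdot|x)\in\Delta(\Omega)$ for every $x$; a transition function $P(\cdot|x,\omega,a)\in\Delta(X_{k(x)+1})$ for every $x\ne x_L$; and, for each episode $t\in[T]$, reward functions $r_{S,t},r_{R,t}:X\times\Omega\times A\to[0,1]$ of the sender and of the receivers, drawn i.i.d. over $t$, with means $r_S,r_R$. In episode $t$ the sender commits to a signaling policy $\phi_t:X\times\Omega\to\Delta(A)$; then, starting from $x_0$, for $k=0,\dots,L-1$ one draws $\omega_k\sim\mu(\cdot|x_k)$, $a_k\sim\phi_t(\cdot|x_k,\omega_k)$, $x_{k+1}\sim P(\cdot|x_k,\omega_k,a_k)$. Given the past and $\phi_t$, the trajectory is independent of the rewards of episode $t$. Under partial feedback the sender then observes the trajectory and $r_{S,t}(x_k,\omega_k,a_k)$, $r_{R,t}(x_k,\omega_k,a_k)$ for $k<L$, and nothing else; $\mu$, $P$ and the reward distributions are unknown. The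 occupancy measure $q^{P,\phi,\mu}(x,\omega,a,x')$ is the probability that $(x,\omega,a,x')$ is visited in an episode with policy $\phi$; for any vector $q$ on $X\times\Omega\times A\times X$ let $q(x,\omega,a)=\sum_{x'}q(x,\omega,a,x')$, $q(x,\omega)=\sum_a q(x,\omega,a)$, $q(x)=\sum_\omega q(x,\omega)$ and $r^\top q=\sum_{x,\omega,a}q(x,\omega,a)r(x,\omega,a)$. Let $\mathrm{OPT}$ be the maximum of $r_S^\top q$ over all occupancy measures $q=q^{P,\phi,\mu}$ with $\sum_\omega q(x,\omega,a)\,(r_R(x,\omega,a)-r_R(x,\omega,a'))\ge 0$ for all $x,a,a'$. The regret is $R_T=T\cdot\mathrm{OPT}-\sum_{t\in[T]}r_S^\top q^{P,\phi_t,\mu}$. \textbf{Estimators and bounds.} Let $N_t(\cdot)$ be the number of episodes before $t$ in which the indicated state or tuple is visited, and put $\overline P_t(x'|x,\omega,a)=\frac{N_t(x,\omega,a,x')}{\max\{1,N_t(x,\omega,a)\}}$, $\overline\mu_t(\omega|x)=\frac{N_t(x,\omega)}{\max\{1,N_t(x)\}}$; let $\overline r_{S,t}(x,\omega,a)$ and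 $\overline r_{R,t}(x,\omega,a)$ be the sums of the rewards of $(x,\omega,a)$ observed before episode $t$, divided by $\max\{1,N_t(x,\omega,a)\}$; and let $$\epsilon_t(x,\omega,a)=\sqrt{\tfrac{2|X_{k(x)+1}|\ln(T|X||\Omega||A|/\delta)}{\max\{1,N_t(x,\omega,a)\}}},\quad \zeta_t(x)=\sqrt{\tfrac{2|\Omega|\ln(T|X|/\delta)}{\max\{1,N_t(x)\}}},\quad \xi_t(x,\omega,a)=\min\Big\{1,\sqrt{\tfrac{\ln(3T|X||\Omega||A|/\delta)}{\max\{1,N_t(x,\omega,a)\}}}\Big\}.$$ \textbf{The program \texttt{Opt-Opt}} at episode $t$ has variables $q(x,\omega,a,x')\ge 0$ and $\epsilon(x,\omega,a,x')$ (for $x\in X_k$, $x'\in X_{k+1}$, $k<L$) and $\zeta(x,\omega)$. It maximizes $(\overline r_{S,t}+\xi_t)^\top q$ subject to: $\sum_{x\in X_k}q(x)=1$ for $0\le k\le L-1$; $\sum_{x',\omega,a}q(x',\omega,a,x)=q(x)$ for $x\in X_k$, $1\le k\le L-1$; $|q(x,\omega,a,x')-\overline P_t(x'|x,\omega,a)q(x,\omega,a)|\le\epsilon(x,\omega,a,x')$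 and $\sum_{x'\in X_{k(x)+1}}\epsilon(x,\omega,a,x')\le\epsilon_t(x,\omega,a)q(x,\omega,a)$; $|q(x,\omega)-\overline\mu_t(\omega|x)q(x)|\le\zeta(x,\omega)$ and $\sum_\omega\zeta(x,\omega)\le\zeta_t(x)q(x)$; $\sum_\omega q(x,\omega,a)\big(\overline r_{R,t}(x,\omega,a)+\xi_t(x,\omega,a)-\overline r_{R,t}(x,\omega,a')+\xi_t(x,\omega,a')\big)\ge 0$ for all $a,a'$ (all these for all $x\ne x_L$). \textbf{Algorithm} (\texttt{OPPS} with partial feedback; inputs $T$, $\delta\in(0,1)$, $\alpha\in[0,1]$). Let $N=\lceil T^\alpha\rceil$. In each episode $t\le N|X||\Omega||A|$ pick a triplet $(x,\omega,a)\in X\times\Omega\times A$ that was picked least often before, and let $\widehat q_t$ maximize $q(x,\omega,a)$ subject to the constraints of \texttt{Opt-Opt}; in each episode $t>N|X||\Omega||A|$ let $\widehat q_t$ be an optimal solution of \texttt{Opt-Opt}. Commit to $\phi_t(a|x,\omega)=\widehat q_t(x,\omega,a)/\widehat q_t(x,\omega)$, an arbitrary distribution where $\widehat q_t(x,\omega)=0$.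 Ties are broken arbitrarily, and in an episode where \texttt{Opt-Opt} is infeasible the sender may commit to any policy. \textbf{Theorem.} There are universal constants $C>0$ and $p\in\mathbb N$ such that for all layered finite state spaces $X$ with layers $0,\dots,L$, all finite $\Omega$, $A$, all $T$, all $\alpha\in[0,1]$ and $\delta\in(0,1)$, every implementation of the algorithm above and every Markov persuasion process as above: with probability at least $1-7\delta$, $$R_T\le C\,\ln^p\!\big(T|X||\Omega||A|\big)\left(N L|X||\Omega||A|+L^2|X|\sqrt{T|A||\Omega|\ln(1/\delta)}\right),$$ that is, $R_T\le\widetilde{\mathcal O}\big(NL|X||\Omega||A|+L^2|X|\sqrt{T|A||\Omega|\ln(1/\delta)}\big)$. -/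

import Mathlib

open MeasureTheory

namespace MarkovPersuasion

/-! ## Environments -/

/-- A loop-free layered state space: `X` is partitioned into the layers
`X_k = {x | layer x = k}`, `k = 0, …, L`, with `X_0 = {first}` and `X_L = {last}`. -/
structure Layering (X : Type*) (L : ℕ) where
  layer : X → ℕ
  first : X
  last : X
  layer_le : ∀ x, layer x ≤ L
  layer_eq_zero_iff : ∀ x, layer x = 0 ↔ x = first
  layer_eq_last_iff : ∀ x, layer x = L ↔ x = last

/-- The layer `X_{k(x)+1}` following the one of `x`. -/
def Layering.next {X : Type*} [Fintype X] {L : ℕ} (S : Layering X L) (x : X) : Finset X :=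
  Finset.univ.filter fun x' => S.layer x' = S.layer x + 1

/-- A loop-free episodic Markov persuasion process over the layered state space `S`, with
outcomes `Ω` and actions `A`. No transition leaves the final state, where an episode ends. -/
structure MPP {X : Type*} [Fintype X] {L : ℕ} (S : Layering X L) (Ω A : Type*) [Fintype Ω] where
  /-- `prior x ω = μ(ω | x)` -/
  prior : X → Ω → ℝ
  prior_mem : ∀ x, prior x ∈ stdSimplex ℝ Ω
  /-- `trans x ω a x' = P(x' | x, ω, a)` -/
  trans : X → Ω → A → X → ℝ
  trans_nonneg : ∀ x ω a x', 0 ≤ trans x ω a x'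
  trans_sum : ∀ x ω a, S.layer x < L → ∑ x', trans x ω a x' = 1
  trans_layer : ∀ x ω a x', 0 < trans x ω a x' → S.layer x' = S.layer x + 1
  /-- The law of the pair of reward functions `(r_{S,t}, r_{R,t})` of one episode. Its marginals
  on single entries are `ν_S(x,ω,a)` and `ν_R(x,ω,a)`; reward functions of distinct episodes are
  independent, whereas entries of the same episode may have any joint law (for instance the
  product one). -/
  rewardLaw : Measure ((X → Ω → A → ℝ) × (X → Ω → A → ℝ))
  rewardLaw_prob : IsProbabilityMeasure rewardLaw
  rewardLaw_mem : ∀ᵐ r ∂rewardLaw, ∀ x ω a,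
    r.1 x ω a ∈ Set.Icc (0 : ℝ) 1 ∧ r.2 x ω a ∈ Set.Icc (0 : ℝ) 1

/-- A (direct) signaling policy `φ : X × Ω → Δ(A)`. -/
def IsSignalingPolicy {X Ω A : Type*} [Fintype A] (φ : X → Ω → A → ℝ) : Prop :=
  ∀ x ω, φ x ω ∈ stdSimplex ℝ A

/-! ## Episodes -/

/-- The states `x_0, …, x_L`, outcomes `ω_0, …, ω_{L-1}` and actions `a_0, …, a_{L-1}` of an
episode. -/
def Traj (X Ω A : Type*) (L : ℕ) : Type _ := (Fin (L + 1) → X) × (Fin L → Ω) × (Fin L → A)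

namespace Traj

variable {X Ω A : Type*} {L : ℕ}

/-- All sets of trajectories are measurable (there are finitely many trajectories). -/
instance : MeasurableSpace (Traj X Ω A L) := ⊤

instance [Fintype X] [Fintype Ω] [Fintype A] : Fintype (Traj X Ω A L) :=
  inferInstanceAs (Fintype ((Fin (L + 1) → X) × (Fin L → Ω) × (Fin L → A)))

def state (τ : Traj X Ω A L) : Fin (L + 1) → X := τ.1

def outcome (τ : Traj X Ω A L) : Fin L → Ω := τ.2.1

def action (τ : Traj X Ω A L) : Fin L → A := τ.2.2

/-- At step `k` the triplet `(x, ω, a)` occurs. -/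
def At (τ : Traj X Ω A L) (k : Fin L) (x : X) (ω : Ω) (a : A) : Prop :=
  τ.state k.castSucc = x ∧ τ.outcome k = ω ∧ τ.action k = a

def VisitsX (τ : Traj X Ω A L) (x : X) : Prop := ∃ k, τ.state k = x

def VisitsXO (τ : Traj X Ω A L) (x : X) (ω : Ω) : Prop :=
  ∃ k : Fin L, τ.state k.castSucc = x ∧ τ.outcome k = ω

def VisitsXOA (τ : Traj X Ω A L) (x : X) (ω : Ω) (a : A) : Prop := ∃ k, τ.At k x ω a

def VisitsXOAX (τ : Traj X Ω A L) (x : X) (ω : Ω) (a : A) (x' : X) : Prop :=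
  ∃ k : Fin L, τ.At k x ω a ∧ τ.state k.succ = x'

end Traj

/-- What the sender observes in an episode under partial feedback: the trajectory and, for each
step `k`, the sender's and the receiver's reward of the visited triplet `(x_k, ω_k, a_k)`. -/
abbrev Episode (X Ω A : Type*) (L : ℕ) : Type _ :=
  Traj X Ω A L × (Fin L → ℝ) × (Fin L → ℝ)

/-- The observations of the first `t` episodes. -/
abbrev History (X Ω A : Type*) (L t : ℕ) : Type _ := Fin t → Episode X Ω A L

/-- The part of a history that precedes the episode with (zero-based) index `t`. -/
def History.before {X Ω A : Type*} {L T : ℕ} (h : History X Ω A L T) (t : Fin T) :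
    History X Ω A L t := fun i => h (Fin.castLE t.isLt.le i)

noncomputable section

/-! ## Occupancy measures and their marginals -/

/-- Vectors indexed by `X × Ω × A × X`. -/
abbrev Occ (X Ω A : Type*) : Type _ := X → Ω → A → X → ℝ

namespace Occ

variable {X Ω A : Type*} [Fintype X] [Fintype Ω] [Fintype A]

/-- `q(x, ω, a)` -/
def xoa (q : Occ X Ω A) (x : X) (ω : Ω) (a : A) : ℝ := ∑ x', q x ω a x'

/-- `q(x, ω)` -/
def xo (q : Occ X Ω A) (x : X) (ω : Ω) : ℝ := ∑ a, xoa q x ω a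

/-- `q(x)` -/
def ofState (q : Occ X Ω A) (x : X) : ℝ := ∑ ω, xo q x ω

/-- `r^⊤ q` -/
def value (r : X → Ω → A → ℝ) (q : Occ X Ω A) : ℝ := ∑ x, ∑ ω, ∑ a, xoa q x ω a * r x ω a

end Occ

/-! ## Interaction with the environment -/

namespace MPP

variable {X Ω A : Type*} [Fintype X] [Fintype Ω] [Fintype A] {L : ℕ} {S : Layering X L}

/-- The mean `r_S(x, ω, a)` of the sender's reward. -/
def meanS (M : MPP S Ω A) (x : X) (ω : Ω) (a : A) : ℝ := ∫ r, r.1 x ω a ∂M.rewardLaw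

/-- The mean `r_R(x, ω, a)` of the receivers' reward. -/
def meanR (M : MPP S Ω A) (x : X) (ω : Ω) (a : A) : ℝ := ∫ r, r.2 x ω a ∂M.rewardLaw

open Classical in
/-- The probability of a trajectory: start in `x_0`, then at each step draw `ω_k ∼ μ(x_k)`,
`a_k ∼ φ(· | x_k, ω_k)` and `x_{k+1} ∼ P(· | x_k, ω_k, a_k)`. -/
def pathProb (M : MPP S Ω A) (φ : X → Ω → A → ℝ) (τ : Traj X Ω A L) : ℝ :=
  (if τ.state 0 = S.first then 1 else 0) *
    ∏ k : Fin L, M.prior (τ.state k.castSucc) (τ.outcome k) *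
      φ (τ.state k.castSucc) (τ.outcome k) (τ.action k) *
      M.trans (τ.state k.castSucc) (τ.outcome k) (τ.action k) (τ.state k.succ)

/-- The law of the trajectory of an episode in which the sender commits to `φ`. -/
def trajLaw (M : MPP S Ω A) (φ : X → Ω → A → ℝ) : Measure (Traj X Ω A L) :=
  ∑ τ, ENNReal.ofReal (M.pathProb φ τ) • Measure.dirac τ

/-- The law of what the sender observes in an episode in which they commit to `φ`: the reward
functions are drawn independently of the trajectory and read off at the visited triplets. -/
def episodeLaw (M : MPP S Ω A) (φ : X → Ω → A → ℝ) : Measure (Episode X Ω A L) :=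
  ((M.trajLaw φ).prod M.rewardLaw).map fun p =>
    (p.1, (fun k => p.2.1 (p.1.state k.castSucc) (p.1.outcome k) (p.1.action k)),
      (fun k => p.2.2 (p.1.state k.castSucc) (p.1.outcome k) (p.1.action k)))

/-- The occupancy measure `q^{P,φ,μ}`: the probability that `(x, ω, a, x')` is visited. -/
def occ (M : MPP S Ω A) (φ : X → Ω → A → ℝ) : Occ X Ω A := fun x ω a x' =>
  (M.trajLaw φ).real {τ | τ.VisitsXOAX x ω a x'}

/-- The valid occupancy measures that satisfy the persuasiveness constraints. -/
def persuasiveOcc (M : MPP S Ω A) : Set (Occ X Ω A) :=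
  {q | (∃ φ, IsSignalingPolicy φ ∧ q = M.occ φ) ∧
    ∀ x a a', 0 ≤ ∑ ω, q.xoa x ω a * (M.meanR x ω a - M.meanR x ω a')}

/-- The value `OPT` of the offline problem: the largest expected sender's reward of a valid
persuasive occupancy measure. -/
def opt (M : MPP S Ω A) : ℝ := sSup (Occ.value M.meanS '' M.persuasiveOcc)

end MPP

/-! ## Estimators and confidence bounds -/

section Estimators

variable {X Ω A : Type*} [Fintype X] [Fintype Ω] [Fintype A] {L t : ℕ}

open Classical in
/-- `N_t(x)` -/
def countX (h : History X Ω A L t) (x : X) : ℕ :=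
  (Finset.univ.filter fun s : Fin t => (h s).1.VisitsX x).card

open Classical in
/-- `N_t(x, ω)` -/
def countXO (h : History X Ω A L t) (x : X) (ω : Ω) : ℕ :=
  (Finset.univ.filter fun s : Fin t => (h s).1.VisitsXO x ω).card

open Classical in
/-- `N_t(x, ω, a)` -/
def countXOA (h : History X Ω A L t) (x : X) (ω : Ω) (a : A) : ℕ :=
  (Finset.univ.filter fun s : Fin t => (h s).1.VisitsXOA x ω a).card

open Classical in
/-- `N_t(x, ω, a, x')` -/
def countXOAX (h : History X Ω A L t) (x : X) (ω : Ω) (a : A) (x' : X) : ℕ :=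
  (Finset.univ.filter fun s : Fin t => (h s).1.VisitsXOAX x ω a x').card

/-- The estimated transition probability of `x'` given `(x, ω, a)`. -/
def transEst (h : History X Ω A L t) (x : X) (ω : Ω) (a : A) (x' : X) : ℝ :=
  countXOAX h x ω a x' / max 1 (countXOA h x ω a : ℝ)

/-- The estimated prior probability of `ω` given `x`. -/
def priorEst (h : History X Ω A L t) (x : X) (ω : Ω) : ℝ :=
  countXO h x ω / max 1 (countX h x : ℝ)

open Classical in
/-- The estimated sender's reward. (In a loop-free process a triplet occurs at no more than one
step of an episode.) -/
def rewardEstS (h : History X Ω A L t) (x : X) (ω : Ω) (a : A) : ℝ :=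
  (∑ s : Fin t, ∑ k : Fin L, if (h s).1.At k x ω a then (h s).2.1 k else 0) /
    max 1 (countXOA h x ω a : ℝ)

open Classical in
/-- The estimated receivers' reward. -/
def rewardEstR (h : History X Ω A L t) (x : X) (ω : Ω) (a : A) : ℝ :=
  (∑ s : Fin t, ∑ k : Fin L, if (h s).1.At k x ω a then (h s).2.2 k else 0) /
    max 1 (countXOA h x ω a : ℝ)

/-- The confidence bound `ε_t(x, ω, a)` for transitions. -/
def transBound (S : Layering X L) (T : ℕ) (δ : ℝ) (h : History X Ω A L t)
    (x : X) (ω : Ω) (a : A) : ℝ :=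
  √(2 * ((S.next x).card : ℝ) *
      Real.log (T * Fintype.card X * Fintype.card Ω * Fintype.card A / δ) /
    max 1 (countXOA h x ω a : ℝ))

/-- The confidence bound `ζ_t(x)` for priors. -/
def priorBound (T : ℕ) (δ : ℝ) (h : History X Ω A L t) (x : X) : ℝ :=
  √(2 * (Fintype.card Ω : ℝ) * Real.log (T * Fintype.card X / δ) / max 1 (countX h x : ℝ))

/-- The confidence bound `ξ_{S,t}(x, ω, a) = ξ_{R,t}(x, ω, a)` for rewards under partial
feedback. -/
def rewardBound (T : ℕ) (δ : ℝ) (h : History X Ω A L t) (x : X) (ω : Ω) (a : A) : ℝ :=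
  min 1 (√(Real.log (3 * T * Fintype.card X * Fintype.card Ω * Fintype.card A / δ) /
    max 1 (countXOA h x ω a : ℝ)))

/-! ## The optimistic linear program `Opt-Opt` -/

open Classical in
/-- The constraints of `Opt-Opt` on its variables `q, ζ, ε`. The program has variables
`q(x, ω, a, x')` only for `x'` in the layer following the one of `x`; this is the field
`support`. -/
structure OptOptFeasible (S : Layering X L) (T : ℕ) (δ : ℝ) (h : History X Ω A L t)
    (q : Occ X Ω A) (ζ : X → Ω → ℝ) (ε : X → Ω → A → X → ℝ) : Prop where
  support : ∀ x ω a x', x' ∉ S.next x → q x ω a x' = 0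
  nonneg : ∀ x ω a x', 0 ≤ q x ω a x'
  sum_layer : ∀ k < L, ∑ x with S.layer x = k, ∑ ω, ∑ a, ∑ x', q x ω a x' = 1
  flow : ∀ x, 1 ≤ S.layer x → S.layer x < L → ∑ x', ∑ ω, ∑ a, q x' ω a x = q.ofState x
  trans_upper : ∀ x ω a, ∀ x' ∈ S.next x,
    q x ω a x' - transEst h x ω a x' * q.xoa x ω a ≤ ε x ω a x'
  trans_lower : ∀ x ω a, ∀ x' ∈ S.next x,
    transEst h x ω a x' * q.xoa x ω a - q x ω a x' ≤ ε x ω a x'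
  trans_sum : ∀ x ω a, S.layer x < L →
    ∑ x' ∈ S.next x, ε x ω a x' ≤ transBound S T δ h x ω a * q.xoa x ω a
  prior_upper : ∀ x ω, S.layer x < L → q.xo x ω - priorEst h x ω * q.ofState x ≤ ζ x ω
  prior_lower : ∀ x ω, S.layer x < L → priorEst h x ω * q.ofState x - q.xo x ω ≤ ζ x ω
  prior_sum : ∀ x, S.layer x < L → ∑ ω, ζ x ω ≤ priorBound T δ h x * q.ofState x
  persuasive : ∀ x a a', S.layer x < L →
    0 ≤ ∑ ω, q.xoa x ω a *
      (rewardEstR h x ω a + rewardBound T δ h x ω a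
        - rewardEstR h x ω a' + rewardBound T δ h x ω a')

/-- `q` is the occupancy part of an optimal solution of the program that maximizes `obj` subject
to the constraints of `Opt-Opt`. -/
def IsOptOptSolution (S : Layering X L) (T : ℕ) (δ : ℝ) (h : History X Ω A L t)
    (obj : Occ X Ω A → ℝ) (q : Occ X Ω A) : Prop :=
  (∃ ζ ε, OptOptFeasible S T δ h q ζ ε) ∧
    ∀ q' ζ' ε', OptOptFeasible S T δ h q' ζ' ε' → obj q' ≤ obj q

/-- The objective of `Opt-Opt`. -/
def optimisticValue (T : ℕ) (δ : ℝ) (h : History X Ω A L t) (q : Occ X Ω A) : ℝ :=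
  Occ.value (fun x ω a => rewardEstS h x ω a + rewardBound T δ h x ω a) q

end Estimators

/-! ## The algorithm -/

/-- The length `N |X| |Ω| |A|`, with `N = ⌈T^α⌉`, of the exploration phase. -/
def explorationLength (X Ω A : Type*) [Fintype X] [Fintype Ω] [Fintype A] (T : ℕ) (α : ℝ) : ℕ :=
  ⌈(T : ℝ) ^ α⌉₊ * Fintype.card X * Fintype.card Ω * Fintype.card A

open Classical in
/-- An implementation of optimistic persuasive policy search with partial feedback. It maps the
observations of the first `t` episodes to what is used in the next one (of zero-based index `t`):
the triplet considered in the exploration phase, the solution `q̂` of the linear program, and the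
policy induced by `q̂`. Every choice that the algorithm leaves open (ties, the policy at pairs
with `q̂(x, ω) = 0`, the behaviour in case `Opt-Opt` is infeasible) is arbitrary. An
implementation knows the layered state space, but not the environment. -/
structure OPPS {X : Type*} [Fintype X] {L : ℕ} (S : Layering X L) (Ω A : Type*) [Fintype Ω]
    [Fintype A] (T : ℕ) (α δ : ℝ) where
  triplet : ∀ t : ℕ, History X Ω A L t → X × Ω × A
  qhat : ∀ t : ℕ, History X Ω A L t → Occ X Ω A
  policy : ∀ t : ℕ, History X Ω A L t → X → Ω → A → ℝ
  measurable_policy : ∀ t, Measurable (policy t)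
  isSignalingPolicy : ∀ t h, IsSignalingPolicy (policy t h)
  /-- The triplet minimizes the counter `C`, the number of earlier episodes that considered it. -/
  triplet_argmin : ∀ t < explorationLength X Ω A T α, ∀ (h : History X Ω A L t) (y : X × Ω × A),
    (Finset.univ.filter fun s : Fin t => triplet s (h.before s) = triplet t h).card ≤
      (Finset.univ.filter fun s : Fin t => triplet s (h.before s) = y).card
  solve_explore : ∀ t < explorationLength X Ω A T α, ∀ h : History X Ω A L t,
    (∃ q ζ ε, OptOptFeasible S T δ h q ζ ε) →
      IsOptOptSolution S T δ h
        (fun q => q.xoa (triplet t h).1 (triplet t h).2.1 (triplet t h).2.2) (qhat t h)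
  solve_exploit : ∀ t, explorationLength X Ω A T α ≤ t → ∀ h : History X Ω A L t,
    (∃ q ζ ε, OptOptFeasible S T δ h q ζ ε) →
      IsOptOptSolution S T δ h (optimisticValue T δ h) (qhat t h)
  policy_eq : ∀ t (h : History X Ω A L t) x ω, 0 < (qhat t h).xo x ω →
    ∀ a, policy t h x ω a = (qhat t h).xoa x ω a / (qhat t h).xo x ω

namespace OPPS

variable {X Ω A : Type*} [Fintype X] [Fintype Ω] [Fintype A] {L T : ℕ} {S : Layering X L}
  {α δ : ℝ}

/-- The law of the observations of the first `t` episodes when the algorithm interacts with the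
environment `M`. -/
def historyLaw (alg : OPPS S Ω A T α δ) (M : MPP S Ω A) : ∀ t : ℕ, Measure (History X Ω A L t)
  | 0 => Measure.dirac Fin.elim0
  | t + 1 => (historyLaw alg M t).bind fun h =>
      (M.episodeLaw (alg.policy t h)).map
        (Fin.snoc (α := fun _ => Episode X Ω A L) h)

/-- The regret `R_T = T · OPT - ∑_t r_S^⊤ q_t`, with `q_t = q^{P,φ_t,μ}`. -/
def regret (alg : OPPS S Ω A T α δ) (M : MPP S Ω A) (h : History X Ω A L T) : ℝ :=
  T * M.opt - ∑ t : Fin T, Occ.value M.meanS (M.occ (alg.policy t (h.before t)))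

end OPPS

end

end MarkovPersuasion

open MarkovPersuasion

/-! The proof is optimism in the face of uncertainty plus a pathwise counting argument. Outside an
event of probability at most `7 * δ`, all estimates lie within their confidence bounds (`Accurate`).
Then every persuasive occupancy measure is feasible for `Opt-Opt` (`optOptFeasible_occ`), and its
optimistic value dominates its true value. An exploitation episode therefore loses at most the
optimistic value of the solution `q` minus the true value of the policy computed from `q`.

To bound this gap, `q` is compared in `ℓ¹` with the true occupancy measure of its policy. Both use
the same policy and satisfy the flow constraints, so errors enter only through priors and
transitions and are carried from layer to layer (`OptOptFeasible.sum_abs_sub_le`). The errors are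
weighted by the true occupancy measure, not by `q`. Hence the gap is at most an expected cost
`confidenceCost` along the actual trajectory (`value_sub_value_le_confidenceCost`).

Expected costs are at most twice the realized ones up to a term logarithmic in `1 / δ`, with no
extra `√T` (`measure_value_gt_total_le`). Realized costs are sums of inverse square roots of visit
counts, which Cauchy–Schwarz bounds by a multiple of `√T` (`sum_total_le`). Exploration episodes are
charged their trivial loss `L`.

All probabilistic statements come from one device, `lintegral_prod_le_one`: nonnegative factors, one
per episode, whose conditional expectation is at most one have a product of expectation at most one,
to which Markov's inequality applies. The number of visits to a tuple is random, so a deviation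
process is stopped at its `n`-th visit and a union bound is taken over `n ≤ T`. For `ℓ¹` errors
there is a further union bound over sign patterns. -/

namespace MarkovPersuasion
noncomputable section

set_option linter.unusedSectionVars false

/-! ### Weighted sums over paths of a layered kernel. -/

section

section PathSums

variable {X Ω A : Type*} [Fintype X] [Fintype Ω] [Fintype A] {n : ℕ}

/-- The weight of a path under an initial weight `f` and a (sub-)stochastic kernel `K`. -/
def pathWeight (K : X → Ω → A → X → ℝ) (f : X → ℝ) (τ : Traj X Ω A n) : ℝ :=
  f (τ.state 0) *
    ∏ k : Fin n, K (τ.state k.castSucc) (τ.outcome k) (τ.action k) (τ.state k.succ)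

/-- The weights after one step. -/
def push (K : X → Ω → A → X → ℝ) (f : X → ℝ) : X → ℝ :=
  fun x' => ∑ x, ∑ ω, ∑ a, f x * K x ω a x'

/-- Prepend a step to a trajectory. -/
def Traj.cons (x : X) (ω : Ω) (a : A) (τ : Traj X Ω A n) : Traj X Ω A (n + 1) :=
  (Fin.cons x τ.1, Fin.cons ω τ.2.1, Fin.cons a τ.2.2)

theorem sum_traj_succ (F : Traj X Ω A (n + 1) → ℝ) :
    ∑ τ, F τ = ∑ x, ∑ ω, ∑ a, ∑ τ : Traj X Ω A n, F (τ.cons x ω a) := by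
  let e : X × Ω × A × Traj X Ω A n ≃ Traj X Ω A (n + 1) :=
    { toFun := fun p => p.2.2.2.cons p.1 p.2.1 p.2.2.1
      invFun := fun τ => (τ.1 0, τ.2.1 0, τ.2.2 0, (Fin.tail τ.1, Fin.tail τ.2.1, Fin.tail τ.2.2))
      left_inv := fun p => by simp [Traj.cons]; rfl
      right_inv := fun τ => by
        simp [Traj.cons, Fin.cons_self_tail]; rfl }
  rw [← e.sum_comp]
  simp only [Fintype.sum_prod_type]
  rfl

theorem pathWeight_cons (K : X → Ω → A → X → ℝ) (f : X → ℝ) (x : X) (ω : Ω) (a : A)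
    (τ : Traj X Ω A n) :
    pathWeight K f (τ.cons x ω a) = pathWeight K (fun y => f x * K x ω a y) τ := by
  simp only [pathWeight, Fin.prod_univ_succ, Traj.cons, Traj.state, Traj.outcome, Traj.action,
    Fin.cons_zero, Fin.castSucc_zero, Fin.cons_succ, ← Fin.succ_castSucc]
  ring

/-- `pathWeight` is linear in the initial weight, so a sum over a prepended first step can be
absorbed into that weight. This drives the inductions on path length below. -/
theorem sum_pathWeight_add (K : X → Ω → A → X → ℝ) (f : X → Ω → A → X → ℝ)
    (c : Traj X Ω A n → ℝ) :
    ∑ x, ∑ ω, ∑ a, ∑ τ, pathWeight K (f x ω a) τ * c τ =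
      ∑ τ, pathWeight K (fun y => ∑ x, ∑ ω, ∑ a, f x ω a y) τ * c τ := by
  simp only [pathWeight, Finset.sum_mul]
  rw [Finset.sum_comm (s := (Finset.univ : Finset (Traj X Ω A n)))]
  refine Finset.sum_congr rfl fun x _ => ?_
  rw [Finset.sum_comm (s := (Finset.univ : Finset (Traj X Ω A n)))]
  refine Finset.sum_congr rfl fun ω _ => ?_
  rw [Finset.sum_comm (s := (Finset.univ : Finset (Traj X Ω A n)))]

variable {L : ℕ} {S : Layering X L}

theorem sum_push {K : X → Ω → A → X → ℝ} {f : X → ℝ} {j : ℕ} (hj : j < L)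
    (hK : ∀ x, S.layer x < L → ∑ ω, ∑ a, ∑ x', K x ω a x' = 1)
    (hf : ∀ x, S.layer x ≠ j → f x = 0) :
    ∑ x, push K f x = ∑ x, f x := by
  simp only [push]
  rw [Finset.sum_comm]
  refine Finset.sum_congr rfl fun x _ => ?_
  have h : ∑ x', ∑ ω, ∑ a, f x * K x ω a x' = f x * ∑ ω, ∑ a, ∑ x', K x ω a x' := by
    rw [Finset.sum_comm, Finset.mul_sum]
    refine Finset.sum_congr rfl fun ω _ => ?_
    rw [Finset.sum_comm, Finset.mul_sum]
    exact Finset.sum_congr rfl fun a _ => (Finset.mul_sum ..).symm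
  rw [h]
  by_cases hx : S.layer x = j
  · rw [hK x (by omega), mul_one]
  · rw [hf x hx, zero_mul]

theorem push_eq_zero {K : X → Ω → A → X → ℝ} {f : X → ℝ} {j : ℕ}
    (hK : ∀ x ω a x', S.layer x' ≠ S.layer x + 1 → K x ω a x' = 0)
    (hf : ∀ x, S.layer x ≠ j → f x = 0) (x : X) (hx : S.layer x ≠ j + 1) :
    push K f x = 0 := by
  refine Finset.sum_eq_zero fun y _ => Finset.sum_eq_zero fun ω _ => Finset.sum_eq_zero fun a _ => ?_
  by_cases hy : S.layer y = j
  · rw [hK y ω a x (by omega), mul_zero]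
  · rw [hf y hy, zero_mul]

/-- Peeling off the first step replaces `f` by `push K f`, which has the same mass. The condition `j
+ n ≤ L` keeps the paths from stepping out of the final layer, where `K` need not be stochastic. -/
theorem sum_pathWeight {K : X → Ω → A → X → ℝ}
    (hK : ∀ x, S.layer x < L → ∑ ω, ∑ a, ∑ x', K x ω a x' = 1)
    (hK' : ∀ x ω a x', S.layer x' ≠ S.layer x + 1 → K x ω a x' = 0) :
    ∀ (n : ℕ) (f : X → ℝ) (j : ℕ), j + n ≤ L → (∀ x, S.layer x ≠ j → f x = 0) →
      ∑ τ : Traj X Ω A n, pathWeight K f τ = ∑ x, f x := by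
  intro n
  induction n with
  | zero =>
    intro f _ _ _
    let e : X ≃ Traj X Ω A 0 :=
      { toFun := fun x => (fun _ => x, Fin.elim0, Fin.elim0)
        invFun := fun τ => τ.1 0
        left_inv := fun x => rfl
        right_inv := fun τ => by
          refine Prod.ext ?_ (Prod.ext (Subsingleton.elim _ _) (Subsingleton.elim _ _))
          funext i
          rw [show i = 0 from Fin.ext (by omega)] }
    rw [← e.sum_comp]
    exact Finset.sum_congr rfl fun x _ => mul_one (f x)
  | succ n ih =>
    intro f j hj hf
    rw [sum_traj_succ]
    simp only [pathWeight_cons]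
    have := sum_pathWeight_add (n := n) K (fun x ω a y => f x * K x ω a y) (fun _ => 1)
    simp only [mul_one] at this
    rw [this, ← sum_push (by omega) hK hf]
    exact ih _ (j + 1) (by omega) (push_eq_zero hK' hf)

/-- The steps before `k` turn `f` into its `k`-th push, and the steps after `k` sum out to one. -/
theorem sum_pathWeight_mul_step {K : X → Ω → A → X → ℝ}
    (hK : ∀ x, S.layer x < L → ∑ ω, ∑ a, ∑ x', K x ω a x' = 1)
    (hK' : ∀ x ω a x', S.layer x' ≠ S.layer x + 1 → K x ω a x' = 0)
    (g : X → Ω → A → X → ℝ) :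
    ∀ (n : ℕ) (f : X → ℝ) (j : ℕ) (k : Fin n), j + n ≤ L → (∀ x, S.layer x ≠ j → f x = 0) →
      ∑ τ : Traj X Ω A n, pathWeight K f τ *
          g (τ.state k.castSucc) (τ.outcome k) (τ.action k) (τ.state k.succ) =
        ∑ x, ∑ ω, ∑ a, ∑ x', (push K)^[k] f x * K x ω a x' * g x ω a x' := by
  intro n
  induction n with
  | zero => intro _ _ k; exact k.elim0
  | succ n ih =>
    intro f j k hj hf
    rw [sum_traj_succ]
    simp only [pathWeight_cons]
    refine Fin.cases ?_ (fun k => ?_) k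
    -- When the marked step comes first, `g` is absorbed into the initial weights of the remaining
    -- path, whose total is known.
    · simp only [Fin.castSucc_zero, Fin.val_zero, Function.iterate_zero, id]
      refine Finset.sum_congr rfl fun x _ => Finset.sum_congr rfl fun ω _ =>
        Finset.sum_congr rfl fun a _ => ?_
      rw [← sum_pathWeight hK hK' n (fun y => f x * K x ω a y * g x ω a y) (j + 1) (by omega)]
      · refine Finset.sum_congr rfl fun τ _ => ?_
        simp only [pathWeight, Traj.cons, Traj.state, Traj.outcome, Traj.action, Fin.cons_zero,
          Fin.cons_succ]
        ring
      · intro y hy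
        by_cases hx : S.layer x = j
        · rw [hK' x ω a y (by omega)]; ring
        · rw [hf x hx]; ring
    · have := ih (push K f) (j + 1) k (by omega) (push_eq_zero hK' hf)
      rw [Fin.val_succ, Function.iterate_succ_apply, ← this]
      exact sum_pathWeight_add (n := n) K (fun x ω a y => f x * K x ω a y)
        (fun τ => g (τ.state k.castSucc) (τ.outcome k) (τ.action k) (τ.state k.succ))

end PathSums

end

/-! ### State distributions, layered trajectories and the formula for occupancy measures. -/

section

theorem Layering.mem_next {X : Type*} [Fintype X] {L : ℕ} {S : Layering X L} {x x' : X} :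
    x' ∈ S.next x ↔ S.layer x' = S.layer x + 1 := by
  simp [Layering.next]

namespace MPP

variable {X Ω A : Type*} [Fintype X] [Fintype Ω] [Fintype A] {L : ℕ} {S : Layering X L}
  (M : MPP S Ω A) {φ : X → Ω → A → ℝ}

/-- The probability of a step `(ω, a, x')` from `x`. -/
def stepProb (φ : X → Ω → A → ℝ) (x : X) (ω : Ω) (a : A) (x' : X) : ℝ :=
  M.prior x ω * φ x ω a * M.trans x ω a x'

/-- The law of the state at step `k`. -/
def stateDist (φ : X → Ω → A → ℝ) (k : ℕ) : X → ℝ := by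
  classical exact (push (M.stepProb φ))^[k] fun x => if x = S.first then 1 else 0

theorem pathProb_eq (φ : X → Ω → A → ℝ) (τ : Traj X Ω A L) :
    M.pathProb φ τ = pathWeight (M.stepProb φ)
      (by classical exact fun x => if x = S.first then 1 else 0) τ := rfl

theorem trans_eq_zero (x : X) (ω : Ω) (a : A) (x' : X) (h : S.layer x' ≠ S.layer x + 1) :
    M.trans x ω a x' = 0 :=
  le_antisymm (not_lt.1 fun h' => h (M.trans_layer x ω a x' h')) (M.trans_nonneg x ω a x')

theorem sum_trans_next (x : X) (ω : Ω) (a : A) (hx : S.layer x < L) :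
    ∑ x' ∈ S.next x, M.trans x ω a x' = 1 := by
  rw [← M.trans_sum x ω a hx]
  exact Finset.sum_subset (Finset.subset_univ _) fun y _ hy =>
    M.trans_eq_zero x ω a y fun h => hy (Layering.mem_next.2 h)

theorem stepProb_eq_zero (φ : X → Ω → A → ℝ) (x : X) (ω : Ω) (a : A) (x' : X)
    (h : S.layer x' ≠ S.layer x + 1) : M.stepProb φ x ω a x' = 0 := by
  rw [stepProb, M.trans_eq_zero x ω a x' h, mul_zero]

theorem stepProb_nonneg (hφ : IsSignalingPolicy φ) (x : X) (ω : Ω) (a : A) (x' : X) :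
    0 ≤ M.stepProb φ x ω a x' :=
  mul_nonneg (mul_nonneg ((M.prior_mem x).1 ω) ((hφ x ω).1 a)) (M.trans_nonneg x ω a x')

theorem stepProb_sum (hφ : IsSignalingPolicy φ) (x : X) (hx : S.layer x < L) :
    ∑ ω, ∑ a, ∑ x', M.stepProb φ x ω a x' = 1 := by
  simp only [stepProb, ← Finset.mul_sum, M.trans_sum x _ _ hx, mul_one, (hφ x _).2,
    (M.prior_mem x).2]

theorem stateDist_succ (φ : X → Ω → A → ℝ) (k : ℕ) (x' : X) :
    M.stateDist φ (k + 1) x' = ∑ x, ∑ ω, ∑ a, M.stateDist φ k x * M.stepProb φ x ω a x' := by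
  simp only [stateDist, Function.iterate_succ_apply']
  rfl

theorem stateDist_eq_zero (φ : X → Ω → A → ℝ) (k : ℕ) (x : X) (hx : S.layer x ≠ k) :
    M.stateDist φ k x = 0 := by
  classical
  induction k generalizing x with
  | zero =>
    have : x ≠ S.first := fun h => hx ((S.layer_eq_zero_iff x).2 h)
    simp [stateDist, this]
  | succ k ih =>
    have := push_eq_zero (M.stepProb_eq_zero φ) ih x hx
    simpa only [stateDist, Function.iterate_succ_apply'] using this

theorem stateDist_nonneg (hφ : IsSignalingPolicy φ) (k : ℕ) (x : X) : 0 ≤ M.stateDist φ k x := by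
  classical
  induction k generalizing x with
  | zero => simp only [stateDist, Function.iterate_zero, id]; split_ifs <;> simp
  | succ k ih =>
    rw [stateDist_succ]
    exact Finset.sum_nonneg fun y _ => Finset.sum_nonneg fun ω _ => Finset.sum_nonneg fun a _ =>
      mul_nonneg (ih y) (M.stepProb_nonneg hφ y ω a x)

theorem sum_stateDist (hφ : IsSignalingPolicy φ) (k : ℕ) (hk : k ≤ L) :
    ∑ x, M.stateDist φ k x = 1 := by
  classical
  induction k with
  | zero => simp [stateDist]
  | succ k ih =>
    rw [← ih (by omega), ← sum_push (j := k) (by omega) (M.stepProb_sum hφ)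
      (M.stateDist_eq_zero φ k)]
    simp only [stateDist, Function.iterate_succ_apply']

theorem pathProb_nonneg (hφ : IsSignalingPolicy φ) (τ : Traj X Ω A L) : 0 ≤ M.pathProb φ τ := by
  unfold pathProb
  refine mul_nonneg (by split_ifs <;> simp) (Finset.prod_nonneg fun k _ => ?_)
  exact M.stepProb_nonneg hφ _ _ _ _

theorem sum_pathProb (hφ : IsSignalingPolicy φ) : ∑ τ : Traj X Ω A L, M.pathProb φ τ = 1 := by
  classical
  simp only [pathProb_eq]
  rw [sum_pathWeight (M.stepProb_sum hφ) (M.stepProb_eq_zero φ) L _ 0 (by omega)]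
  · simp
  · intro x hx
    have : x ≠ S.first := fun h => hx ((S.layer_eq_zero_iff x).2 h)
    simp [this]

theorem sum_pathProb_mul_step (hφ : IsSignalingPolicy φ) (k : Fin L) (g : X → Ω → A → X → ℝ) :
    ∑ τ : Traj X Ω A L, M.pathProb φ τ *
        g (τ.state k.castSucc) (τ.outcome k) (τ.action k) (τ.state k.succ) =
      ∑ x, ∑ ω, ∑ a, ∑ x', M.stateDist φ k x * M.stepProb φ x ω a x' * g x ω a x' := by
  classical
  simp only [pathProb_eq]
  rw [sum_pathWeight_mul_step (M.stepProb_sum hφ) (M.stepProb_eq_zero φ) g L _ 0 k (by omega)]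
  · rfl
  · intro x hx
    have : x ≠ S.first := fun h => hx ((S.layer_eq_zero_iff x).2 h)
    simp [this]

end MPP

/-- The `k`-th state of the trajectory lies in the `k`-th layer. -/
def Traj.Layered {X Ω A : Type*} {L : ℕ} (S : Layering X L) (τ : Traj X Ω A L) : Prop :=
  ∀ k, S.layer (τ.state k) = k

namespace Traj.Layered

variable {X Ω A : Type*} {L : ℕ} {S : Layering X L} {τ : Traj X Ω A L}

theorem eq_of_castSucc (h : τ.Layered S) {k : Fin L} {x : X} (hk : τ.state k.castSucc = x) :
    (k : ℕ) = S.layer x := by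
  rw [← hk, h k.castSucc]; rfl

/-- Layers determine the time of a visit, so the existential over steps collapses to the single step
`S.layer x`. The same holds for the other three kinds of visits. -/
theorem visitsX_iff (h : τ.Layered S) {x : X} (hx : S.layer x < L) :
    τ.VisitsX x ↔ τ.state (Fin.castSucc ⟨S.layer x, hx⟩) = x := by
  constructor
  · rintro ⟨k, hk⟩
    have : k = Fin.castSucc ⟨S.layer x, hx⟩ := Fin.ext (by rw [← h k, hk]; rfl)
    rwa [← this]
  · exact fun h => ⟨_, h⟩

theorem visitsXO_iff (h : τ.Layered S) {x : X} (hx : S.layer x < L) {ω : Ω} :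
    τ.VisitsXO x ω ↔ τ.state (Fin.castSucc ⟨S.layer x, hx⟩) = x ∧
      τ.outcome ⟨S.layer x, hx⟩ = ω := by
  constructor
  · rintro ⟨k, hk, hk'⟩
    have : k = ⟨S.layer x, hx⟩ := Fin.ext (h.eq_of_castSucc hk)
    rw [← this]; exact ⟨hk, hk'⟩
  · exact fun h => ⟨_, h⟩

theorem visitsXOA_iff (h : τ.Layered S) {x : X} (hx : S.layer x < L) {ω : Ω} {a : A} :
    τ.VisitsXOA x ω a ↔ τ.At ⟨S.layer x, hx⟩ x ω a := by
  constructor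
  · rintro ⟨k, hk⟩
    have : k = ⟨S.layer x, hx⟩ := Fin.ext (h.eq_of_castSucc hk.1)
    rwa [← this]
  · exact fun h => ⟨_, h⟩

theorem visitsXOAX_iff (h : τ.Layered S) {x : X} (hx : S.layer x < L) {ω : Ω} {a : A} {x' : X} :
    τ.VisitsXOAX x ω a x' ↔ τ.At ⟨S.layer x, hx⟩ x ω a ∧
      τ.state (Fin.succ ⟨S.layer x, hx⟩) = x' := by
  constructor
  · rintro ⟨k, hk⟩
    have : k = ⟨S.layer x, hx⟩ := Fin.ext (h.eq_of_castSucc hk.1.1)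
    rwa [← this]
  · exact fun h => ⟨_, h⟩

end Traj.Layered

namespace MPP

variable {X Ω A : Type*} [Fintype X] [Fintype Ω] [Fintype A] {L : ℕ} {S : Layering X L}
  (M : MPP S Ω A) {φ : X → Ω → A → ℝ}

theorem layered_of_pathProb_ne_zero {τ : Traj X Ω A L} (h : M.pathProb φ τ ≠ 0) :
    τ.Layered S := by
  unfold pathProb at h
  have h0 : τ.state 0 = S.first := by
    by_contra h'
    simp [h'] at h
  have hs := Finset.prod_ne_zero_iff.1 (right_ne_zero_of_mul h)
  intro k
  induction k using Fin.induction with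
  | zero => rw [h0, (S.layer_eq_zero_iff _).2 rfl]; rfl
  | succ k ih =>
    have := right_ne_zero_of_mul (hs k (Finset.mem_univ k))
    have := M.trans_layer _ _ _ _ (lt_of_le_of_ne (M.trans_nonneg _ _ _ _) this.symm)
    rw [this, ih]; simp

theorem trajLaw_apply (hφ : IsSignalingPolicy φ) (s : Set (Traj X Ω A L)) [DecidablePred (· ∈ s)] :
    (M.trajLaw φ).real s = ∑ τ, M.pathProb φ τ * if τ ∈ s then 1 else 0 := by
  rw [Measure.real, trajLaw, Measure.finsetSum_apply, ENNReal.toReal_sum]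
  · refine Finset.sum_congr rfl fun τ _ => ?_
    simp only [Measure.smul_apply, Measure.dirac_apply, smul_eq_mul, ENNReal.toReal_mul,
      ENNReal.toReal_ofReal (M.pathProb_nonneg hφ τ), Set.indicator_apply]
    split_ifs <;> simp
  · intro τ _
    simp only [Measure.smul_apply, Measure.dirac_apply, smul_eq_mul]
    exact ENNReal.mul_ne_top ENNReal.ofReal_ne_top (by simp [Set.indicator_apply]; split_ifs <;> simp)

/-- The tuple can only occur at step `S.layer x`, so its visit probability is the marginal of that
step. In the final layer both sides vanish. -/
theorem occ_eq (hφ : IsSignalingPolicy φ) (x : X) (ω : Ω) (a : A) (x' : X) :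
    M.occ φ x ω a x' = M.stateDist φ (S.layer x) x * M.stepProb φ x ω a x' := by
  classical
  rw [occ, M.trajLaw_apply hφ]
  by_cases hx : S.layer x < L
  · have := M.sum_pathProb_mul_step hφ ⟨S.layer x, hx⟩
      (fun y o b y' => if (y = x ∧ o = ω ∧ b = a) ∧ y' = x' then 1 else 0)
    rw [Finset.sum_eq_single x, Finset.sum_eq_single ω, Finset.sum_eq_single a,
      Finset.sum_eq_single x'] at this
    · simp only [and_self, if_true, mul_one] at this
      rw [← this]
      refine Finset.sum_congr rfl fun τ _ => ?_
      by_cases hτ : M.pathProb φ τ = 0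
      · simp [hτ]
      · have hl := M.layered_of_pathProb_ne_zero hτ
        simp only [Set.mem_ofPred_eq, hl.visitsXOAX_iff hx, Traj.At]
    all_goals simp +contextual
  · rw [Finset.sum_eq_zero, M.stepProb_eq_zero, mul_zero]
    · have := S.layer_le x'; omega
    · intro τ _
      by_cases hτ : M.pathProb φ τ = 0
      · simp [hτ]
      · have hl := M.layered_of_pathProb_ne_zero hτ
        rw [if_neg, mul_zero]
        rintro ⟨k, hk⟩
        have := hl.eq_of_castSucc hk.1.1
        omega

end MPP

end

/-! ### Marginals of occupancy measures, and Hoeffding's lemma. -/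

section

namespace MPP

variable {X Ω A : Type*} [Fintype X] [Fintype Ω] [Fintype A] {L : ℕ} {S : Layering X L}
  (M : MPP S Ω A) {φ : X → Ω → A → ℝ}

theorem occ_nonneg (x : X) (ω : Ω) (a : A) (x' : X) : 0 ≤ M.occ φ x ω a x' :=
  measureReal_nonneg

theorem occ_eq_trans (hφ : IsSignalingPolicy φ) (x : X) (ω : Ω) (a : A) (x' : X) :
    M.occ φ x ω a x' = (M.occ φ).xoa x ω a * M.trans x ω a x' := by
  by_cases hx : S.layer x < L
  · simp only [Occ.xoa, M.occ_eq hφ, stepProb, ← Finset.mul_sum, M.trans_sum x _ _ hx]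
    ring
  · have := S.layer_le x'
    rw [M.occ_eq hφ, stepProb, M.trans_eq_zero x ω a x' (by omega)]
    ring

theorem occ_xoa (hφ : IsSignalingPolicy φ) {x : X} (hx : S.layer x < L) (ω : Ω) (a : A) :
    (M.occ φ).xoa x ω a = M.stateDist φ (S.layer x) x * M.prior x ω * φ x ω a := by
  simp only [Occ.xoa, M.occ_eq hφ, stepProb, ← Finset.mul_sum, M.trans_sum x _ _ hx]
  ring

theorem occ_xo (hφ : IsSignalingPolicy φ) {x : X} (hx : S.layer x < L) (ω : Ω) :
    (M.occ φ).xo x ω = M.stateDist φ (S.layer x) x * M.prior x ω := by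
  simp only [Occ.xo, M.occ_xoa hφ hx, ← Finset.mul_sum, (hφ x ω).2, mul_one]

theorem occ_ofState (hφ : IsSignalingPolicy φ) {x : X} (hx : S.layer x < L) :
    (M.occ φ).ofState x = M.stateDist φ (S.layer x) x := by
  simp only [Occ.ofState, M.occ_xo hφ hx, ← Finset.mul_sum, (M.prior_mem x).2, mul_one]

theorem sum_layer_occ_ofState (hφ : IsSignalingPolicy φ) {k : ℕ} (hk : k < L) :
    ∑ x with S.layer x = k, (M.occ φ).ofState x = 1 := by
  rw [← M.sum_stateDist hφ k hk.le, Finset.sum_filter]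
  refine Finset.sum_congr rfl fun x _ => ?_
  split_ifs with h
  · rw [M.occ_ofState hφ (by omega), h]
  · rw [M.stateDist_eq_zero φ k x h]

theorem occ_flow (hφ : IsSignalingPolicy φ) {x : X} (h1 : 1 ≤ S.layer x) (hx : S.layer x < L) :
    ∑ x', ∑ ω, ∑ a, M.occ φ x' ω a x = (M.occ φ).ofState x := by
  obtain ⟨k, hk⟩ : ∃ k, S.layer x = k + 1 := ⟨S.layer x - 1, by omega⟩
  rw [M.occ_ofState hφ hx, hk, M.stateDist_succ]
  refine Finset.sum_congr rfl fun y _ => Finset.sum_congr rfl fun ω _ =>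
    Finset.sum_congr rfl fun a _ => ?_
  rw [M.occ_eq hφ]
  by_cases hy : S.layer y = k
  · rw [hy]
  · rw [M.stepProb_eq_zero φ y ω a x (by omega), mul_zero, mul_zero]

/-- After exchanging sums, each state contributes at one step only. This is the link from linear
functionals of `M.occ φ` to sums along random trajectories. -/
theorem value_occ (hφ : IsSignalingPolicy φ) (c : X → Ω → A → ℝ) :
    Occ.value c (M.occ φ) = ∑ τ : Traj X Ω A L, M.pathProb φ τ *
      ∑ k : Fin L, c (τ.state k.castSucc) (τ.outcome k) (τ.action k) := by
  simp only [Finset.mul_sum, Occ.value]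
  refine Eq.trans ?_ Finset.sum_comm
  simp only [M.sum_pathProb_mul_step hφ _ fun x ω a _ => c x ω a]
  refine Eq.trans ?_ Finset.sum_comm
  refine Finset.sum_congr rfl fun x _ => ?_
  refine Eq.trans ?_ Finset.sum_comm
  refine Finset.sum_congr rfl fun ω _ => ?_
  refine Eq.trans ?_ Finset.sum_comm
  refine Finset.sum_congr rfl fun a _ => ?_
  refine Eq.trans ?_ Finset.sum_comm
  rw [Occ.xoa, Finset.sum_mul]
  refine Finset.sum_congr rfl fun x' _ => ?_
  rw [M.occ_eq hφ]
  by_cases hx : S.layer x < L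
  · rw [Finset.sum_eq_single ⟨S.layer x, hx⟩]
    · intro k _ hk
      rw [M.stateDist_eq_zero φ k x fun h => hk (Fin.ext h.symm)]
      ring
    · simp
  · have := S.layer_le x'
    simp [M.stepProb_eq_zero φ x ω a x' (by omega)]

end MPP

/-- **Hoeffding's lemma** for a variable with values in `[-1, 1]`. -/
theorem integral_exp_centered_le_one {α : Type*} [MeasurableSpace α] (ν : Measure α)
    [IsProbabilityMeasure ν] {z : α → ℝ} (hz : AEMeasurable z ν)
    (hb : ∀ᵐ y ∂ν, z y ∈ Set.Icc (-1 : ℝ) 1) (l : ℝ) :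
    ∫ y, Real.exp (l * (z y - ∫ y, z y ∂ν) - l ^ 2 / 2) ∂ν ≤ 1 := by
  have h := (ProbabilityTheory.hasSubgaussianMGF_of_mem_Icc hz hb).mgf_le l
  simp only [ProbabilityTheory.mgf] at h
  simp only [Real.exp_sub, integral_div]
  rw [div_le_one (Real.exp_pos _)]
  -- The variance proxy is the squared half-length of `[-1, 1]`, which equals one.
  refine h.trans (Real.exp_le_exp.2 (le_of_eq ?_))
  norm_num

theorem lintegral_exp_centered_le_one {α : Type*} [MeasurableSpace α] (ν : Measure α)
    [IsProbabilityMeasure ν] {z : α → ℝ} (hz : AEMeasurable z ν)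
    (hb : ∀ᵐ y ∂ν, z y ∈ Set.Icc (-1 : ℝ) 1) (l : ℝ) :
    ∫⁻ y, ENNReal.ofReal (Real.exp (l * (z y - ∫ y, z y ∂ν) - l ^ 2 / 2)) ∂ν ≤ 1 := by
  have hi : Integrable (fun y => Real.exp (l * (z y - ∫ y, z y ∂ν) - l ^ 2 / 2)) ν := by
    simp only [Real.exp_sub]
    exact ((ProbabilityTheory.hasSubgaussianMGF_of_mem_Icc hz hb).integrable_exp_mul l).div_const _
  rw [← ofReal_integral_eq_lintegral_ofReal hi (ae_of_all _ fun y => (Real.exp_pos _).le)]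
  exact ENNReal.ofReal_le_one.2 (integral_exp_centered_le_one ν hz hb l)

theorem sum_exp_centered_le_one {ι : Type*} [Fintype ι] {p : ι → ℝ} (hp : p ∈ stdSimplex ℝ ι)
    {z : ι → ℝ} (hz : ∀ i, z i ∈ Set.Icc (-1 : ℝ) 1) (l : ℝ) :
    ∑ i, p i * Real.exp (l * (z i - ∑ j, p j * z j) - l ^ 2 / 2) ≤ 1 := by
  let _ : MeasurableSpace ι := ⊤
  let ν : Measure ι := ∑ i, ENNReal.ofReal (p i) • Measure.dirac i
  have hint : ∀ f : ι → ℝ, ∫ y, f y ∂ν = ∑ i, p i * f i := fun f => by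
    rw [integral_finsetSum_measure]
    · simp [integral_smul_measure, ENNReal.toReal_ofReal (hp.1 _)]
    · exact fun i _ => (integrable_dirac (by simp)).smul_measure ENNReal.ofReal_ne_top
  have : IsProbabilityMeasure ν := ⟨by
    simp only [ν, Measure.finsetSum_apply, Measure.smul_apply, measure_univ, smul_eq_mul, mul_one]
    rw [← ENNReal.ofReal_sum_of_nonneg fun i _ => hp.1 i, hp.2, ENNReal.ofReal_one]⟩
  have := integral_exp_centered_le_one ν (z := z) (measurable_from_top.aemeasurable) (ae_of_all _ hz) l
  rwa [hint, hint] at this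

end

/-! ### Measurability of the interaction, and products of test factors. -/

section

variable {X Ω A : Type*} [Fintype X] [Fintype Ω] [Fintype A] {L : ℕ} {S : Layering X L}

instance : MeasurableSingletonClass (Traj X Ω A L) := ⟨fun _ => trivial⟩

/-- What is observed along `τ` if the reward functions are `r`. -/
def Traj.readOff (τ : Traj X Ω A L) (r : (X → Ω → A → ℝ) × (X → Ω → A → ℝ)) : Episode X Ω A L :=
  (τ, (fun k => r.1 (τ.state k.castSucc) (τ.outcome k) (τ.action k)),
    (fun k => r.2 (τ.state k.castSucc) (τ.outcome k) (τ.action k)))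

theorem Traj.measurable_readOff (τ : Traj X Ω A L) : Measurable τ.readOff := by
  unfold Traj.readOff; fun_prop

theorem Traj.measurable_readOff_uncurry :
    Measurable fun p : Traj X Ω A L × ((X → Ω → A → ℝ) × (X → Ω → A → ℝ)) => p.1.readOff p.2 :=
  measurable_from_prod_countable_right' (fun τ => τ.measurable_readOff) (by
    rintro x y r h
    rw [measurableAtom_of_measurableSingletonClass] at h
    rw [Set.mem_singleton_iff.1 h])

theorem measurable_of_forall_traj {β γ : Type*} [MeasurableSpace β] [MeasurableSpace γ]
    {f : β → Traj X Ω A L → γ} (hf : ∀ τ, Measurable fun b => f b τ) :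
    Measurable fun p : β × Traj X Ω A L => f p.1 p.2 :=
  measurable_from_prod_countable_left fun τ => hf τ

namespace MPP

variable (M : MPP S Ω A)

theorem lintegral_episodeLaw (φ : X → Ω → A → ℝ) {f : Episode X Ω A L → ENNReal}
    (hf : Measurable f) :
    ∫⁻ e, f e ∂M.episodeLaw φ =
      ∑ τ, ENNReal.ofReal (M.pathProb φ τ) * ∫⁻ r, f (τ.readOff r) ∂M.rewardLaw := by
  have := M.rewardLaw_prob
  have h : M.episodeLaw φ = ((M.trajLaw φ).prod M.rewardLaw).map
    fun p => p.1.readOff p.2 := rfl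
  rw [h, lintegral_map hf Traj.measurable_readOff_uncurry, lintegral_prod]
  · rw [trajLaw, lintegral_finsetSum_measure]
    refine Finset.sum_congr rfl fun τ _ => ?_
    rw [lintegral_smul_measure, lintegral_dirac, smul_eq_mul]
  · exact (hf.comp Traj.measurable_readOff_uncurry).aemeasurable

theorem isProbabilityMeasure_episodeLaw {φ : X → Ω → A → ℝ} (hφ : IsSignalingPolicy φ) :
    IsProbabilityMeasure (M.episodeLaw φ) := ⟨by
  have := M.rewardLaw_prob
  rw [← lintegral_one, M.lintegral_episodeLaw φ measurable_const]
  simp only [lintegral_one, measure_univ, mul_one]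
  rw [← ENNReal.ofReal_sum_of_nonneg fun τ _ => M.pathProb_nonneg hφ τ, M.sum_pathProb hφ,
    ENNReal.ofReal_one]⟩

theorem measurable_pathProb {β : Type*} [MeasurableSpace β] {f : β → X → Ω → A → ℝ}
    (hf : Measurable f) (τ : Traj X Ω A L) : Measurable fun b => M.pathProb (f b) τ := by
  unfold pathProb; fun_prop

end MPP

theorem History.measurable_before {T : ℕ} (t : Fin T) :
    Measurable fun h : History X Ω A L T => h.before t := by
  unfold History.before; fun_prop

theorem measurable_snoc (t : ℕ) :
    Measurable fun p : History X Ω A L t × Episode X Ω A L =>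
      (Fin.snoc (α := fun _ => Episode X Ω A L) p.1 p.2 : History X Ω A L (t + 1)) := by
  refine measurable_pi_iff.2 fun i => ?_
  refine Fin.lastCases ?_ (fun i => ?_) i
  · simpa only [Fin.snoc_last] using measurable_snd
  · simp only [Fin.snoc_castSucc]; fun_prop

namespace OPPS

variable {T : ℕ} {α δ : ℝ} (alg : OPPS S Ω A T α δ) (M : MPP S Ω A)

theorem measurable_lintegral_episodeLaw (t : ℕ) {f : History X Ω A L t → Episode X Ω A L → ENNReal}
    (hf : Measurable (Function.uncurry f)) :
    Measurable fun h => ∫⁻ e, f h e ∂M.episodeLaw (alg.policy t h) := by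
  have := M.rewardLaw_prob
  have hf' : ∀ h, Measurable (f h) := fun h => hf.comp measurable_prodMk_left
  simp only [M.lintegral_episodeLaw _ (hf' _)]
  refine Finset.measurable_sum _ fun τ _ => ?_
  refine ((M.measurable_pathProb (alg.measurable_policy t) τ).ennreal_ofReal).mul ?_
  have := hf.comp (measurable_fst.prodMk (τ.measurable_readOff.comp measurable_snd) :
    Measurable fun p : History X Ω A L t × ((X → Ω → A → ℝ) × (X → Ω → A → ℝ)) =>
      (p.1, τ.readOff p.2))
  exact this.lintegral_prod_right'

theorem measurable_historyKernel (t : ℕ) :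
    Measurable fun h : History X Ω A L t => (M.episodeLaw (alg.policy t h)).map
      (Fin.snoc (α := fun _ => Episode X Ω A L) h) := by
  refine Measure.measurable_of_measurable_coe _ fun s hs => ?_
  have hsn : ∀ h : History X Ω A L t,
      Measurable (Fin.snoc (α := fun _ => Episode X Ω A L) h : _ → History X Ω A L (t + 1)) :=
    fun h => (measurable_snoc t).comp measurable_prodMk_left
  have : ∀ h : History X Ω A L t, (M.episodeLaw (alg.policy t h)).map
      (Fin.snoc (α := fun _ => Episode X Ω A L) h) s =
      ∫⁻ e, s.indicator (fun _ => (1 : ENNReal)) (Fin.snoc (α := fun _ => Episode X Ω A L) h e)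
        ∂M.episodeLaw (alg.policy t h) := fun h => by
    rw [← lintegral_indicator_one hs, lintegral_map (measurable_one.indicator hs) (hsn h)]
    rfl
  simp only [this]
  exact alg.measurable_lintegral_episodeLaw M t
    ((measurable_const.indicator hs).comp (measurable_snoc t))

theorem lintegral_historyLaw_succ (t : ℕ) {f : History X Ω A L (t + 1) → ENNReal}
    (hf : Measurable f) :
    ∫⁻ h, f h ∂alg.historyLaw M (t + 1) =
      ∫⁻ h, ∫⁻ e, f (Fin.snoc (α := fun _ => Episode X Ω A L) h e)
        ∂M.episodeLaw (alg.policy t h) ∂alg.historyLaw M t := by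
  rw [historyLaw, Measure.lintegral_bind (alg.measurable_historyKernel M t).aemeasurable
    hf.aemeasurable]
  refine lintegral_congr fun h => ?_
  exact lintegral_map hf ((measurable_snoc t).comp measurable_prodMk_left :
    Measurable fun e => (Fin.snoc (α := fun _ => Episode X Ω A L) h e : History X Ω A L (t + 1)))

theorem isProbabilityMeasure_historyLaw (t : ℕ) : IsProbabilityMeasure (alg.historyLaw M t) := by
  induction t with
  | zero => rw [historyLaw]; infer_instance
  | succ t ih =>
    constructor
    rw [← lintegral_one, alg.lintegral_historyLaw_succ M t measurable_const]
    have : ∀ h, IsProbabilityMeasure (M.episodeLaw (alg.policy t h)) := fun h =>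
      M.isProbabilityMeasure_episodeLaw (alg.isSignalingPolicy t h)
    simp

theorem before_snoc {t : ℕ} (h : History X Ω A L t) (e : Episode X Ω A L) (s : Fin t) :
    History.before (Fin.snoc (α := fun _ => Episode X Ω A L) h e : History X Ω A L (t + 1))
      s.castSucc = h.before s := by
  funext i
  have : Fin.castLE s.castSucc.isLt.le i = Fin.castSucc (Fin.castLE s.isLt.le i) := rfl
  simp only [History.before]
  rw [this, Fin.snoc_castSucc]

theorem before_snoc_last {t : ℕ} (h : History X Ω A L t) (e : Episode X Ω A L) :
    History.before (Fin.snoc (α := fun _ => Episode X Ω A L) h e : History X Ω A L (t + 1))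
      (Fin.last t) = h := by
  funext i
  have : Fin.castLE (Fin.last t).isLt.le i = Fin.castSucc i := rfl
  simp only [History.before]
  rw [this, Fin.snoc_castSucc]

theorem measurable_prod_before (G : ∀ t, History X Ω A L t → Episode X Ω A L → ENNReal)
    (hG : ∀ t, Measurable (Function.uncurry (G t))) (t : ℕ) :
    Measurable fun h : History X Ω A L t => ∏ s : Fin t, G s (h.before s) (h s) :=
  Finset.measurable_prod _ fun s _ =>
    (hG s).comp ((History.measurable_before s).prodMk (measurable_pi_apply s))

/-- Products of conditional test factors have expectation at most one. -/
theorem lintegral_prod_le_one (G : ∀ t, History X Ω A L t → Episode X Ω A L → ENNReal)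
    (hG : ∀ t, Measurable (Function.uncurry (G t)))
    (h1 : ∀ t h, ∫⁻ e, G t h e ∂M.episodeLaw (alg.policy t h) ≤ 1) (t : ℕ) :
    ∫⁻ h, ∏ s : Fin t, G s (h.before s) (h s) ∂alg.historyLaw M t ≤ 1 := by
  induction t with
  | zero => simp [historyLaw]
  | succ t ih =>
    rw [alg.lintegral_historyLaw_succ M t (measurable_prod_before G hG (t + 1))]
    -- Given the first `t` episodes, all factors but the last are constants, and the last integrates
    -- to at most one.
    refine le_trans (lintegral_mono fun h => ?_) ih
    have : ∀ e : Episode X Ω A L, ∏ s : Fin (t + 1),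
        G s (History.before (Fin.snoc (α := fun _ => Episode X Ω A L) h e) s)
          (Fin.snoc (α := fun _ => Episode X Ω A L) h e s) =
        (∏ s : Fin t, G s (h.before s) (h s)) * G t h e := fun e => by
      rw [Fin.prod_univ_castSucc]
      congr 1
      · refine Finset.prod_congr rfl fun s _ => ?_
        rw [before_snoc, Fin.snoc_castSucc]; rfl
      · rw [before_snoc_last, Fin.snoc_last]; rfl
    simp only [this]
    have hm : Measurable (G t h) := (hG t).comp measurable_prodMk_left
    rw [lintegral_const_mul _ hm]
    exact mul_le_of_le_one_right' (h1 t h)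

end OPPS

end

/-! ### Visit counts, and deviations along a random number of visits. -/

section

variable {X Ω A : Type*} [Fintype X] [Fintype Ω] [Fintype A] {L : ℕ} {S : Layering X L}

open Classical in
/-- The number of episodes whose trajectory has property `V`. -/
def visitCount {t : ℕ} (V : Traj X Ω A L → Prop) (h : History X Ω A L t) : ℕ :=
  (Finset.univ.filter fun s : Fin t => V (h s).1).card

open Classical in
/-- The sum of `Z` over the episodes whose trajectory has property `V`. -/
def visitSum {t : ℕ} (V : Traj X Ω A L → Prop) (Z : Episode X Ω A L → ℝ)
    (h : History X Ω A L t) : ℝ :=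
  ∑ s : Fin t, if V (h s).1 then Z (h s) else 0

theorem sum_castLE {T : ℕ} {β : Type*} [AddCommMonoid β] (t : Fin T) (f : Fin T → β) :
    ∑ i : Fin t, f (Fin.castLE t.isLt.le i) = ∑ s with s < t, f s := by
  refine Finset.sum_bij (fun i _ => Fin.castLE t.isLt.le i) ?_ ?_ ?_ ?_
  · intro i _
    simp only [Finset.mem_filter, Finset.mem_univ, true_and]
    exact i.isLt
  · intro i _ j _ h
    exact Fin.ext (by simpa [Fin.ext_iff] using h)
  · intro s hs
    simp only [Finset.mem_filter, Finset.mem_univ, true_and] at hs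
    exact ⟨⟨s, hs⟩, Finset.mem_univ _, rfl⟩
  · intro i _; rfl

open Classical in
theorem visitCount_before {T : ℕ} (V : Traj X Ω A L → Prop) (h : History X Ω A L T) (t : Fin T) :
    visitCount V (h.before t) = (Finset.univ.filter fun s : Fin T => s < t ∧ V (h s).1).card := by
  rw [visitCount, Finset.card_filter, Finset.card_filter]
  have := sum_castLE t fun s => if V (h s).1 then 1 else 0
  rw [Finset.sum_filter] at this
  simp only [← ite_and] at this
  exact this

open Classical in
theorem visitSum_before {T : ℕ} (V : Traj X Ω A L → Prop) (Z : Episode X Ω A L → ℝ)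
    (h : History X Ω A L T) (t : Fin T) :
    visitSum V Z (h.before t) = ∑ s with s < t, if V (h s).1 then Z (h s) else 0 :=
  sum_castLE t fun s => if V (h s).1 then Z (h s) else 0

theorem visitCount_before_mono {T : ℕ} (V : Traj X Ω A L → Prop) (h : History X Ω A L T)
    {s t : Fin T} (hst : s ≤ t) : visitCount V (h.before s) ≤ visitCount V (h.before t) := by
  classical
  rw [visitCount_before, visitCount_before]
  refine Finset.card_le_card fun i hi => ?_
  simp only [Finset.mem_filter, Finset.mem_univ, true_and] at hi ⊢
  exact ⟨hi.1.trans_le hst, hi.2⟩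

theorem visitCount_before_lt {T : ℕ} (V : Traj X Ω A L → Prop) (h : History X Ω A L T)
    {s t : Fin T} (hst : s < t) (hs : V (h s).1) :
    visitCount V (h.before s) < visitCount V (h.before t) := by
  classical
  rw [visitCount_before, visitCount_before]
  refine Finset.card_lt_card ⟨fun i hi => ?_, fun hsub => ?_⟩
  · simp only [Finset.mem_filter, Finset.mem_univ, true_and] at hi ⊢
    exact ⟨hi.1.trans hst, hi.2⟩
  · have := hsub (show s ∈ Finset.univ.filter fun i : Fin T => i < t ∧ V (h i).1 by simp [hst, hs])
    simp at this

open Classical in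
/-- The sum stopped after the `n`-th visit agrees with the sum up to a time with `n` visits. -/
theorem sum_stopped_eq {T : ℕ} (V : Traj X Ω A L → Prop) (Z : Episode X Ω A L → ℝ)
    (h : History X Ω A L T) (t : Fin T) :
    (∑ s : Fin T, if V (h s).1 ∧ visitCount V (h.before s) < visitCount V (h.before t)
      then Z (h s) else 0) = visitSum V Z (h.before t) := by
  rw [visitSum_before, Finset.sum_filter]
  refine Finset.sum_congr rfl fun s _ => ?_
  by_cases hst : s < t
  · by_cases hs : V (h s).1
    · simp [hst, hs, visitCount_before_lt V h hst hs]
    · simp [hs]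
  · have := visitCount_before_mono V h (not_lt.1 hst)
    simp [hst, not_lt.2 this]

theorem measurable_visitCount {t : ℕ} (V : Traj X Ω A L → Prop) :
    Measurable fun h : History X Ω A L t => visitCount V h := by
  classical
  simp only [visitCount, Finset.card_filter]
  refine Finset.measurable_sum _ fun s _ => ?_
  have : Measurable fun τ : Traj X Ω A L => if V τ then 1 else 0 := measurable_from_top
  exact this.comp ((measurable_pi_apply s).fst)

theorem visitSum_const {t : ℕ} (V : Traj X Ω A L → Prop) (c : ℝ) (h : History X Ω A L t) :
    visitSum V (fun _ => c) h = visitCount V h * c := by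
  classical
  simp [visitSum, visitCount, ← Finset.sum_filter]

theorem visitSum_mul_sub {t : ℕ} (V : Traj X Ω A L → Prop) (Z : Episode X Ω A L → ℝ) (l c : ℝ)
    (h : History X Ω A L t) :
    visitSum V (fun e => l * Z e - c) h = l * visitSum V Z h - visitCount V h * c := by
  classical
  rw [← visitSum_const]
  simp only [visitSum, Finset.mul_sum, ← Finset.sum_sub_distrib]
  exact Finset.sum_congr rfl fun s _ => by split_ifs <;> simp

theorem visitCount_le {t : ℕ} (V : Traj X Ω A L → Prop) (h : History X Ω A L t) :
    visitCount V h ≤ t := by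
  classical
  exact (Finset.card_filter_le _ _).trans (by simp)

namespace OPPS

variable {T : ℕ} {α δ : ℝ} (alg : OPPS S Ω A T α δ) (M : MPP S Ω A)

open Classical in
-- Chernoff's method for the process stopped at its `n`-th visit: the exponential product has mean
-- at most one, and on the event it is at least `exp c`.
theorem measure_deviation_count_le (V : Traj X Ω A L → Prop) {Z : Episode X Ω A L → ℝ}
    (hZ : Measurable Z)
    (hexp : ∀ φ, IsSignalingPolicy φ → ∀ l : ℝ, ∫⁻ e, (if V e.1 then
      ENNReal.ofReal (Real.exp (l * Z e - l ^ 2 / 2)) else 1) ∂M.episodeLaw φ ≤ 1)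
    {c : ℝ} (hc : 0 < c) {n : ℕ} (hn : 1 ≤ n) :
    alg.historyLaw M T {h | ∃ t : Fin T, visitCount V (h.before t) = n ∧
      √(2 * c * n) < visitSum V Z (h.before t)} ≤ ENNReal.ofReal (Real.exp (-c)) := by
  -- This `l` maximizes `l * √(2 * c * n) - n * l ^ 2 / 2`, and the maximum is `c`.
  set l : ℝ := √(2 * c / n) with hl
  have hn0 : (0 : ℝ) < n := by exact_mod_cast hn
  -- The factor is frozen at one after `n` visits. The product over all `T` episodes thus keeps the
  -- value it has at the time `t` of the event, and no maximal inequality is needed.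
  let G : ∀ t, History X Ω A L t → Episode X Ω A L → ENNReal := fun t h e =>
    if V e.1 ∧ visitCount V h < n then ENNReal.ofReal (Real.exp (l * Z e - l ^ 2 / 2)) else 1
  have hG : ∀ t, Measurable (Function.uncurry (G t)) := fun t => by
    refine Measurable.ite ?_ ?_ measurable_const
    · have h1 : MeasurableSet {τ : Traj X Ω A L | V τ} := trivial
      have h2 := measurableSet_lt (measurable_visitCount (t := t) V) (measurable_const (a := n))
      exact (measurable_snd.fst h1).inter (measurable_fst h2)
    · have : Measurable fun e => ENNReal.ofReal (Real.exp (l * Z e - l ^ 2 / 2)) := by fun_prop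
      exact this.comp measurable_snd
  have hG1 : ∀ t h, ∫⁻ e, G t h e ∂M.episodeLaw (alg.policy t h) ≤ 1 := fun t h => by
    by_cases hN : visitCount V h < n
    · simpa only [G, hN, and_true] using hexp _ (alg.isSignalingPolicy t h) l
    · have := M.isProbabilityMeasure_episodeLaw (alg.isSignalingPolicy t h)
      simp [G, hN]
  have key := alg.lintegral_prod_le_one M G hG hG1 T
  have hsub : {h : History X Ω A L T | ∃ t : Fin T, visitCount V (h.before t) = n ∧
      √(2 * c * n) < visitSum V Z (h.before t)} ⊆
      {h | ENNReal.ofReal (Real.exp c) ≤ ∏ s : Fin T, G s (h.before s) (h s)} := by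
    rintro h ⟨t, ht, hS⟩
    have h1 : ∏ s : Fin T, G s (h.before s) (h s) = ENNReal.ofReal
        (Real.exp (visitSum V (fun e => l * Z e - l ^ 2 / 2) (h.before t))) := by
      rw [← sum_stopped_eq, Real.exp_sum, ENNReal.ofReal_prod_of_nonneg fun _ _ =>
        (Real.exp_pos _).le]
      refine Finset.prod_congr rfl fun s _ => ?_
      simp only [G, ht]
      split_ifs <;> simp
    rw [Set.mem_ofPred_eq, h1, visitSum_mul_sub, ht]
    refine ENNReal.ofReal_le_ofReal (Real.exp_le_exp.2 ?_)
    have h2 : l ^ 2 = 2 * c / n := Real.sq_sqrt (by positivity)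
    have h3 : l * √(2 * c * n) = 2 * c := by
      rw [hl, ← Real.sqrt_mul (by positivity), show 2 * c / n * (2 * c * n) = (2 * c) ^ 2 by
        field_simp, Real.sqrt_sq (by positivity)]
    have h4 : l * √(2 * c * n) ≤ l * visitSum V Z (h.before t) :=
      mul_le_mul_of_nonneg_left hS.le (Real.sqrt_nonneg _)
    have h5 : (n : ℝ) * (l ^ 2 / 2) = c := by rw [h2]; field_simp
    linarith
  refine (measure_mono hsub).trans ?_
  have h6 := (mul_meas_ge_le_lintegral (measurable_prod_before G hG T)
    (ENNReal.ofReal (Real.exp c))).trans key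
  rw [Real.exp_neg, ENNReal.ofReal_inv_of_pos (Real.exp_pos c)]
  rw [mul_comm] at h6
  rw [← one_div]
  exact ENNReal.le_div_iff_mul_le (Or.inl (by simp [Real.exp_pos])) (Or.inl ENNReal.ofReal_ne_top)
    |>.2 h6

open Classical in
/-- A deviation bound that holds simultaneously for all numbers of visits. -/
theorem measure_deviation_le (V : Traj X Ω A L → Prop) {Z : Episode X Ω A L → ℝ}
    (hZ : Measurable Z)
    (hexp : ∀ φ, IsSignalingPolicy φ → ∀ l : ℝ, ∫⁻ e, (if V e.1 then
      ENNReal.ofReal (Real.exp (l * Z e - l ^ 2 / 2)) else 1) ∂M.episodeLaw φ ≤ 1)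
    {c : ℝ} (hc : 0 < c) :
    alg.historyLaw M T {h | ∃ t : Fin T, 1 ≤ visitCount V (h.before t) ∧
      √(2 * c * visitCount V (h.before t)) < visitSum V Z (h.before t)} ≤
      ENNReal.ofReal (T * Real.exp (-c)) := by
  have hsub : {h : History X Ω A L T | ∃ t : Fin T, 1 ≤ visitCount V (h.before t) ∧
      √(2 * c * visitCount V (h.before t)) < visitSum V Z (h.before t)} ⊆
      ⋃ n ∈ Finset.Icc 1 T, {h | ∃ t : Fin T, visitCount V (h.before t) = n ∧
        √(2 * c * n) < visitSum V Z (h.before t)} := by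
    rintro h ⟨t, h1, h2⟩
    simp only [Set.mem_iUnion, Finset.mem_Icc]
    exact ⟨_, ⟨h1, (visitCount_le V _).trans t.isLt.le⟩, t, rfl, h2⟩
  refine (measure_mono hsub).trans ((measure_biUnion_finset_le _ _).trans ?_)
  refine (Finset.sum_le_sum fun n hn =>
    alg.measure_deviation_count_le M V hZ hexp hc (Finset.mem_Icc.1 hn).1).trans ?_
  rw [Finset.sum_const, Nat.card_Icc, ENNReal.ofReal_mul (by positivity)]
  simp

end OPPS

end

/-! ### Conditional exponential moments of transitions, outcomes and rewards. -/

section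

variable {X Ω A : Type*} [Fintype X] [Fintype Ω] [Fintype A] {L : ℕ} {S : Layering X L}

namespace MPP

variable (M : MPP S Ω A) {φ : X → Ω → A → ℝ}

theorem lintegral_episodeLaw_traj (hφ : IsSignalingPolicy φ) {f : Traj X Ω A L → ℝ}
    (hf : ∀ τ, 0 ≤ f τ) :
    ∫⁻ e, ENNReal.ofReal (f e.1) ∂M.episodeLaw φ =
      ENNReal.ofReal (∑ τ, M.pathProb φ τ * f τ) := by
  have := M.rewardLaw_prob
  have hm : Measurable fun e : Episode X Ω A L => ENNReal.ofReal (f e.1) :=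
    (measurable_from_top (f := fun τ => ENNReal.ofReal (f τ))).comp measurable_fst
  rw [M.lintegral_episodeLaw φ hm, ENNReal.ofReal_sum_of_nonneg fun τ _ =>
    mul_nonneg (M.pathProb_nonneg hφ τ) (hf τ)]
  refine Finset.sum_congr rfl fun τ _ => ?_
  rw [ENNReal.ofReal_mul (M.pathProb_nonneg hφ τ)]
  simp [Traj.readOff]

theorem sum_pathProb_mul_le_one (hφ : IsSignalingPolicy φ) (k : Fin L) {f : Traj X Ω A L → ℝ}
    {g : X → Ω → A → X → ℝ}
    (hfg : ∀ τ : Traj X Ω A L, τ.Layered S →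
      f τ = g (τ.state k.castSucc) (τ.outcome k) (τ.action k) (τ.state k.succ))
    (hg : ∀ y, S.layer y = k → ∑ ω, ∑ a, ∑ x', M.stepProb φ y ω a x' * g y ω a x' ≤ 1) :
    ∑ τ, M.pathProb φ τ * f τ ≤ 1 := by
  have h : ∑ τ, M.pathProb φ τ * f τ = ∑ τ : Traj X Ω A L, M.pathProb φ τ *
      g (τ.state k.castSucc) (τ.outcome k) (τ.action k) (τ.state k.succ) := by
    refine Finset.sum_congr rfl fun τ _ => ?_
    by_cases hτ : M.pathProb φ τ = 0
    · simp [hτ]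
    · rw [hfg τ (M.layered_of_pathProb_ne_zero hτ)]
  rw [h, M.sum_pathProb_mul_step hφ, ← M.sum_stateDist hφ k k.isLt.le]
  refine Finset.sum_le_sum fun y _ => ?_
  simp only [mul_assoc, ← Finset.mul_sum]
  by_cases hy : S.layer y = k
  · exact mul_le_of_le_one_right (M.stateDist_nonneg hφ k y) (hg y hy)
  · simp [M.stateDist_eq_zero φ k y hy]

theorem trans_mem_stdSimplex {x : X} (hx : S.layer x < L) (ω : Ω) (a : A) :
    M.trans x ω a ∈ stdSimplex ℝ X :=
  ⟨M.trans_nonneg x ω a, M.trans_sum x ω a hx⟩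

open Classical in
-- On a visit, the weighted sum of indicators is `z` at the next state, which is drawn from `M.trans
-- x ω a`, so Hoeffding's lemma applies. Without a visit the factor is one.
theorem lintegral_exp_trans_le_one (hφ : IsSignalingPolicy φ) {x : X} (hx : S.layer x < L) (ω : Ω)
    (a : A) {z : X → ℝ} (hz : ∀ i, z i ∈ Set.Icc (-1 : ℝ) 1) (l : ℝ) :
    ∫⁻ e, (if e.1.VisitsXOA x ω a then ENNReal.ofReal (Real.exp (l *
      ((∑ x', z x' * if e.1.VisitsXOAX x ω a x' then 1 else 0) - ∑ x', M.trans x ω a x' * z x') -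
        l ^ 2 / 2)) else 1) ∂M.episodeLaw φ ≤ 1 := by
  have h := M.lintegral_episodeLaw_traj hφ (f := fun τ => if τ.VisitsXOA x ω a then Real.exp (l *
      ((∑ x', z x' * if τ.VisitsXOAX x ω a x' then 1 else 0) - ∑ x', M.trans x ω a x' * z x') -
        l ^ 2 / 2) else 1) fun τ => by split_ifs <;> positivity
  simp only [apply_ite ENNReal.ofReal, ENNReal.ofReal_one] at h
  rw [h, ENNReal.ofReal_le_one]
  refine M.sum_pathProb_mul_le_one hφ ⟨S.layer x, hx⟩ (g := fun y o b y' =>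
    if y = x ∧ o = ω ∧ b = a then
      Real.exp (l * (z y' - ∑ x', M.trans x ω a x' * z x') - l ^ 2 / 2) else 1) ?_ ?_
  · intro τ hτ
    simp only [hτ.visitsXOA_iff hx, hτ.visitsXOAX_iff hx, Traj.At]
    by_cases hat : τ.state (Fin.castSucc ⟨S.layer x, hx⟩) = x ∧ τ.outcome ⟨S.layer x, hx⟩ = ω ∧
      τ.action ⟨S.layer x, hx⟩ = a
    · simp only [hat, true_and, and_self, if_true, mul_ite, mul_one, mul_zero, Finset.sum_ite_eq,
        Finset.mem_univ]
    · rw [if_neg hat, if_neg hat]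
  · intro y hy
    refine le_of_le_of_eq ?_ (M.stepProb_sum hφ y (by rw [hy]; exact hx))
    refine Finset.sum_le_sum fun o _ => Finset.sum_le_sum fun b _ => ?_
    by_cases hyx : y = x ∧ o = ω ∧ b = a
    · obtain ⟨rfl, rfl, rfl⟩ := hyx
      simp only [and_self, if_true, stepProb, mul_assoc, ← Finset.mul_sum]
      rw [M.trans_sum _ _ _ hx]
      have h1 := (M.prior_mem y).1 o
      have h2 := (hφ y o).1 b
      have h3 := sum_exp_centered_le_one (M.trans_mem_stdSimplex hx o b) hz l
      gcongr
    · simp [hyx]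

open Classical in
theorem lintegral_exp_prior_le_one (hφ : IsSignalingPolicy φ) {x : X} (hx : S.layer x < L)
    {z : Ω → ℝ} (hz : ∀ i, z i ∈ Set.Icc (-1 : ℝ) 1) (l : ℝ) :
    ∫⁻ e, (if e.1.VisitsX x then ENNReal.ofReal (Real.exp (l *
      ((∑ ω, z ω * if e.1.VisitsXO x ω then 1 else 0) - ∑ ω, M.prior x ω * z ω) -
        l ^ 2 / 2)) else 1) ∂M.episodeLaw φ ≤ 1 := by
  have h := M.lintegral_episodeLaw_traj hφ (f := fun τ => if τ.VisitsX x then Real.exp (l *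
      ((∑ ω, z ω * if τ.VisitsXO x ω then 1 else 0) - ∑ ω, M.prior x ω * z ω) -
        l ^ 2 / 2) else 1) fun τ => by split_ifs <;> positivity
  simp only [apply_ite ENNReal.ofReal, ENNReal.ofReal_one] at h
  rw [h, ENNReal.ofReal_le_one]
  refine M.sum_pathProb_mul_le_one hφ ⟨S.layer x, hx⟩ (g := fun y o b y' =>
    if y = x then Real.exp (l * (z o - ∑ ω, M.prior x ω * z ω) - l ^ 2 / 2) else 1) ?_ ?_
  · intro τ hτ
    simp only [hτ.visitsX_iff hx, hτ.visitsXO_iff hx]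
    by_cases hat : τ.state (Fin.castSucc ⟨S.layer x, hx⟩) = x
    · simp only [hat, true_and, if_true, mul_ite, mul_one, mul_zero, Finset.sum_ite_eq,
        Finset.mem_univ]
    · rw [if_neg hat, if_neg hat]
  · intro y hy
    by_cases hyx : y = x
    · obtain rfl := hyx
      simp only [if_true, stepProb, mul_assoc, ← Finset.mul_sum, ← Finset.sum_mul,
        M.trans_sum _ _ _ hx, (hφ y _).2, one_mul]
      exact sum_exp_centered_le_one (M.prior_mem y) hz l
    · simp only [hyx, if_false, mul_one]
      exact (M.stepProb_sum hφ y (by rw [hy]; exact hx)).le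

open Classical in
-- Rewards are independent of the trajectory, so Hoeffding's lemma can be applied path by path to `σ
-- * (2 * r - 1)`, which fills `[-1, 1]`; this explains the factor `2`. The sign `σ` selects the
-- tail, and `pr`, `rew` select the sender's or the receivers' rewards.
theorem lintegral_exp_reward_le_one (hφ : IsSignalingPolicy φ) {x : X} (hx : S.layer x < L) (ω : Ω)
    (a : A) {pr : (X → Ω → A → ℝ) × (X → Ω → A → ℝ) → X → Ω → A → ℝ} (hpr : Measurable pr)
    (hmem : ∀ᵐ r ∂M.rewardLaw, pr r x ω a ∈ Set.Icc (0 : ℝ) 1)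
    {rew : Episode X Ω A L → Fin L → ℝ} (hrew : Measurable rew)
    (hrew' : ∀ τ r k, rew (Traj.readOff τ r) k =
      pr r (τ.state k.castSucc) (τ.outcome k) (τ.action k))
    {σ : ℝ} (hσ : σ = 1 ∨ σ = -1) (l : ℝ) :
    ∫⁻ e, (if e.1.VisitsXOA x ω a then ENNReal.ofReal (Real.exp (l *
      (2 * σ * ((∑ k, if e.1.At k x ω a then rew e k else 0) - ∫ r, pr r x ω a ∂M.rewardLaw)) -
        l ^ 2 / 2)) else 1) ∂M.episodeLaw φ ≤ 1 := by
  have := M.rewardLaw_prob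
  have hAt : ∀ k, Measurable fun e : Episode X Ω A L => if e.1.At k x ω a then rew e k else 0 :=
    fun k => Measurable.ite (measurable_fst (show MeasurableSet {τ : Traj X Ω A L | τ.At k x ω a}
      from trivial)) ((measurable_pi_apply k).comp hrew) measurable_const
  rw [M.lintegral_episodeLaw]
  swap
  · refine Measurable.ite (measurable_fst (show MeasurableSet
      {τ : Traj X Ω A L | τ.VisitsXOA x ω a} from trivial)) ?_ measurable_const
    fun_prop
  have hpr' : Measurable fun r => pr r x ω a := by fun_prop
  have hint : Integrable (fun r => pr r x ω a) M.rewardLaw :=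
    Integrable.of_mem_Icc 0 1 hpr'.aemeasurable hmem
  have h := lintegral_exp_centered_le_one M.rewardLaw (z := fun r => σ * (2 * pr r x ω a - 1))
    (by fun_prop) (by
      filter_upwards [hmem] with r hr
      rcases hσ with rfl | rfl <;> constructor <;> linarith [hr.1, hr.2]) l
  have hz : ∫ r, σ * (2 * pr r x ω a - 1) ∂M.rewardLaw =
      σ * (2 * (∫ r, pr r x ω a ∂M.rewardLaw) - 1) := by
    rw [integral_const_mul, integral_sub (hint.const_mul 2) (integrable_const _),
      integral_const_mul]
    simp
  rw [hz] at h
  have h1 := M.sum_pathProb hφ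
  have hle : ∀ τ : Traj X Ω A L, ENNReal.ofReal (M.pathProb φ τ) * ∫⁻ r,
      (if (τ.readOff r).1.VisitsXOA x ω a then ENNReal.ofReal (Real.exp (l *
      (2 * σ * ((∑ k, if (τ.readOff r).1.At k x ω a then rew (τ.readOff r) k else 0) -
        ∫ r, pr r x ω a ∂M.rewardLaw)) - l ^ 2 / 2)) else 1) ∂M.rewardLaw ≤
      ENNReal.ofReal (M.pathProb φ τ) := by
    intro τ
    by_cases hτ : M.pathProb φ τ = 0
    · simp [hτ]
    refine mul_le_of_le_one_right' ?_
    have hl := M.layered_of_pathProb_ne_zero hτ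
    have hfst : ∀ r, (τ.readOff r).1 = τ := fun r => rfl
    by_cases hV : τ.VisitsXOA x ω a
    · refine le_trans (lintegral_mono fun r => ?_) h
      have hat := (hl.visitsXOA_iff hx).1 hV
      have hs : (∑ k, if τ.At k x ω a then rew (τ.readOff r) k else 0) = pr r x ω a := by
        rw [Finset.sum_eq_single ⟨S.layer x, hx⟩]
        · rw [if_pos hat, hrew', hat.1, hat.2.1, hat.2.2]
        · intro k _ hk
          exact if_neg fun hk' => hk (Fin.ext (hl.eq_of_castSucc hk'.1))
        · simp
      simp only [hfst, hV, if_true, hs]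
      refine ENNReal.ofReal_le_ofReal (Real.exp_le_exp.2 (le_of_eq ?_))
      ring
    · simp [hfst, hV]
  refine (Finset.sum_le_sum fun τ _ => hle τ).trans ?_
  rw [← ENNReal.ofReal_sum_of_nonneg fun τ _ => M.pathProb_nonneg hφ τ, h1, ENNReal.ofReal_one]

end MPP

/-- Trajectories that respect the layers, and rewards in `[0, 1]`. -/
def Episode.Regular (S : Layering X L) (e : Episode X Ω A L) : Prop :=
  e.1.Layered S ∧ ∀ k, e.2.1 k ∈ Set.Icc (0 : ℝ) 1 ∧ e.2.2 k ∈ Set.Icc (0 : ℝ) 1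

theorem measurableSet_regular :
    MeasurableSet {e : Episode X Ω A L | Episode.Regular S e} := by
  refine MeasurableSet.inter (measurable_fst (show MeasurableSet
      {τ : Traj X Ω A L | τ.Layered S} from trivial)) ?_
  have h : {e : Episode X Ω A L | ∀ k, e.2.1 k ∈ Set.Icc (0 : ℝ) 1 ∧ e.2.2 k ∈ Set.Icc (0 : ℝ) 1} =
      ⋂ k, (((fun e : Episode X Ω A L => e.2.1 k) ⁻¹' Set.Icc (0 : ℝ) 1) ∩
        ((fun e : Episode X Ω A L => e.2.2 k) ⁻¹' Set.Icc (0 : ℝ) 1)) := by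
    ext e; simp
  rw [show (fun e : Episode X Ω A L =>
    ∀ k, e.2.1 k ∈ Set.Icc (0 : ℝ) 1 ∧ e.2.2 k ∈ Set.Icc (0 : ℝ) 1) = _ from h]
  refine MeasurableSet.iInter fun k => ?_
  have h1 : Measurable fun e : Episode X Ω A L => e.2.1 k := by fun_prop
  have h2 : Measurable fun e : Episode X Ω A L => e.2.2 k := by fun_prop
  exact (h1 measurableSet_Icc).inter (h2 measurableSet_Icc)

open Classical in
theorem MPP.lintegral_regular_le_one (M : MPP S Ω A) {φ : X → Ω → A → ℝ}
    (hφ : IsSignalingPolicy φ) :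
    ∫⁻ e, (if Episode.Regular S e then 1 else ⊤) ∂M.episodeLaw φ ≤ 1 := by
  have := M.rewardLaw_prob
  rw [M.lintegral_episodeLaw _ (Measurable.ite measurableSet_regular measurable_const
    measurable_const)]
  have h1 : ∑ τ : Traj X Ω A L, ENNReal.ofReal (M.pathProb φ τ) = 1 := by
    rw [← ENNReal.ofReal_sum_of_nonneg fun τ _ => M.pathProb_nonneg hφ τ, M.sum_pathProb hφ,
      ENNReal.ofReal_one]
  refine le_of_le_of_eq ?_ h1
  refine Finset.sum_le_sum fun τ _ => ?_
  by_cases hτ : M.pathProb φ τ = 0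
  · simp [hτ]
  refine mul_le_of_le_one_right' (le_of_eq ?_)
  have hl := M.layered_of_pathProb_ne_zero hτ
  rw [lintegral_congr_ae (g := fun _ => 1)]
  · simp
  · filter_upwards [M.rewardLaw_mem] with r hr
    exact if_pos (show Episode.Regular S (τ.readOff r) from ⟨hl, fun k => hr _ _ _⟩)

open Classical in
-- An almost sure property fits the product bound through a factor equal to `⊤` where it fails. One
-- irregular episode makes the product infinite, since no factor is zero, while a function of finite
-- integral is almost surely finite.
theorem OPPS.measure_not_regular {T : ℕ} {α δ : ℝ} (alg : OPPS S Ω A T α δ) (M : MPP S Ω A) :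
    alg.historyLaw M T {h | ∃ s, ¬ Episode.Regular S (h s)} = 0 := by
  let G : ∀ t, History X Ω A L t → Episode X Ω A L → ENNReal := fun t h e =>
    if Episode.Regular S e then 1 else ⊤
  have hG : ∀ t, Measurable (Function.uncurry (G t)) := fun t =>
    (Measurable.ite measurableSet_regular measurable_const measurable_const :
      Measurable fun e : Episode X Ω A L => if Episode.Regular S e then (1 : ENNReal) else ⊤).comp
        measurable_snd
  have key := alg.lintegral_prod_le_one M G hG
    (fun t h => M.lintegral_regular_le_one (alg.isSignalingPolicy t h)) T
  have h0 := (measure_eq_top_of_lintegral_ne_top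
    (measurable_prod_before G hG T).aemeasurable (ne_top_of_le_ne_top ENNReal.one_ne_top key))
  refine measure_mono_null ?_ h0
  rintro h ⟨s, hs⟩
  refine WithTop.prod_eq_top (Finset.mem_univ s) (if_neg hs) fun i _ => ?_
  change G i (h.before i) (h i) ≠ 0
  simp only [G]
  split_ifs <;> simp

end

/-! ### Concentration of the estimators. -/

section

variable {X Ω A : Type*} [Fintype X] [Fintype Ω] [Fintype A] {L : ℕ} {S : Layering X L}

theorem visitCount_mono {t : ℕ} {V W : Traj X Ω A L → Prop} (hVW : ∀ τ, V τ → W τ)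
    (h : History X Ω A L t) : visitCount V h ≤ visitCount W h := by
  classical
  refine Finset.card_le_card fun s hs => ?_
  simp only [Finset.mem_filter, Finset.mem_univ, true_and] at hs ⊢
  exact hVW _ hs

open Classical in
theorem visitSum_weighted {t : ℕ} {ι : Type*} [Fintype ι] {V : Traj X Ω A L → Prop}
    {E : ι → Traj X Ω A L → Prop} (hEV : ∀ i τ, E i τ → V τ) (p z : ι → ℝ)
    (h : History X Ω A L t) :
    visitSum V (fun e => (∑ i, z i * if E i e.1 then 1 else 0) - ∑ i, p i * z i) h =
      ∑ i, z i * (visitCount (E i) h - visitCount V h * p i) := by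
  have h1 : ∀ i, (visitCount (E i) h : ℝ) = ∑ s, if E i (h s).1 then (1 : ℝ) else 0 := fun i => by
    simp [visitCount]
  have h2 : (visitCount V h : ℝ) = ∑ s, if V (h s).1 then (1 : ℝ) else 0 := by
    simp [visitCount]
  simp only [visitSum, h1, h2, mul_sub, Finset.sum_sub_distrib, Finset.mul_sum, Finset.sum_mul]
  rw [Finset.sum_comm (s := (Finset.univ : Finset ι)), Finset.sum_comm (s := (Finset.univ : Finset ι)),
    ← Finset.sum_sub_distrib]
  refine Finset.sum_congr rfl fun s _ => ?_
  split_ifs with hV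
  · rw [sub_right_inj]
    exact Finset.sum_congr rfl fun i _ => by ring
  · have : ∀ i, ¬ E i (h s).1 := fun i hi => hV (hEV i _ hi)
    simp [this]

/-- The exponent `m * log D` pays for a union bound over `2 ^ m` sign patterns, because `(2 / D) ^ m
≤ 2 / D`. It explains the cardinality under the root in `transBound` and `priorBound`. -/
theorem two_pow_mul_exp_neg_le {m : ℕ} (hm : 1 ≤ m) {D : ℝ} (hD : 2 ≤ D) (T : ℕ) :
    2 ^ m * (T * Real.exp (-(m * Real.log D))) ≤ 2 * T / D := by
  have hD0 : 0 < D := by linarith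
  have h : Real.exp (-(m * Real.log D)) = (1 / D) ^ m := by
    rw [Real.exp_neg, Real.exp_nat_mul, Real.exp_log hD0, one_div, inv_pow]
  rw [h]
  calc 2 ^ m * (T * (1 / D) ^ m) = T * (2 / D) ^ m := by
        rw [mul_left_comm, ← mul_pow, mul_one_div]
    _ ≤ T * (2 / D) := by
        gcongr
        exact pow_le_of_le_one (by positivity) ((div_le_one hD0).2 hD) (by omega)
    _ = 2 * T / D := by ring

/-- The threshold `7` is available because the claim is void unless `δ ≤ 1 / 7`; all that matters is
that it exceeds `e`. -/
theorem one_le_log_of_seven_le {D : ℝ} (hD : 7 ≤ D) : 1 ≤ Real.log D := by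
  rw [Real.le_log_iff_exp_le (by linarith)]
  linarith [Real.exp_one_lt_d9]

namespace OPPS

variable {T : ℕ} {α δ : ℝ} (alg : OPPS S Ω A T α δ) (M : MPP S Ω A)

open Classical in
-- An `ℓ¹` norm over `s` is the largest pairing with a sign vector on `s`. Each pairing is a scalar
-- deviation, and there are `2 ^ s.card` of them. Coordinates outside `s` get weight zero, so only
-- the next layer counts for transitions.
theorem measure_l1_deviation_le {ι : Type*} [Fintype ι] {V : Traj X Ω A L → Prop}
    {E : ι → Traj X Ω A L → Prop} (hEV : ∀ i τ, E i τ → V τ) (p : ι → ℝ) (s : Finset ι)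
    (hexp : ∀ z : ι → ℝ, (∀ i, z i ∈ Set.Icc (-1 : ℝ) 1) → ∀ φ, IsSignalingPolicy φ → ∀ l : ℝ,
      ∫⁻ e, (if V e.1 then ENNReal.ofReal (Real.exp (l *
        ((∑ i, z i * if E i e.1 then 1 else 0) - ∑ i, p i * z i) - l ^ 2 / 2)) else 1)
          ∂M.episodeLaw φ ≤ 1)
    {c : ℝ} (hc : 0 < c) :
    alg.historyLaw M T {h | ∃ t : Fin T, 1 ≤ visitCount V (h.before t) ∧
      √(2 * c * visitCount V (h.before t)) <
        ∑ i ∈ s, |(visitCount (E i) (h.before t) : ℝ) - visitCount V (h.before t) * p i|} ≤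
      ENNReal.ofReal (2 ^ s.card * (T * Real.exp (-c))) := by
  let z : Finset ι → ι → ℝ := fun B i => if i ∈ s then (if i ∈ B then 1 else -1) else 0
  have hz : ∀ B i, z B i ∈ Set.Icc (-1 : ℝ) 1 := fun B i => by
    simp only [z]; split_ifs <;> simp
  let Z : Finset ι → Episode X Ω A L → ℝ := fun B e =>
    (∑ i, z B i * if E i e.1 then 1 else 0) - ∑ i, p i * z B i
  have hZ : ∀ B, Measurable (Z B) := fun B =>
    (measurable_from_top (f := fun τ : Traj X Ω A L =>
      (∑ i, z B i * if E i τ then 1 else 0) - ∑ i, p i * z B i)).comp measurable_fst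
  have hsub : {h : History X Ω A L T | ∃ t : Fin T, 1 ≤ visitCount V (h.before t) ∧
      √(2 * c * visitCount V (h.before t)) <
        ∑ i ∈ s, |(visitCount (E i) (h.before t) : ℝ) - visitCount V (h.before t) * p i|} ⊆
      ⋃ B ∈ s.powerset, {h | ∃ t : Fin T, 1 ≤ visitCount V (h.before t) ∧
        √(2 * c * visitCount V (h.before t)) < visitSum V (Z B) (h.before t)} := by
    rintro h ⟨t, h1, h2⟩
    simp only [Set.mem_iUnion, Finset.mem_powerset]
    refine ⟨s.filter fun i =>
      0 ≤ (visitCount (E i) (h.before t) : ℝ) - visitCount V (h.before t) * p i,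
      Finset.filter_subset _ _, t, h1, h2.trans_eq ?_⟩
    simp only [Z]
    rw [visitSum_weighted hEV]
    rw [← Finset.sum_subset (Finset.subset_univ s)]
    · refine Finset.sum_congr rfl fun i hi => ?_
      simp only [z, hi, if_true, Finset.mem_filter, true_and]
      split_ifs with h0
      · rw [abs_of_nonneg h0, one_mul]
      · rw [abs_of_neg (not_le.1 h0)]; ring
    · intro i _ hi
      simp [z, hi]
  refine (measure_mono hsub).trans ((measure_biUnion_finset_le _ _).trans ?_)
  refine (Finset.sum_le_sum fun B _ =>
    alg.measure_deviation_le M V (hZ B) (fun φ hφ l => hexp (z B) (hz B) φ hφ l) hc).trans ?_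
  rw [Finset.sum_const, Finset.card_powerset, ← ENNReal.ofReal_nsmul, nsmul_eq_mul]
  push_cast
  rfl

open Classical in
/-- The empirical distribution of the events `E i` among the episodes with `V` is close to `p`. -/
theorem measure_l1_estimate_le {ι : Type*} [Fintype ι] {V : Traj X Ω A L → Prop}
    {E : ι → Traj X Ω A L → Prop} (hEV : ∀ i τ, E i τ → V τ) {p : ι → ℝ} {s : Finset ι}
    (hp0 : ∀ i, 0 ≤ p i) (hp1 : ∑ i ∈ s, p i = 1)
    (hexp : ∀ z : ι → ℝ, (∀ i, z i ∈ Set.Icc (-1 : ℝ) 1) → ∀ φ,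
      IsSignalingPolicy φ → ∀ l : ℝ,
      ∫⁻ e, (if V e.1 then ENNReal.ofReal (Real.exp (l *
        ((∑ i, z i * if E i e.1 then 1 else 0) - ∑ i, p i * z i) - l ^ 2 / 2)) else 1)
          ∂M.episodeLaw φ ≤ 1)
    {D : ℝ} (hD : 7 ≤ D) :
    alg.historyLaw M T {h | ∃ t : Fin T,
      √(2 * (s.card : ℝ) * Real.log D / max 1 (visitCount V (h.before t) : ℝ)) <
        ∑ i ∈ s, |(visitCount (E i) (h.before t) : ℝ) / max 1 (visitCount V (h.before t) : ℝ) -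
          p i|} ≤ ENNReal.ofReal (2 * T / D) := by
  have hm : 1 ≤ s.card := by
    refine Finset.card_pos.2 (Finset.nonempty_iff_ne_empty.2 fun h => ?_)
    simp [h] at hp1
  have hm' : (1 : ℝ) ≤ s.card := by exact_mod_cast hm
  have hlog := one_le_log_of_seven_le hD
  have hc : 0 < (s.card : ℝ) * Real.log D := by positivity
  refine le_trans (measure_mono ?_) ((alg.measure_l1_deviation_le M hEV p s hexp hc).trans
    (ENNReal.ofReal_le_ofReal (two_pow_mul_exp_neg_le hm (by linarith) T)))
  rintro h ⟨t, ht⟩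
  rcases Nat.eq_zero_or_pos (visitCount V (h.before t)) with h0 | h0
  -- Without visits the estimate is zero and the error is the full mass `1`, which is below the
  -- confidence bound because `2 * s.card * log D ≥ 1`.
  · exfalso
    have hE : ∀ i, visitCount (E i) (h.before t) = 0 := fun i =>
      Nat.le_zero.1 (h0 ▸ visitCount_mono (hEV i) (h.before t))
    simp only [hE, h0, Nat.cast_zero, zero_div, zero_sub, abs_neg, abs_of_nonneg (hp0 _), hp1] at ht
    rw [Real.sqrt_lt' one_pos] at ht
    norm_num at ht
    nlinarith
  · refine ⟨t, h0, ?_⟩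
    have hN : (1 : ℝ) ≤ visitCount V (h.before t) := by exact_mod_cast h0
    set N : ℝ := (visitCount V (h.before t) : ℝ) with hNdef
    have hN0 : 0 < N := by linarith
    rw [max_eq_right hN] at ht
    have h1 : ∀ i, |(visitCount (E i) (h.before t) : ℝ) - N * p i| =
        N * |(visitCount (E i) (h.before t) : ℝ) / N - p i| := fun i => by
      rw [← abs_of_pos hN0, ← abs_mul, abs_of_pos hN0]
      congr 1
      field_simp
    simp only [h1, ← Finset.mul_sum]
    refine lt_of_eq_of_lt ?_ (mul_lt_mul_of_pos_left ht hN0)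
    rw [show 2 * ((s.card : ℝ) * Real.log D) * N = N ^ 2 * (2 * (s.card : ℝ) * Real.log D / N) by
      field_simp, Real.sqrt_mul (by positivity), Real.sqrt_sq hN0.le]

theorem measure_trans_bad_le {x : X} (hx : S.layer x < L) (ω : Ω) (a : A)
    (hD : 7 ≤ (T * Fintype.card X * Fintype.card Ω * Fintype.card A / δ : ℝ)) :
    alg.historyLaw M T {h | ∃ t : Fin T, transBound S T δ (h.before t) x ω a <
      ∑ x' ∈ S.next x, |transEst (h.before t) x ω a x' - M.trans x ω a x'|} ≤
      ENNReal.ofReal (2 * T / (T * Fintype.card X * Fintype.card Ω * Fintype.card A / δ)) :=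
  alg.measure_l1_estimate_le M (V := fun τ => τ.VisitsXOA x ω a)
    (E := fun x' τ => τ.VisitsXOAX x ω a x') (fun _ _ ⟨k, hk⟩ => ⟨k, hk.1⟩)
    (M.trans_nonneg x ω a) (M.sum_trans_next x ω a hx)
    (fun _ hz _ hφ l => M.lintegral_exp_trans_le_one hφ hx ω a hz l) hD

theorem measure_prior_bad_le {x : X} (hx : S.layer x < L)
    (hD : 7 ≤ (T * Fintype.card X / δ : ℝ)) :
    alg.historyLaw M T {h | ∃ t : Fin T, priorBound (Ω := Ω) T δ (h.before t) x <
      ∑ ω, |priorEst (h.before t) x ω - M.prior x ω|} ≤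
      ENNReal.ofReal (2 * T / (T * Fintype.card X / δ)) :=
  alg.measure_l1_estimate_le M (V := fun τ => τ.VisitsX x)
    (E := fun ω τ => τ.VisitsXO x ω) (fun _ _ ⟨k, hk⟩ => ⟨k.castSucc, hk.1⟩)
    (M.prior_mem x).1 (M.prior_mem x).2
    (fun _ hz _ hφ l => M.lintegral_exp_prior_le_one hφ hx hz l) hD

open Classical in
/-- The empirical mean of the observed rewards of `(x, ω, a)` is close to their mean. -/
theorem measure_reward_bad_le {x : X} (hx : S.layer x < L) (ω : Ω) (a : A)
    {pr : (X → Ω → A → ℝ) × (X → Ω → A → ℝ) → X → Ω → A → ℝ} (hpr : Measurable pr)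
    (hmem : ∀ᵐ r ∂M.rewardLaw, pr r x ω a ∈ Set.Icc (0 : ℝ) 1)
    {rew : Episode X Ω A L → Fin L → ℝ} (hrew : Measurable rew)
    (hrew' : ∀ τ r k, rew (Traj.readOff τ r) k =
      pr r (τ.state k.castSucc) (τ.outcome k) (τ.action k))
    {D : ℝ} (hD : 7 ≤ D) :
    alg.historyLaw M T {h | ∃ t : Fin T, 1 ≤ countXOA (h.before t) x ω a ∧
      √(Real.log D / countXOA (h.before t) x ω a) <
      |(∑ s : Fin t, ∑ k : Fin L, if ((h.before t) s).1.At k x ω a then rew ((h.before t) s) k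
        else 0) / max 1 (countXOA (h.before t) x ω a : ℝ) - ∫ r, pr r x ω a ∂M.rewardLaw|} ≤
      ENNReal.ofReal (2 * T / D ^ 2) := by
  set V : Traj X Ω A L → Prop := fun τ => τ.VisitsXOA x ω a
  set m := ∫ r, pr r x ω a ∂M.rewardLaw
  let R : Episode X Ω A L → ℝ := fun e => ∑ k, if e.1.At k x ω a then rew e k else 0
  have hR : Measurable R := Finset.measurable_sum _ fun k _ =>
    Measurable.ite (measurable_fst (show MeasurableSet {τ : Traj X Ω A L | τ.At k x ω a}
      from trivial)) ((measurable_pi_apply k).comp hrew) measurable_const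
  let Z : ℝ → Episode X Ω A L → ℝ := fun σ e => 2 * σ * (R e - m)
  have hlog := one_le_log_of_seven_le hD
  -- Since `Z` carries a factor `2`, the level `c = 2 * log D` yields the threshold `√(log D / N)`
  -- for the mean, and failure probability `T / D ^ 2` per tail.
  have hc : 0 < 2 * Real.log D := by linarith
  have hdev : ∀ σ : ℝ, σ = 1 ∨ σ = -1 → alg.historyLaw M T
      {h | ∃ t : Fin T, 1 ≤ visitCount V (h.before t) ∧
        √(2 * (2 * Real.log D) * visitCount V (h.before t)) < visitSum V (Z σ) (h.before t)} ≤
      ENNReal.ofReal (T / D ^ 2) := fun σ hσ => by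
    refine (alg.measure_deviation_le M V (Z := Z σ) ((hR.sub_const m).const_mul _)
      (fun φ hφ l => M.lintegral_exp_reward_le_one hφ hx ω a hpr hmem hrew hrew' hσ l) hc).trans ?_
    refine ENNReal.ofReal_le_ofReal (le_of_eq ?_)
    rw [Real.exp_neg, mul_comm 2, mul_comm, Real.exp_mul, Real.exp_log (by linarith)]
    norm_num
    ring
  refine le_trans (measure_mono ?_) ((measure_union_le _ _).trans
    (add_le_add (hdev 1 (Or.inl rfl)) (hdev (-1) (Or.inr rfl)))) |>.trans_eq ?_
  · rintro h ⟨t, h0, ht⟩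
    have hcount : countXOA (h.before t) x ω a = visitCount V (h.before t) := rfl
    rw [hcount] at h0 ht
    have hN : (1 : ℝ) ≤ visitCount V (h.before t) := by exact_mod_cast h0
    have hsum : ∀ σ, visitSum V (Z σ) (h.before t) = 2 * σ * ((∑ s : Fin t, ∑ k : Fin L,
        if ((h.before t) s).1.At k x ω a then rew ((h.before t) s) k else 0) -
          visitCount V (h.before t) * m) := fun σ => by
      have h1 : Z σ = fun e => 2 * σ * R e - 2 * σ * m := funext fun e => by simp only [Z]; ring
      rw [h1, visitSum_mul_sub]
      have h2 : visitSum V R (h.before t) = ∑ s : Fin t, ∑ k : Fin L,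
          if ((h.before t) s).1.At k x ω a then rew ((h.before t) s) k else 0 := by
        refine Finset.sum_congr rfl fun s _ => ?_
        split_ifs with hV
        · rfl
        · refine (Finset.sum_eq_zero fun k _ => if_neg fun hk => hV ⟨k, hk⟩).symm
      rw [h2]; ring
    set N : ℝ := (visitCount V (h.before t) : ℝ) with hNdef
    set Q := ∑ s : Fin t, ∑ k : Fin L,
        if ((h.before t) s).1.At k x ω a then rew ((h.before t) s) k else 0
    have hN0 : 0 < N := by linarith
    rw [max_eq_right hN] at ht
    have hsq : √(2 * (2 * Real.log D) * N) = 2 * N * √(Real.log D / N) := by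
      rw [show 2 * (2 * Real.log D) * N = (2 * N) ^ 2 * (Real.log D / N) by field_simp,
        Real.sqrt_mul (by positivity), Real.sqrt_sq (by positivity)]
    have hQ : Q - N * m = N * (Q / N - m) := by field_simp
    rcases lt_abs.1 ht with h1 | h1
    · refine Or.inl ⟨t, h0, ?_⟩
      rw [hsum, hsq, hQ]
      nlinarith
    · refine Or.inr ⟨t, h0, ?_⟩
      rw [hsum, hsq, hQ]
      nlinarith
  · rw [← ENNReal.ofReal_add (by positivity) (by positivity)]
    congr 1; ring

end OPPS

end

/-! ### Expected against realized costs, and ranges of costs and estimates. -/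

section

variable {X Ω A : Type*} [Fintype X] [Fintype Ω] [Fintype A] {L : ℕ} {S : Layering X L}

/-- The sum of `c` along a trajectory. -/
def Traj.total (τ : Traj X Ω A L) (c : X → Ω → A → ℝ) : ℝ :=
  ∑ k : Fin L, c (τ.state k.castSucc) (τ.outcome k) (τ.action k)

/-- It suffices that `(1 - w / 2) * (1 + w) ≥ 1` on `[0, 1]`. -/
theorem exp_neg_le_one_sub_half {w : ℝ} (h0 : 0 ≤ w) (h1 : w ≤ 1) :
    Real.exp (-w) ≤ 1 - w / 2 := by
  have h2 := Real.add_one_le_exp w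
  rw [Real.exp_neg, inv_eq_one_div, div_le_iff₀ (Real.exp_pos w)]
  nlinarith

theorem Traj.total_mem (τ : Traj X Ω A L) {c : X → Ω → A → ℝ} {b : ℝ}
    (hc : ∀ x ω a, 0 ≤ c x ω a ∧ c x ω a ≤ b) : 0 ≤ τ.total c ∧ τ.total c ≤ L * b := by
  refine ⟨Finset.sum_nonneg fun k _ => (hc _ _ _).1, ?_⟩
  refine (Finset.sum_le_sum fun k _ => (hc _ _ _).2).trans ?_
  simp

/-- For the normalized total `W ∈ [0, 1]` one has `E exp(-W) ≤ 1 - E W / 2 ≤ exp(-E W / 2)`. Losing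
the factor `2` in the mean is what avoids a variance term. -/
theorem MPP.lintegral_exp_value_sub_total_le_one (M : MPP S Ω A) {φ : X → Ω → A → ℝ}
    (hφ : IsSignalingPolicy φ) {c : X → Ω → A → ℝ} {b : ℝ} (hb : 0 < L * b)
    (hc : ∀ x ω a, 0 ≤ c x ω a ∧ c x ω a ≤ b) :
    ∫⁻ e, ENNReal.ofReal (Real.exp ((∑ τ, M.pathProb φ τ * τ.total c) / (2 * (L * b)) -
      e.1.total c / (L * b))) ∂M.episodeLaw φ ≤ 1 := by
  set v := ∑ τ, M.pathProb φ τ * τ.total c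
  rw [M.lintegral_episodeLaw_traj hφ (f := fun τ => Real.exp (v / (2 * (L * b)) -
      τ.total c / (L * b))) fun τ => (Real.exp_pos _).le, ENNReal.ofReal_le_one]
  have h1 : ∑ τ : Traj X Ω A L, M.pathProb φ τ *
      Real.exp (v / (2 * (L * b)) - τ.total c / (L * b)) ≤
      ∑ τ, M.pathProb φ τ * (Real.exp (v / (2 * (L * b))) * (1 - τ.total c / (L * b) / 2)) := by
    refine Finset.sum_le_sum fun τ _ => mul_le_mul_of_nonneg_left ?_ (M.pathProb_nonneg hφ τ)
    rw [sub_eq_add_neg, Real.exp_add]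
    have ht := τ.total_mem hc
    exact mul_le_mul_of_nonneg_left (exp_neg_le_one_sub_half (div_nonneg ht.1 hb.le)
      ((div_le_one hb).2 ht.2)) (Real.exp_pos _).le
  have h2 : ∑ τ, M.pathProb φ τ * (Real.exp (v / (2 * (L * b))) * (1 - τ.total c / (L * b) / 2)) =
      Real.exp (v / (2 * (L * b))) * (1 - v / (2 * (L * b))) := by
    have : ∀ τ : Traj X Ω A L, M.pathProb φ τ *
        (Real.exp (v / (2 * (L * b))) * (1 - τ.total c / (L * b) / 2)) =
        Real.exp (v / (2 * (L * b))) * M.pathProb φ τ - Real.exp (v / (2 * (L * b))) /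
          (2 * (L * b)) * (M.pathProb φ τ * τ.total c) := fun τ => by field_simp
    simp only [this, Finset.sum_sub_distrib, ← Finset.mul_sum, M.sum_pathProb hφ]
    change _ * 1 - _ * v = _
    ring
  refine h1.trans (h2.trans_le ?_)
  have h3 := Real.one_sub_le_exp_neg (v / (2 * (L * b)))
  rw [Real.exp_neg] at h3
  calc _ ≤ Real.exp (v / (2 * (L * b))) * (Real.exp (v / (2 * (L * b))))⁻¹ :=
        mul_le_mul_of_nonneg_left h3 (Real.exp_pos _).le
    _ = 1 := mul_inv_cancel₀ (Real.exp_pos _).ne'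

/-- Expected costs are bounded by twice the realized costs, up to a logarithmic term. -/
theorem OPPS.measure_value_gt_total_le {T : ℕ} {α δ : ℝ} (alg : OPPS S Ω A T α δ) (M : MPP S Ω A)
    {c : ∀ t, History X Ω A L t → X → Ω → A → ℝ} (hcm : ∀ t, Measurable (c t)) {b : ℝ}
    (hb : 0 < L * b) (hc : ∀ t h x ω a, 0 ≤ c t h x ω a ∧ c t h x ω a ≤ b) {η : ℝ} (hη : 0 < η) :
    alg.historyLaw M T {h | 2 * (∑ t : Fin T, (h t).1.total (c t (h.before t))) +
        2 * (L * b) * Real.log (1 / η) <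
      ∑ t : Fin T, Occ.value (c t (h.before t)) (M.occ (alg.policy t (h.before t)))} ≤
      ENNReal.ofReal η := by
  let v : ∀ t, History X Ω A L t → ℝ := fun t h =>
    ∑ τ, M.pathProb (alg.policy t h) τ * τ.total (c t h)
  let G : ∀ t, History X Ω A L t → Episode X Ω A L → ENNReal := fun t h e =>
    ENNReal.ofReal (Real.exp (v t h / (2 * (L * b)) - e.1.total (c t h) / (L * b)))
  have htot : ∀ t (τ : Traj X Ω A L), Measurable fun h => τ.total (c t h) := fun t τ => by
    have := hcm t
    unfold Traj.total
    fun_prop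
  have hv : ∀ t, Measurable (v t) := fun t => Finset.measurable_sum _ fun τ _ =>
    (M.measurable_pathProb (alg.measurable_policy t) τ).mul (htot t τ)
  have hG : ∀ t, Measurable (Function.uncurry (G t)) := fun t => by
    have h1 : Measurable fun p : History X Ω A L t × Traj X Ω A L => p.2.total (c t p.1) :=
      measurable_of_forall_traj (htot t)
    have h2 : Measurable fun p : History X Ω A L t × Episode X Ω A L => p.2.1.total (c t p.1) :=
      h1.comp (measurable_fst.prodMk measurable_snd.fst)
    have h3 : Measurable fun p : History X Ω A L t × Episode X Ω A L => v t p.1 :=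
      (hv t).comp measurable_fst
    have : Measurable fun p : History X Ω A L t × Episode X Ω A L =>
      ENNReal.ofReal (Real.exp (v t p.1 / (2 * (L * b)) - p.2.1.total (c t p.1) / (L * b))) := by
      fun_prop
    exact this
  have key := alg.lintegral_prod_le_one M G hG
    (fun t h => M.lintegral_exp_value_sub_total_le_one (alg.isSignalingPolicy t h) hb (hc t h)) T
  have h6 := (mul_meas_ge_le_lintegral (measurable_prod_before G hG T)
    (ENNReal.ofReal (1 / η))).trans key
  refine le_trans (measure_mono (t := {h | ENNReal.ofReal (1 / η) ≤
    ∏ s : Fin T, G s (h.before s) (h s)}) ?_) ?_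
  · intro h hh
    simp only [Set.mem_ofPred_eq] at hh ⊢
    have h1 : ∏ s : Fin T, G s (h.before s) (h s) = ENNReal.ofReal (Real.exp
        (∑ s : Fin T, (v s (h.before s) / (2 * (L * b)) -
          (h s).1.total (c s (h.before s)) / (L * b)))) := by
      rw [Real.exp_sum, ENNReal.ofReal_prod_of_nonneg fun _ _ => (Real.exp_pos _).le]
    rw [h1]
    refine ENNReal.ofReal_le_ofReal ?_
    rw [← Real.log_le_iff_le_exp (by positivity), Finset.sum_sub_distrib, ← Finset.sum_div,
      ← Finset.sum_div]
    have h2 : ∀ s : Fin T, v s (h.before s) =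
        Occ.value (c s (h.before s)) (M.occ (alg.policy s (h.before s))) := fun s =>
      (M.value_occ (alg.isSignalingPolicy _ _) _).symm
    simp only [h2]
    rw [le_sub_iff_add_le, le_div_iff₀ (by positivity), add_mul, div_mul_eq_mul_div,
      show ∀ w : ℝ, w * (2 * (L * b)) / (L * b) = 2 * w from fun w => by
        rw [show w * (2 * (L * b)) = 2 * w * (L * b) by ring, mul_div_cancel_right₀ _ hb.ne']]
    linarith
  · have he : ENNReal.ofReal (1 / η) = (ENNReal.ofReal η)⁻¹ := by
      rw [one_div, ENNReal.ofReal_inv_of_pos hη]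
    rw [he, mul_comm] at h6
    rw [he]
    have := (ENNReal.le_div_iff_mul_le (Or.inl (by simp)) (Or.inl (by simp [hη]))).2 h6
    simpa using this

section Bounds

variable {T : ℕ} {δ : ℝ} {t : ℕ}

/-- The per-step cost in the regret bound. -/
def confidenceCost (S : Layering X L) (T : ℕ) (δ : ℝ) (h : History X Ω A L t)
    (x : X) (ω : Ω) (a : A) : ℝ :=
  2 * rewardBound T δ h x ω a + 3 * L * (min 2 (2 * priorBound (Ω := Ω) T δ h x) +
    min 2 (2 * transBound S T δ h x ω a))

theorem rewardBound_nonneg (h : History X Ω A L t) (x : X) (ω : Ω) (a : A) :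
    0 ≤ rewardBound T δ h x ω a :=
  le_min zero_le_one (Real.sqrt_nonneg _)

theorem priorBound_nonneg (h : History X Ω A L t) (x : X) : 0 ≤ priorBound T δ h x :=
  Real.sqrt_nonneg _

theorem transBound_nonneg (h : History X Ω A L t) (x : X) (ω : Ω) (a : A) :
    0 ≤ transBound S T δ h x ω a :=
  Real.sqrt_nonneg _

/-- The multiplicative bound needs bounded costs, which is why each dynamics term is truncated at
`2`: the cost is at most `2 + 3 * L * (2 + 2) ≤ 14 * L`. -/
theorem confidenceCost_mem (hL : 1 ≤ L) (h : History X Ω A L t) (x : X) (ω : Ω) (a : A) :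
    0 ≤ confidenceCost S T δ h x ω a ∧ confidenceCost S T δ h x ω a ≤ 14 * L := by
  have hL' : (1 : ℝ) ≤ L := by exact_mod_cast hL
  have h1 := rewardBound_nonneg (T := T) (δ := δ) h x ω a
  have h2 : rewardBound T δ h x ω a ≤ 1 := min_le_left _ _
  have h3 : (0 : ℝ) ≤ min 2 (2 * priorBound (Ω := Ω) T δ h x) :=
    le_min zero_le_two (mul_nonneg zero_le_two (priorBound_nonneg h x))
  have h4 : (0 : ℝ) ≤ min 2 (2 * transBound S T δ h x ω a) :=
    le_min zero_le_two (mul_nonneg zero_le_two (transBound_nonneg h x ω a))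
  have h5 : min 2 (2 * priorBound (Ω := Ω) T δ h x) ≤ 2 := min_le_left _ _
  have h6 : min 2 (2 * transBound S T δ h x ω a) ≤ 2 := min_le_left _ _
  unfold confidenceCost
  constructor
  · positivity
  · nlinarith

theorem measurable_confidenceCost :
    Measurable fun h : History X Ω A L t => confidenceCost S T δ h := by
  have h1 : ∀ x ω a, Measurable fun h : History X Ω A L t => (countXOA h x ω a : ℝ) :=
    fun x ω a => measurable_from_top.comp (measurable_visitCount fun τ => τ.VisitsXOA x ω a)
  have h2 : ∀ x, Measurable fun h : History X Ω A L t => (countX h x : ℝ) :=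
    fun x => measurable_from_top.comp (measurable_visitCount fun τ => τ.VisitsX x)
  refine measurable_pi_iff.2 fun x => measurable_pi_iff.2 fun ω => measurable_pi_iff.2 fun a => ?_
  have h1' := h1 x ω a
  have h2' := h2 x
  unfold confidenceCost rewardBound priorBound transBound
  fun_prop

end Bounds

open Classical in
theorem sum_at_mem {e : Episode X Ω A L} (he : Episode.Regular S e) {w : Fin L → ℝ}
    (hw : ∀ k, w k ∈ Set.Icc (0 : ℝ) 1) (x : X) (ω : Ω) (a : A) :
    0 ≤ (∑ k, if e.1.At k x ω a then w k else 0) ∧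
      (∑ k, if e.1.At k x ω a then w k else 0) ≤ if e.1.VisitsXOA x ω a then 1 else 0 := by
  refine ⟨Finset.sum_nonneg fun k _ => by split_ifs; exacts [(hw k).1, le_rfl], ?_⟩
  split_ifs with hV
  · obtain ⟨k, hk⟩ := hV
    rw [Finset.sum_eq_single k]
    · rw [if_pos hk]; exact (hw k).2
    · intro j _ hj
      refine if_neg fun hj' => hj (Fin.ext ?_)
      rw [he.1.eq_of_castSucc hj'.1, he.1.eq_of_castSucc hk.1]
    · simp
  · exact (Finset.sum_eq_zero fun k _ => if_neg fun hk => hV ⟨k, hk⟩).le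

open Classical in
-- A layered trajectory meets a triplet at most once, so the numerator is at most the count. Having
-- estimates and means in `[0, 1]` makes the cap `1` in `rewardBound` harmless.
theorem rewardEst_mem {t : ℕ} {h : History X Ω A L t} (hreg : ∀ s, Episode.Regular S (h s))
    {rew : Episode X Ω A L → Fin L → ℝ} (hw : ∀ s k, rew (h s) k ∈ Set.Icc (0 : ℝ) 1)
    (x : X) (ω : Ω) (a : A) :
    (∑ s : Fin t, ∑ k : Fin L, if (h s).1.At k x ω a then rew (h s) k else 0) /
      max 1 (countXOA h x ω a : ℝ) ∈ Set.Icc (0 : ℝ) 1 := by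
  have hpos : (0 : ℝ) < max 1 (countXOA h x ω a : ℝ) := lt_of_lt_of_le one_pos (le_max_left _ _)
  constructor
  · exact div_nonneg (Finset.sum_nonneg fun s _ => (sum_at_mem (hreg s) (hw s) x ω a).1) hpos.le
  · rw [div_le_one hpos]
    refine le_trans (Finset.sum_le_sum fun s _ => (sum_at_mem (hreg s) (hw s) x ω a).2) ?_
    refine le_trans (le_of_eq ?_) (le_max_right _ _)
    simp [countXOA]

theorem MPP.mean_mem (M : MPP S Ω A) (x : X) (ω : Ω) (a : A) :
    M.meanS x ω a ∈ Set.Icc (0 : ℝ) 1 ∧ M.meanR x ω a ∈ Set.Icc (0 : ℝ) 1 := by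
  have := M.rewardLaw_prob
  have h : ∀ f : (X → Ω → A → ℝ) × (X → Ω → A → ℝ) → ℝ, Measurable f →
      (∀ᵐ r ∂M.rewardLaw, f r ∈ Set.Icc (0 : ℝ) 1) → ∫ r, f r ∂M.rewardLaw ∈ Set.Icc (0 : ℝ) 1 :=
    fun f hf hr => by
      refine ⟨integral_nonneg_of_ae (hr.mono fun r h => h.1), ?_⟩
      have := integral_mono_ae (Integrable.of_mem_Icc 0 1 hf.aemeasurable hr)
        (integrable_const (1 : ℝ)) (hr.mono fun r h => h.2)
      simpa using this
  exact ⟨h _ (by fun_prop) (M.rewardLaw_mem.mono fun r h => (h x ω a).1),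
    h _ (by fun_prop) (M.rewardLaw_mem.mono fun r h => (h x ω a).2)⟩

theorem measure_iUnion_le_of_card {β ι : Type*} [MeasurableSpace β] (ν : Measure β) [Fintype ι]
    [Nonempty ι] {B : ι → Set β} {b : ℝ}
    (hB : ∀ i, ν (B i) ≤ ENNReal.ofReal (b / Fintype.card ι)) : ν (⋃ i, B i) ≤ ENNReal.ofReal b := by
  refine (measure_iUnion_fintype_le ν B).trans ((Finset.sum_le_sum fun i _ => hB i).trans ?_)
  rw [Finset.sum_const, ← ENNReal.ofReal_nsmul, nsmul_eq_mul, Finset.card_univ,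
    mul_div_cancel₀ _ (by exact_mod_cast Fintype.card_ne_zero)]

end

/-! ### The good event and its probability. -/

section

variable {X Ω A : Type*} [Fintype X] [Fintype Ω] [Fintype A] {L : ℕ} {S : Layering X L}
  {T : ℕ} {α δ : ℝ}

theorem nonempty_of_mem_stdSimplex {ι : Type*} [Fintype ι] {p : ι → ℝ} (hp : p ∈ stdSimplex ℝ ι) :
    Nonempty ι := by
  by_contra h
  have := not_nonempty_iff.1 h
  simpa using hp.2

/-- All estimates are accurate, and realized costs are close to expected ones. -/
structure GoodHistory (alg : OPPS S Ω A T α δ) (M : MPP S Ω A) (h : History X Ω A L T) : Prop where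
  regular : ∀ s, Episode.Regular S (h s)
  trans : ∀ (t : Fin T) x ω a, S.layer x < L →
    ∑ x' ∈ S.next x, |transEst (h.before t) x ω a x' - M.trans x ω a x'| ≤
      transBound S T δ (h.before t) x ω a
  prior : ∀ (t : Fin T) x, S.layer x < L →
    ∑ ω, |priorEst (h.before t) x ω - M.prior x ω| ≤ priorBound (Ω := Ω) T δ (h.before t) x
  rewardS : ∀ (t : Fin T) x ω a, S.layer x < L →
    |rewardEstS (h.before t) x ω a - M.meanS x ω a| ≤ rewardBound T δ (h.before t) x ω a
  rewardR : ∀ (t : Fin T) x ω a, S.layer x < L →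
    |rewardEstR (h.before t) x ω a - M.meanR x ω a| ≤ rewardBound T δ (h.before t) x ω a
  value_le : ∑ t : Fin T, Occ.value (confidenceCost S T δ (h.before t))
      (M.occ (alg.policy t (h.before t))) ≤
    2 * (∑ t : Fin T, (h t).1.total (confidenceCost S T δ (h.before t))) +
      2 * (L * (14 * L)) * Real.log (1 / δ)

theorem abs_sub_le_rewardBound {t : ℕ} {h : History X Ω A L t} {x : X} {ω : Ω} {a : A} {r m : ℝ}
    (hr : r ∈ Set.Icc (0 : ℝ) 1) (hm : m ∈ Set.Icc (0 : ℝ) 1)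
    (hD : 7 ≤ 3 * T * Fintype.card X * Fintype.card Ω * Fintype.card A / δ)
    (hdev : 1 ≤ countXOA h x ω a → |r - m| ≤
      √(Real.log (3 * T * Fintype.card X * Fintype.card Ω * Fintype.card A / δ) /
        countXOA h x ω a)) :
    |r - m| ≤ rewardBound T δ h x ω a := by
  have h1 : |r - m| ≤ 1 := abs_le.2 ⟨by linarith [hr.1, hm.2], by linarith [hr.2, hm.1]⟩
  refine le_min h1 ?_
  rcases Nat.eq_zero_or_pos (countXOA h x ω a) with h0 | h0
  · refine h1.trans (Real.one_le_sqrt.2 ?_)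
    simpa [h0] using one_le_log_of_seven_le hD
  · rw [max_eq_right (by exact_mod_cast h0)]
    exact hdev h0

theorem rewardEstS_mem {t : ℕ} {h : History X Ω A L t} (hreg : ∀ s, Episode.Regular S (h s))
    (x : X) (ω : Ω) (a : A) : rewardEstS h x ω a ∈ Set.Icc (0 : ℝ) 1 :=
  rewardEst_mem (rew := fun e => e.2.1) hreg (fun s k => ((hreg s).2 k).1) x ω a

theorem rewardEstR_mem {t : ℕ} {h : History X Ω A L t} (hreg : ∀ s, Episode.Regular S (h s))
    (x : X) (ω : Ω) (a : A) : rewardEstR h x ω a ∈ Set.Icc (0 : ℝ) 1 :=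
  rewardEst_mem (rew := fun e => e.2.2) hreg (fun s k => ((hreg s).2 k).2) x ω a

namespace OPPS

variable (alg : OPPS S Ω A T α δ) (M : MPP S Ω A)

/-- The budget is `2 * δ` each for transitions and priors, and `δ` each for the sender's rewards,
the receivers' rewards and the comparison of costs. Regularity costs nothing. -/
theorem measure_not_goodHistory_le (hL : 1 ≤ L) (hT : 1 ≤ T) (hδ : 0 < δ) (hδ' : δ ≤ 1 / 7) :
    alg.historyLaw M T {h | ¬ GoodHistory alg M h} ≤ ENNReal.ofReal (7 * δ) := by
  classical
  have : Nonempty X := ⟨S.first⟩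
  have : Nonempty Ω := nonempty_of_mem_stdSimplex (M.prior_mem S.first)
  obtain ⟨h0, -⟩ : ∃ h : History X Ω A L T, True := by
    have := alg.isProbabilityMeasure_historyLaw M T
    obtain ⟨h⟩ := nonempty_of_isProbabilityMeasure (alg.historyLaw M T)
    exact ⟨h, trivial⟩
  have : Nonempty A := nonempty_of_mem_stdSimplex
    (alg.isSignalingPolicy T h0 S.first (Classical.arbitrary Ω))
  have hT' : (1 : ℝ) ≤ T := by exact_mod_cast hT
  have hX : (1 : ℝ) ≤ Fintype.card X := by exact_mod_cast Fintype.card_pos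
  have hΩ : (1 : ℝ) ≤ Fintype.card Ω := by exact_mod_cast Fintype.card_pos
  have hA : (1 : ℝ) ≤ Fintype.card A := by exact_mod_cast Fintype.card_pos
  have hseven : ∀ {K : ℝ}, 1 ≤ K → 7 ≤ K / δ := fun {K} hK => by
    rw [le_div_iff₀ hδ]; linarith
  have hTX : (1 : ℝ) ≤ T * Fintype.card X := one_le_mul_of_one_le_of_one_le hT' hX
  have hTXO : (1 : ℝ) ≤ T * Fintype.card X * Fintype.card Ω := one_le_mul_of_one_le_of_one_le hTX hΩ
  have hK : (1 : ℝ) ≤ T * Fintype.card X * Fintype.card Ω * Fintype.card A :=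
    one_le_mul_of_one_le_of_one_le hTXO hA
  have h3K : (1 : ℝ) ≤ 3 * T * Fintype.card X * Fintype.card Ω * Fintype.card A := by
    nlinarith
  set D := 3 * T * Fintype.card X * Fintype.card Ω * Fintype.card A / δ with hDdef
  have hcard : (Fintype.card (X × Ω × A) : ℝ) =
      Fintype.card X * Fintype.card Ω * Fintype.card A := by
    simp [mul_assoc]
  have htr : alg.historyLaw M T (⋃ p : X × Ω × A, {h | S.layer p.1 < L ∧ ∃ t : Fin T,
      transBound S T δ (h.before t) p.1 p.2.1 p.2.2 < ∑ x' ∈ S.next p.1,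
        |transEst (h.before t) p.1 p.2.1 p.2.2 x' - M.trans p.1 p.2.1 p.2.2 x'|}) ≤
      ENNReal.ofReal (2 * δ) := by
    refine measure_iUnion_le_of_card _ fun p => ?_
    by_cases hp : S.layer p.1 < L
    · refine (measure_mono fun h hh => hh.2).trans
        ((alg.measure_trans_bad_le M hp p.2.1 p.2.2 (hseven hK)).trans
          (ENNReal.ofReal_le_ofReal (le_of_eq ?_)))
      rw [hcard]; field_simp
    · simp [hp]
  have hpr : alg.historyLaw M T (⋃ x : X, {h | S.layer x < L ∧ ∃ t : Fin T,
      priorBound (Ω := Ω) T δ (h.before t) x <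
        ∑ ω, |priorEst (h.before t) x ω - M.prior x ω|}) ≤ ENNReal.ofReal (2 * δ) := by
    refine measure_iUnion_le_of_card _ fun x => ?_
    by_cases hp : S.layer x < L
    · refine (measure_mono fun h hh => hh.2).trans
        ((alg.measure_prior_bad_le M hp (hseven hTX)).trans
          (ENNReal.ofReal_le_ofReal (le_of_eq ?_)))
      field_simp
    · simp [hp]
  -- With `c` the number of triplets, this reduces to `2 * δ ≤ 9 * T * c`; the square of `D` leaves
  -- ample room.
  have hnum : 2 * (T : ℝ) / D ^ 2 ≤ δ / Fintype.card (X × Ω × A) := by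
    rw [hcard, hDdef, div_pow, div_div_eq_mul_div, div_le_div_iff₀ (by positivity) (by positivity)]
    set c := (Fintype.card X : ℝ) * Fintype.card Ω * Fintype.card A with hc
    have hc1 : 1 ≤ c := by
      rw [hc]; exact one_le_mul_of_one_le_of_one_le (one_le_mul_of_one_le_of_one_le hX hΩ) hA
    rw [show (3 * T * Fintype.card X * Fintype.card Ω * Fintype.card A : ℝ) = 3 * T * c by
      rw [hc]; ring]
    have h1 : 2 * δ ≤ 9 * (T * c) := by nlinarith
    have h2 : 0 ≤ T * δ * c := by positivity
    nlinarith [mul_le_mul_of_nonneg_right h1 h2]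
  have hrS : alg.historyLaw M T (⋃ p : X × Ω × A, {h | S.layer p.1 < L ∧ ∃ t : Fin T,
      1 ≤ countXOA (h.before t) p.1 p.2.1 p.2.2 ∧
      √(Real.log D / countXOA (h.before t) p.1 p.2.1 p.2.2) <
        |rewardEstS (h.before t) p.1 p.2.1 p.2.2 - M.meanS p.1 p.2.1 p.2.2|}) ≤
      ENNReal.ofReal δ := by
    refine measure_iUnion_le_of_card _ fun p => ?_
    by_cases hp : S.layer p.1 < L
    · exact (measure_mono fun h hh => hh.2).trans
        ((alg.measure_reward_bad_le M hp p.2.1 p.2.2 measurable_fst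
          (M.rewardLaw_mem.mono fun r h => (h _ _ _).1) (rew := fun e => e.2.1)
          measurable_snd.fst (fun _ _ _ => rfl) (hseven h3K)).trans
          (ENNReal.ofReal_le_ofReal hnum))
    · simp [hp]
  have hrR : alg.historyLaw M T (⋃ p : X × Ω × A, {h | S.layer p.1 < L ∧ ∃ t : Fin T,
      1 ≤ countXOA (h.before t) p.1 p.2.1 p.2.2 ∧
      √(Real.log D / countXOA (h.before t) p.1 p.2.1 p.2.2) <
        |rewardEstR (h.before t) p.1 p.2.1 p.2.2 - M.meanR p.1 p.2.1 p.2.2|}) ≤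
      ENNReal.ofReal δ := by
    refine measure_iUnion_le_of_card _ fun p => ?_
    by_cases hp : S.layer p.1 < L
    · exact (measure_mono fun h hh => hh.2).trans
        ((alg.measure_reward_bad_le M hp p.2.1 p.2.2 measurable_snd
          (M.rewardLaw_mem.mono fun r h => (h _ _ _).2) (rew := fun e => e.2.2)
          measurable_snd.snd (fun _ _ _ => rfl) (hseven h3K)).trans
          (ENNReal.ofReal_le_ofReal hnum))
    · simp [hp]
  have hL' : (1 : ℝ) ≤ L := by exact_mod_cast hL
  have hma := alg.measure_value_gt_total_le M (c := fun t h => confidenceCost S T δ h)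
    (fun t => measurable_confidenceCost) (b := 14 * L) (by positivity)
    (fun t h x ω a => confidenceCost_mem hL h x ω a) hδ
  have hu := (measure_union_le _ _).trans (add_le_add (alg.measure_not_regular M).le
    ((measure_union_le _ _).trans (add_le_add htr ((measure_union_le _ _).trans (add_le_add hpr
      ((measure_union_le _ _).trans (add_le_add hrS ((measure_union_le _ _).trans
        (add_le_add hrR hma)))))))))
  refine (measure_mono ?_).trans (hu.trans ?_)
  · intro h hh
    by_contra hcon
    refine hh ?_
    simp only [Set.mem_union, Set.mem_iUnion, Set.mem_ofPred_eq, not_or, not_exists, not_and,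
      not_lt, not_not, Prod.forall] at hcon
    obtain ⟨h1, h2, h3, h4, h5, h6⟩ := hcon
    have hreg : ∀ (t : Fin T) s, Episode.Regular S (h.before t s) := fun t s => h1 _
    exact
      { regular := h1
        trans := fun t x ω a hx => h2 x ω a hx t
        prior := fun t x hx => h3 x hx t
        rewardS := fun t x ω a hx => abs_sub_le_rewardBound
          (rewardEstS_mem (hreg t) x ω a) (M.mean_mem x ω a).1 (hseven h3K) (h4 x ω a hx t)
        rewardR := fun t x ω a hx => abs_sub_le_rewardBound
          (rewardEstR_mem (hreg t) x ω a) (M.mean_mem x ω a).2 (hseven h3K) (h5 x ω a hx t)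
        value_le := h6 }
  · rw [zero_add, ← ENNReal.ofReal_add (by positivity) (by positivity),
      ← ENNReal.ofReal_add (by positivity) (by positivity),
      ← ENNReal.ofReal_add (by positivity) (by positivity),
      ← ENNReal.ofReal_add (by positivity) (by positivity)]
    exact ENNReal.ofReal_le_ofReal (by linarith)

end OPPS

end

/-! ### Feasibility of persuasive occupancy measures, and an `ℓ¹` perturbation bound. -/

section

variable {X Ω A : Type*} [Fintype X] [Fintype Ω] [Fintype A] {L : ℕ} {S : Layering X L}
  {T t : ℕ} {α δ : ℝ}

/-- The estimates computed from `h` lie within their confidence bounds. -/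
structure Accurate (M : MPP S Ω A) (T : ℕ) (δ : ℝ) (h : History X Ω A L t) : Prop where
  trans : ∀ x ω a, S.layer x < L →
    ∑ x' ∈ S.next x, |transEst h x ω a x' - M.trans x ω a x'| ≤ transBound S T δ h x ω a
  prior : ∀ x, S.layer x < L →
    ∑ ω, |priorEst h x ω - M.prior x ω| ≤ priorBound (Ω := Ω) T δ h x
  rewardS : ∀ x ω a, S.layer x < L →
    |rewardEstS h x ω a - M.meanS x ω a| ≤ rewardBound T δ h x ω a
  rewardR : ∀ x ω a, S.layer x < L →
    |rewardEstR h x ω a - M.meanR x ω a| ≤ rewardBound T δ h x ω a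

theorem GoodHistory.accurate {alg : OPPS S Ω A T α δ} {M : MPP S Ω A} {h : History X Ω A L T}
    (hg : GoodHistory alg M h) (t : Fin T) : Accurate M T δ (h.before t) :=
  ⟨hg.trans t, hg.prior t, hg.rewardS t, hg.rewardR t⟩

namespace Occ

theorem xoa_nonneg {q : Occ X Ω A} (hq : ∀ x ω a x', 0 ≤ q x ω a x') (x : X) (ω : Ω) (a : A) :
    0 ≤ q.xoa x ω a :=
  Finset.sum_nonneg fun x' _ => hq x ω a x'

theorem xo_nonneg {q : Occ X Ω A} (hq : ∀ x ω a x', 0 ≤ q x ω a x') (x : X) (ω : Ω) :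
    0 ≤ q.xo x ω :=
  Finset.sum_nonneg fun a _ => xoa_nonneg hq x ω a

theorem ofState_nonneg {q : Occ X Ω A} (hq : ∀ x ω a x', 0 ≤ q x ω a x') (x : X) :
    0 ≤ q.ofState x :=
  Finset.sum_nonneg fun ω _ => xo_nonneg hq x ω

/-- Summation over all states, layer by layer, for vectors that vanish at the final state. -/
theorem sum_eq_sum_layer {f : X → ℝ} (hf : ∀ x, ¬ S.layer x < L → f x = 0) :
    ∑ x, f x = ∑ k ∈ Finset.range L, ∑ x with S.layer x = k, f x := by
  classical
  rw [← Finset.sum_filter_add_sum_filter_not Finset.univ (fun x => S.layer x < L),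
    Finset.sum_eq_zero (s := Finset.univ.filter fun x => ¬ S.layer x < L), add_zero,
    ← Finset.sum_fiberwise_of_maps_to (t := Finset.range L) (g := S.layer)]
  · refine Finset.sum_congr rfl fun k hk => ?_
    rw [Finset.filter_filter]
    refine Finset.sum_congr (Finset.filter_congr fun x _ => ?_) fun _ _ => rfl
    have := Finset.mem_range.1 hk
    constructor
    · exact fun h => h.2
    · exact fun h => ⟨by omega, h⟩
  · intro x hx
    exact Finset.mem_range.2 (Finset.mem_filter.1 hx).2
  · intro x hx
    exact hf x (Finset.mem_filter.1 hx).2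

theorem value_le_value {q : Occ X Ω A} (hq : ∀ x ω a x', 0 ≤ q x ω a x')
    (hs : ∀ x ω a, ¬ S.layer x < L → q.xoa x ω a = 0) {r r' : X → Ω → A → ℝ}
    (hr : ∀ x ω a, S.layer x < L → r x ω a ≤ r' x ω a) : value r q ≤ value r' q := by
  refine Finset.sum_le_sum fun x _ => Finset.sum_le_sum fun ω _ => Finset.sum_le_sum fun a _ => ?_
  by_cases hx : S.layer x < L
  · exact mul_le_mul_of_nonneg_left (hr x ω a hx) (xoa_nonneg hq x ω a)
  · simp [hs x ω a hx]

theorem value_one_eq {q : Occ X Ω A} (hs : ∀ x ω a, ¬ S.layer x < L → q.xoa x ω a = 0)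
    (hl : ∀ k < L, ∑ x with S.layer x = k, q.ofState x = 1) :
    value (fun _ _ _ => 1) q = L := by
  have h1 : value (fun _ _ _ => 1) q = ∑ x, q.ofState x := by simp [value, ofState, xo]
  rw [h1, sum_eq_sum_layer (S := S)]
  · rw [Finset.sum_congr rfl fun k hk => hl k (Finset.mem_range.1 hk)]
    simp
  · intro x hx
    simp [ofState, xo, hs x _ _ hx]

end Occ

namespace MPP

variable (M : MPP S Ω A) {φ : X → Ω → A → ℝ}

theorem occ_xoa_eq_zero (hφ : IsSignalingPolicy φ) (x : X) (ω : Ω) (a : A)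
    (hx : ¬ S.layer x < L) : (M.occ φ).xoa x ω a = 0 := by
  refine Finset.sum_eq_zero fun x' _ => ?_
  have := S.layer_le x'
  rw [M.occ_eq hφ, M.stepProb_eq_zero φ x ω a x' (by omega), mul_zero]

theorem value_occ_nonneg {r : X → Ω → A → ℝ} (hr : ∀ x ω a, 0 ≤ r x ω a) :
    0 ≤ Occ.value r (M.occ φ) :=
  Finset.sum_nonneg fun x _ => Finset.sum_nonneg fun ω _ => Finset.sum_nonneg fun a _ =>
    mul_nonneg (Occ.xoa_nonneg M.occ_nonneg x ω a) (hr x ω a)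

theorem value_occ_le (hφ : IsSignalingPolicy φ) : Occ.value M.meanS (M.occ φ) ≤ L := by
  rw [← Occ.value_one_eq (M.occ_xoa_eq_zero hφ) fun k hk => M.sum_layer_occ_ofState hφ hk]
  exact Occ.value_le_value M.occ_nonneg (M.occ_xoa_eq_zero hφ)
    fun x ω a _ => (M.mean_mem x ω a).1.2

/-- Persuasive occupancy measures are feasible for `Opt-Opt` if the estimates are accurate. -/
theorem optOptFeasible_occ {h : History X Ω A L t} (hacc : Accurate M T δ h)
    (hφ : IsSignalingPolicy φ)
    (hpers : ∀ x a a', 0 ≤ ∑ ω, (M.occ φ).xoa x ω a * (M.meanR x ω a - M.meanR x ω a')) :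
    OptOptFeasible S T δ h (M.occ φ)
      (fun x ω => |priorEst h x ω - M.prior x ω| * (M.occ φ).ofState x)
      (fun x ω a x' => |transEst h x ω a x' - M.trans x ω a x'| * (M.occ φ).xoa x ω a) where
  support x ω a x' hx' := by
    rw [M.occ_eq_trans hφ, M.trans_eq_zero x ω a x' fun h => hx' (Layering.mem_next.2 h), mul_zero]
  nonneg := M.occ_nonneg
  sum_layer k hk := M.sum_layer_occ_ofState hφ hk
  flow x h1 hx := M.occ_flow hφ h1 hx
  trans_upper x ω a x' _ := by
    have h0 := Occ.xoa_nonneg (M.occ_nonneg (φ := φ)) x ω a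
    rw [M.occ_eq_trans hφ x ω a x', mul_comm, ← sub_mul]
    exact mul_le_mul_of_nonneg_right (by rw [abs_sub_comm]; exact le_abs_self _) h0
  trans_lower x ω a x' _ := by
    have h0 := Occ.xoa_nonneg (M.occ_nonneg (φ := φ)) x ω a
    rw [M.occ_eq_trans hφ x ω a x', mul_comm ((M.occ φ).xoa x ω a), ← sub_mul]
    exact mul_le_mul_of_nonneg_right (le_abs_self _) h0
  trans_sum x ω a hx := by
    rw [← Finset.sum_mul]
    exact mul_le_mul_of_nonneg_right (hacc.trans x ω a hx)
      (Occ.xoa_nonneg (M.occ_nonneg (φ := φ)) x ω a)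
  prior_upper x ω hx := by
    rw [M.occ_xo hφ hx, M.occ_ofState hφ hx, mul_comm, ← sub_mul]
    exact mul_le_mul_of_nonneg_right (by rw [abs_sub_comm]; exact le_abs_self _)
      (M.stateDist_nonneg hφ _ _)
  prior_lower x ω hx := by
    rw [M.occ_xo hφ hx, M.occ_ofState hφ hx, mul_comm (M.stateDist φ _ x), ← sub_mul]
    exact mul_le_mul_of_nonneg_right (le_abs_self _) (M.stateDist_nonneg hφ _ _)
  prior_sum x hx := by
    rw [← Finset.sum_mul]
    exact mul_le_mul_of_nonneg_right (hacc.prior x hx) (Occ.ofState_nonneg M.occ_nonneg x)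
  persuasive x a a' hx := by
    refine (hpers x a a').trans (Finset.sum_le_sum fun ω _ => mul_le_mul_of_nonneg_left ?_
      (Occ.xoa_nonneg M.occ_nonneg x ω a))
    -- The bonuses at `a` and at `a'` absorb the two estimation errors, so the relaxed incentive is
    -- at least the true one.
    have h1 := abs_le.1 (hacc.rewardR x ω a hx)
    have h2 := abs_le.1 (hacc.rewardR x ω a' hx)
    linarith [h1.1, h2.2]

end MPP

/-- A vector close to a multiple of a distribution, compared with another multiple. -/
theorem sum_abs_sub_mul_le {ι : Type*} (s : Finset ι) {v p p' e : ι → ℝ} {b w u : ℝ}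
    (hv : ∀ i ∈ s, 0 ≤ v i) (hw : ∑ i ∈ s, v i = w) (hp : ∀ i ∈ s, 0 ≤ p i)
    (hp1 : ∑ i ∈ s, p i = 1) (hup : ∀ i ∈ s, v i - p' i * w ≤ e i)
    (hlo : ∀ i ∈ s, p' i * w - v i ≤ e i) (he : ∑ i ∈ s, e i ≤ b * w)
    (hb : ∑ i ∈ s, |p' i - p i| ≤ b) (hu : 0 ≤ u) :
    ∑ i ∈ s, |v i - u * p i| ≤ |w - u| + u * min 2 (2 * b) := by
  have hb0 : 0 ≤ b := (Finset.sum_nonneg fun i _ => abs_nonneg _).trans hb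
  have hw0 : 0 ≤ w := hw ▸ Finset.sum_nonneg hv
  rcases hw0.eq_or_lt with hw1 | hw1
  · have hz : ∀ i ∈ s, v i = 0 := (Finset.sum_eq_zero_iff_of_nonneg hv).1 (hw.trans hw1.symm)
    have h1 : ∑ i ∈ s, |v i - u * p i| = u := by
      refine Eq.trans ?_ (by rw [← Finset.mul_sum, hp1, mul_one] : ∑ i ∈ s, u * p i = u)
      refine Finset.sum_congr rfl fun i hi => ?_
      rw [hz i hi, zero_sub, abs_neg, abs_of_nonneg (mul_nonneg hu (hp i hi))]
    rw [h1, ← hw1, zero_sub, abs_neg, abs_of_nonneg hu]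
    have : 0 ≤ min 2 (2 * b) := le_min zero_le_two (by linarith)
    nlinarith [mul_nonneg hu this]
  · have hd : ∀ i ∈ s, |v i / w - p i| ≤ e i / w + |p' i - p i| := fun i hi => by
      have h1 : v i / w - p i = (v i - p' i * w) / w + (p' i - p i) := by field_simp; ring
      rw [h1]
      refine (abs_add_le _ _).trans (add_le_add_left ?_ _)
      rw [abs_div, abs_of_pos hw1]
      refine div_le_div_of_nonneg_right (abs_le.2 ⟨?_, hup i hi⟩) hw0
      linarith [hlo i hi]
    have h2 : ∑ i ∈ s, |v i / w - p i| ≤ 2 * b := by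
      refine (Finset.sum_le_sum hd).trans ?_
      rw [Finset.sum_add_distrib, ← Finset.sum_div]
      have := (div_le_iff₀ hw1).2 he
      linarith
    have h3 : ∑ i ∈ s, |v i / w - p i| ≤ 2 := by
      refine (Finset.sum_le_sum fun i hi => (abs_sub _ _)).trans ?_
      rw [Finset.sum_add_distrib, Finset.sum_congr rfl fun i hi =>
        abs_of_nonneg (div_nonneg (hv i hi) hw0), Finset.sum_congr rfl fun i hi =>
        abs_of_nonneg (hp i hi), ← Finset.sum_div, hw, hp1, div_self hw1.ne']
      norm_num
    -- The difference is split so that the error between the distributions `v / w` and `p` is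
    -- weighted by `u`, the true mass in the applications, rather than by `w`.
    have h4 : ∀ i ∈ s, |v i - u * p i| ≤ |w - u| * (v i / w) + u * |v i / w - p i| := fun i hi => by
      have h5 : v i - u * p i = (w - u) * (v i / w) + u * (v i / w - p i) := by field_simp; ring
      rw [h5]
      refine (abs_add_le _ _).trans (le_of_eq ?_)
      rw [abs_mul, abs_mul, abs_of_nonneg (div_nonneg (hv i hi) hw0), abs_of_nonneg hu]
    refine (Finset.sum_le_sum h4).trans ?_
    rw [Finset.sum_add_distrib, ← Finset.mul_sum, ← Finset.mul_sum, ← Finset.sum_div, hw,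
      div_self hw1.ne', mul_one]
    exact add_le_add_right (mul_le_mul_of_nonneg_left (le_min h3 h2) hu) _

end

/-! ### Comparison of the program's solution with the true occupancy measure. -/

section

variable {X Ω A : Type*} [Fintype X] [Fintype Ω] [Fintype A] {L : ℕ} {S : Layering X L}
  {T t : ℕ} {α δ : ℝ}

/-- The bound on the deviation of transitions and priors, `min(2, 2ζ) + min(2, 2ε)`. -/
def dynamicsCost (S : Layering X L) (T : ℕ) (δ : ℝ) (h : History X Ω A L t)
    (x : X) (ω : Ω) (a : A) : ℝ :=
  min 2 (2 * priorBound (Ω := Ω) T δ h x) + min 2 (2 * transBound S T δ h x ω a)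

section Comparison

variable {M : MPP S Ω A} {h : History X Ω A L t} {φ : X → Ω → A → ℝ}
  {q : Occ X Ω A} {ζ : X → Ω → ℝ} {ε : X → Ω → A → X → ℝ}

theorem OptOptFeasible.xoa_eq_zero (hq : OptOptFeasible S T δ h q ζ ε) (x : X) (ω : Ω) (a : A)
    (hx : ¬ S.layer x < L) : q.xoa x ω a = 0 := by
  refine Finset.sum_eq_zero fun x' _ => hq.support x ω a x' fun h' => ?_
  have := Layering.mem_next.1 h'
  have := S.layer_le x'
  omega

theorem OptOptFeasible.sum_abs_next_le (hq : OptOptFeasible S T δ h q ζ ε)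
    (hacc : Accurate M T δ h) (hφ : IsSignalingPolicy φ) {x : X} (hx : S.layer x < L) (ω : Ω)
    (a : A) :
    ∑ x' ∈ S.next x, |q x ω a x' - M.occ φ x ω a x'| ≤
      |q.xoa x ω a - (M.occ φ).xoa x ω a| +
        (M.occ φ).xoa x ω a * min 2 (2 * transBound S T δ h x ω a) := by
  simp only [M.occ_eq_trans hφ x ω a]
  refine sum_abs_sub_mul_le _ (fun x' _ => hq.nonneg x ω a x') ?_
    (fun x' _ => M.trans_nonneg x ω a x') (M.sum_trans_next x ω a hx) (hq.trans_upper x ω a)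
    (hq.trans_lower x ω a) (hq.trans_sum x ω a hx) (hacc.trans x ω a hx)
    (Occ.xoa_nonneg M.occ_nonneg x ω a)
  exact Finset.sum_subset (Finset.subset_univ _) fun x' _ hx' => hq.support x ω a x' hx'

/-- Given `(x, ω)`, both vectors split their mass over actions according to `φ`, so actions add no
error; what remains is the state deviation and the error of the prior. -/
theorem OptOptFeasible.sum_abs_xoa_le (hq : OptOptFeasible S T δ h q ζ ε)
    (hacc : Accurate M T δ h) (hφ : IsSignalingPolicy φ)
    (hφq : ∀ x ω, 0 < q.xo x ω → ∀ a, φ x ω a = q.xoa x ω a / q.xo x ω)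
    {x : X} (hx : S.layer x < L) :
    ∑ ω, ∑ a, |q.xoa x ω a - (M.occ φ).xoa x ω a| ≤
      |q.ofState x - (M.occ φ).ofState x| +
        (M.occ φ).ofState x * min 2 (2 * priorBound (Ω := Ω) T δ h x) := by
  have h1 : ∀ ω a, q.xoa x ω a = q.xo x ω * φ x ω a := fun ω a => by
    rcases (Occ.xo_nonneg hq.nonneg x ω).eq_or_lt with h0 | h0
    · rw [← h0, zero_mul]
      exact (Finset.sum_eq_zero_iff_of_nonneg fun a _ => Occ.xoa_nonneg hq.nonneg x ω a).1 h0.symm a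
        (Finset.mem_univ a)
    · rw [hφq x ω h0 a, mul_div_cancel₀ _ h0.ne']
  have h2 : ∀ ω, ∑ a, |q.xoa x ω a - (M.occ φ).xoa x ω a| =
      |q.xo x ω - (M.occ φ).ofState x * M.prior x ω| := fun ω => by
    have : ∀ a, |q.xoa x ω a - (M.occ φ).xoa x ω a| =
        |q.xo x ω - (M.occ φ).ofState x * M.prior x ω| * φ x ω a := fun a => by
      rw [h1, M.occ_xoa hφ hx, M.occ_ofState hφ hx, ← sub_mul, abs_mul,
        abs_of_nonneg ((hφ x ω).1 a)]
    simp only [this, ← Finset.mul_sum, (hφ x ω).2, mul_one]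
  simp only [h2]
  exact sum_abs_sub_mul_le _ (fun ω _ => Occ.xo_nonneg hq.nonneg x ω) rfl
    (fun ω _ => (M.prior_mem x).1 ω) (M.prior_mem x).2 (fun ω _ => hq.prior_upper x ω hx)
    (fun ω _ => hq.prior_lower x ω hx) (hq.prior_sum x hx) (hacc.prior x hx)
    (Occ.ofState_nonneg M.occ_nonneg x)

theorem OptOptFeasible.ofState_first (hq : OptOptFeasible S T δ h q ζ ε) (hL : 0 < L) :
    q.ofState S.first = 1 := by
  classical
  rw [← hq.sum_layer 0 hL]
  have : (Finset.univ.filter fun x => S.layer x = 0) = {S.first} := by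
    ext x; simp [S.layer_eq_zero_iff]
  rw [this, Finset.sum_singleton]
  rfl

/-- By the flow constraint, the mass of a state is its inflow, for both vectors. This passes errors
to the next layer. -/
theorem OptOptFeasible.sum_layer_abs_ofState_le (hq : OptOptFeasible S T δ h q ζ ε)
    (hφ : IsSignalingPolicy φ) {k : ℕ} (hk : k + 1 < L) :
    ∑ x with S.layer x = k + 1, |q.ofState x - (M.occ φ).ofState x| ≤
      ∑ x with S.layer x = k, ∑ ω, ∑ a, ∑ x' ∈ S.next x, |q x ω a x' - M.occ φ x ω a x'| := by
  classical
  have h1 : ∀ x' ∈ Finset.univ.filter (fun x => S.layer x = k + 1),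
      |q.ofState x' - (M.occ φ).ofState x'| ≤
        ∑ x with S.layer x = k, ∑ ω, ∑ a, |q x ω a x' - M.occ φ x ω a x'| := by
    intro x' hx'
    have hx' : S.layer x' = k + 1 := (Finset.mem_filter.1 hx').2
    rw [← hq.flow x' (by omega) (by omega), ← M.occ_flow hφ (by omega) (by omega)]
    simp only [← Finset.sum_sub_distrib]
    refine (Finset.abs_sum_le_sum_abs _ _).trans ?_
    rw [Finset.sum_filter]
    refine Finset.sum_le_sum fun x _ => ?_
    split_ifs with hx
    · exact (Finset.abs_sum_le_sum_abs _ _).trans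
        (Finset.sum_le_sum fun ω _ => Finset.abs_sum_le_sum_abs _ _)
    · refine (abs_eq_zero.2 ?_).le
      refine Finset.sum_eq_zero fun ω _ => Finset.sum_eq_zero fun a _ => ?_
      rw [hq.support x ω a x' fun h' => hx (by have := Layering.mem_next.1 h'; omega),
        M.occ_eq_trans hφ, M.trans_eq_zero x ω a x' (by omega)]
      ring
  refine (Finset.sum_le_sum h1).trans (le_of_eq ?_)
  rw [Finset.sum_comm]
  refine Finset.sum_congr rfl fun x hx => ?_
  have hx : S.layer x = k := (Finset.mem_filter.1 hx).2
  rw [Finset.sum_comm]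
  refine Finset.sum_congr rfl fun ω _ => ?_
  rw [Finset.sum_comm]
  refine Finset.sum_congr rfl fun a _ => Finset.sum_congr ?_ fun _ _ => rfl
  ext x'
  simp [Layering.mem_next, hx]

/-- The occupancy measure of a policy is close to the solution it was computed from. -/
theorem OptOptFeasible.sum_abs_sub_le (hq : OptOptFeasible S T δ h q ζ ε)
    (hacc : Accurate M T δ h) (hφ : IsSignalingPolicy φ)
    (hφq : ∀ x ω, 0 < q.xo x ω → ∀ a, φ x ω a = q.xoa x ω a / q.xo x ω) :
    ∑ x, ∑ ω, ∑ a, |q.xoa x ω a - (M.occ φ).xoa x ω a| ≤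
      L * Occ.value (dynamicsCost S T δ h) (M.occ φ) := by
  have hp0 : ∀ x, 0 ≤ min 2 (2 * priorBound (Ω := Ω) T δ h x) := fun x =>
    le_min zero_le_two (mul_nonneg zero_le_two (priorBound_nonneg h x))
  have ht0 : ∀ x ω a, 0 ≤ min 2 (2 * transBound S T δ h x ω a) := fun x ω a =>
    le_min zero_le_two (mul_nonneg zero_le_two (transBound_nonneg h x ω a))
  set F : ℕ → ℝ := fun k => ∑ x with S.layer x = k, ∑ ω, ∑ a,
    |q.xoa x ω a - (M.occ φ).xoa x ω a| with hF
  set P : ℕ → ℝ := fun k => ∑ x with S.layer x = k,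
    (M.occ φ).ofState x * min 2 (2 * priorBound (Ω := Ω) T δ h x) with hP
  set R : ℕ → ℝ := fun k => ∑ x with S.layer x = k, ∑ ω, ∑ a,
    (M.occ φ).xoa x ω a * min 2 (2 * transBound S T δ h x ω a) with hR
  have hR0 : ∀ k, 0 ≤ R k := fun k => Finset.sum_nonneg fun x _ => Finset.sum_nonneg fun ω _ =>
    Finset.sum_nonneg fun a _ => mul_nonneg (Occ.xoa_nonneg M.occ_nonneg x ω a) (ht0 x ω a)
  have hP0 : ∀ k, 0 ≤ P k := fun k => Finset.sum_nonneg fun x _ =>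
    mul_nonneg (Occ.ofState_nonneg M.occ_nonneg x) (hp0 x)
  have hFle : ∀ k < L, F k ≤ ∑ x with S.layer x = k, |q.ofState x - (M.occ φ).ofState x| + P k := by
    intro k hk
    rw [hF, hP, ← Finset.sum_add_distrib]
    refine Finset.sum_le_sum fun x hx => hq.sum_abs_xoa_le hacc hφ hφq ?_
    rw [(Finset.mem_filter.1 hx).2]; exact hk
  -- The deviation in a layer is at most the one leaving the previous layer plus the new prior
  -- error. It starts at zero because both vectors put mass one on `S.first`.
  have hstep : ∀ k < L, F k + R k ≤ ∑ j ∈ Finset.range (k + 1), (P j + R j) := by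
    intro k
    induction k with
    | zero =>
      intro hk
      have h1 := hFle 0 hk
      have h2 : ∑ x with S.layer x = 0, |q.ofState x - (M.occ φ).ofState x| = 0 := by
        refine Finset.sum_eq_zero fun x hx => ?_
        rw [(S.layer_eq_zero_iff x).1 (Finset.mem_filter.1 hx).2, hq.ofState_first hk,
          M.occ_ofState hφ (by rw [(S.layer_eq_zero_iff _).2 rfl]; exact hk),
          (S.layer_eq_zero_iff _).2 rfl]
        simp [MPP.stateDist]
      rw [Finset.sum_range_one]
      linarith
    | succ k ih =>
      intro hk
      have h1 := hFle (k + 1) hk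
      have h2 := hq.sum_layer_abs_ofState_le (M := M) hφ hk
      have h3 : ∑ x with S.layer x = k, ∑ ω, ∑ a, ∑ x' ∈ S.next x,
          |q x ω a x' - M.occ φ x ω a x'| ≤ F k + R k := by
        rw [hF, hR, ← Finset.sum_add_distrib]
        refine Finset.sum_le_sum fun x hx => ?_
        simp only [← Finset.sum_add_distrib]
        exact Finset.sum_le_sum fun ω _ => Finset.sum_le_sum fun a _ =>
          hq.sum_abs_next_le hacc hφ (by rw [(Finset.mem_filter.1 hx).2]; omega) ω a
      rw [Finset.sum_range_succ]
      linarith [ih (by omega)]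
  have hval : Occ.value (dynamicsCost S T δ h) (M.occ φ) = ∑ j ∈ Finset.range L, (P j + R j) := by
    rw [Occ.value, Occ.sum_eq_sum_layer (S := S)]
    · refine Finset.sum_congr rfl fun k _ => ?_
      rw [hP, hR, ← Finset.sum_add_distrib]
      refine Finset.sum_congr rfl fun x _ => ?_
      simp only [dynamicsCost, mul_add, Finset.sum_add_distrib, Occ.ofState, Occ.xo, Finset.sum_mul]
    · intro x hx
      simp [M.occ_xoa_eq_zero hφ x _ _ hx]
  rw [Occ.sum_eq_sum_layer (S := S), hval]
  -- Each of the `L` layers may carry the whole accumulated error; hence the factor `L`.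
  · have : ∀ k ∈ Finset.range L, F k ≤ ∑ j ∈ Finset.range L, (P j + R j) := fun k hk => by
      have hk' := Finset.mem_range.1 hk
      have h1 : ∑ j ∈ Finset.range (k + 1), (P j + R j) ≤ ∑ j ∈ Finset.range L, (P j + R j) :=
        Finset.sum_le_sum_of_subset_of_nonneg (Finset.range_mono hk') fun j _ _ =>
          add_nonneg (hP0 j) (hR0 j)
      linarith [hstep k hk', hR0 k]
    refine (Finset.sum_le_sum this).trans (le_of_eq ?_)
    simp
  · intro x hx
    simp [M.occ_xoa_eq_zero hφ x _ _ hx, hq.xoa_eq_zero x _ _ hx]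

end Comparison

/-- The regret of an episode in which the optimistic program is solved. -/
theorem value_sub_value_le_confidenceCost {M : MPP S Ω A} {h : History X Ω A L t}
    (hacc : Accurate M T δ h) {φ ψ : X → Ω → A → ℝ} (hφ : IsSignalingPolicy φ)
    (hψ : IsSignalingPolicy ψ)
    (hpers : ∀ x a a', 0 ≤ ∑ ω, (M.occ ψ).xoa x ω a * (M.meanR x ω a - M.meanR x ω a'))
    {q : Occ X Ω A} (hq : IsOptOptSolution S T δ h (optimisticValue T δ h) q)
    (hφq : ∀ x ω, 0 < q.xo x ω → ∀ a, φ x ω a = q.xoa x ω a / q.xo x ω) :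
    Occ.value M.meanS (M.occ ψ) - Occ.value M.meanS (M.occ φ) ≤
      Occ.value (confidenceCost S T δ h) (M.occ φ) := by
  obtain ⟨⟨ζ, ε, hf⟩, hopt⟩ := hq
  -- Optimism: the occupancy measure of the competitor `ψ` is a feasible point.
  have h1 := hopt _ _ _ (M.optOptFeasible_occ hacc hψ hpers)
  have h2 : Occ.value M.meanS (M.occ ψ) ≤ optimisticValue T δ h (M.occ ψ) :=
    Occ.value_le_value M.occ_nonneg (M.occ_xoa_eq_zero hψ) fun x ω a hx => by
      linarith [(abs_le.1 (hacc.rewardS x ω a hx)).1]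
  have h3 : optimisticValue T δ h q ≤
      Occ.value (fun x ω a => M.meanS x ω a + 2 * rewardBound T δ h x ω a) q :=
    Occ.value_le_value hf.nonneg hf.xoa_eq_zero fun x ω a hx => by
      linarith [(abs_le.1 (hacc.rewardS x ω a hx)).2]
  -- The constant `3` bounds `meanS + 2 * rewardBound`, both terms being capped by one.
  have h4 : Occ.value (fun x ω a => M.meanS x ω a + 2 * rewardBound T δ h x ω a) q -
      Occ.value (fun x ω a => M.meanS x ω a + 2 * rewardBound T δ h x ω a) (M.occ φ) ≤
      3 * ∑ x, ∑ ω, ∑ a, |q.xoa x ω a - (M.occ φ).xoa x ω a| := by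
    simp only [Occ.value, Finset.mul_sum, ← Finset.sum_sub_distrib, ← sub_mul]
    refine Finset.sum_le_sum fun x _ => Finset.sum_le_sum fun ω _ => Finset.sum_le_sum fun a _ => ?_
    have h5 := (M.mean_mem x ω a).1
    have h6 := rewardBound_nonneg (T := T) (δ := δ) h x ω a
    have h7 : rewardBound T δ h x ω a ≤ 1 := min_le_left _ _
    rw [mul_comm 3]
    refine (le_abs_self _).trans ?_
    rw [abs_mul, abs_of_nonneg (a := M.meanS x ω a + 2 * rewardBound T δ h x ω a)
      (by linarith [h5.1])]
    exact mul_le_mul_of_nonneg_left (by linarith [h5.2]) (abs_nonneg _)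
  have h8 := hf.sum_abs_sub_le hacc hφ hφq
  have h9 : Occ.value (fun x ω a => M.meanS x ω a + 2 * rewardBound T δ h x ω a) (M.occ φ) +
      3 * (L * Occ.value (dynamicsCost S T δ h) (M.occ φ)) =
      Occ.value M.meanS (M.occ φ) + Occ.value (confidenceCost S T δ h) (M.occ φ) := by
    simp only [Occ.value, Finset.mul_sum, ← Finset.sum_add_distrib]
    refine Finset.sum_congr rfl fun x _ => Finset.sum_congr rfl fun ω _ =>
      Finset.sum_congr rfl fun a _ => ?_
    simp only [confidenceCost, dynamicsCost]
    ring
  linarith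

end

/-! ### Pathwise summation of confidence widths. -/

section

variable {X Ω A : Type*} [Fintype X] [Fintype Ω] [Fintype A] {L : ℕ} {S : Layering X L}
  {T : ℕ} {α δ : ℝ}

open Classical in
-- The induction step is `1 / √N ≤ 3 * (√(N + 1) - √N)`, which follows from `√(N + 1) ≤ 2 * √N`. The
-- first visit, where the maximum with one acts, is treated apart.
theorem sum_inv_sqrt_visitCount_le (V : Traj X Ω A L → Prop) {n : ℕ} (h : History X Ω A L n) :
    (∑ t : Fin n, if V (h t).1 then 1 / √(max 1 (visitCount V (h.before t) : ℝ)) else 0) ≤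
      3 * √(visitCount V h) := by
  induction n with
  | zero => simp
  | succ n ih =>
    set h' : History X Ω A L n := fun i => h i.castSucc with hh'
    have h1 : ∀ s : Fin n, h.before s.castSucc = h'.before s := fun s => rfl
    have h2 : h.before (Fin.last n) = h' := rfl
    have h3 : visitCount V h = visitCount V h' + if V (h (Fin.last n)).1 then 1 else 0 := by
      simp only [visitCount, Finset.card_filter, Fin.sum_univ_castSucc]
      rfl
    rw [Fin.sum_univ_castSucc, h2, h3]
    have h4 := ih h'
    simp only [h1]
    refine (add_le_add_left h4 _).trans ?_
    split_ifs with hV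
    · have h5 : (0 : ℝ) ≤ visitCount V h' := Nat.cast_nonneg _
      push_cast
      rcases Nat.eq_zero_or_pos (visitCount V h') with h0 | h0
      · simp [h0]
      · have h6 : (1 : ℝ) ≤ visitCount V h' := by exact_mod_cast h0
        rw [max_eq_right h6]
        set N : ℝ := (visitCount V h' : ℝ)
        have h7 : 0 < √N := Real.sqrt_pos.2 (by linarith)
        have h8 : √(N + 1) ≤ 2 * √N := by
          rw [Real.sqrt_le_left (by positivity), mul_pow, Real.sq_sqrt h5]; linarith
        have h9 : √(N + 1) ^ 2 = √N ^ 2 + 1 := by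
          rw [Real.sq_sqrt (by linarith), Real.sq_sqrt h5]
        have h10 : √N ≤ √(N + 1) := Real.sqrt_le_sqrt (by linarith)
        rw [← le_sub_iff_add_le', div_le_iff₀ h7]
        nlinarith
    · simp

open Classical in
-- Cauchy–Schwarz over the index set, together with at most `T * m` visits in all.
theorem sum_sum_inv_sqrt_visitCount_le {ι : Type*} [Fintype ι] (V : ι → Traj X Ω A L → Prop)
    (h : History X Ω A L T) {m : ℝ} (hm : ∀ t, (∑ i, if V i (h t).1 then (1 : ℝ) else 0) ≤ m) :
    (∑ t : Fin T, ∑ i, if V i (h t).1 then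
      1 / √(max 1 (visitCount (V i) (h.before t) : ℝ)) else 0) ≤
      3 * √(Fintype.card ι * (T * m)) := by
  rw [Finset.sum_comm]
  refine (Finset.sum_le_sum fun i _ => sum_inv_sqrt_visitCount_le (V i) h).trans ?_
  rw [← Finset.mul_sum]
  refine mul_le_mul_of_nonneg_left ?_ (by norm_num)
  have h1 := Real.sum_sqrt_mul_sqrt_le Finset.univ (f := fun _ : ι => (1 : ℝ))
    (g := fun i => (visitCount (V i) h : ℝ)) (fun _ => zero_le_one) (fun _ => Nat.cast_nonneg _)
  simp only [Real.sqrt_one, one_mul, Finset.sum_const, Finset.card_univ, nsmul_eq_mul,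
    mul_one] at h1
  refine h1.trans ?_
  rw [Real.sqrt_mul (Nat.cast_nonneg _)]
  refine mul_le_mul_of_nonneg_left (Real.sqrt_le_sqrt ?_) (Real.sqrt_nonneg _)
  have h2 : ∀ i, (visitCount (V i) h : ℝ) = ∑ t, if V i (h t).1 then (1 : ℝ) else 0 := fun i => by
    simp [visitCount]
  simp only [h2]
  rw [Finset.sum_comm]
  refine (Finset.sum_le_sum fun t _ => hm t).trans ?_
  simp

open Classical in
theorem sum_visitsXOA_le (τ : Traj X Ω A L) :
    (∑ p : X × Ω × A, if τ.VisitsXOA p.1 p.2.1 p.2.2 then (1 : ℝ) else 0) ≤ L := by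
  have h1 : ∀ p : X × Ω × A, (if τ.VisitsXOA p.1 p.2.1 p.2.2 then (1 : ℝ) else 0) ≤
      ∑ k : Fin L, if (τ.state k.castSucc, τ.outcome k, τ.action k) = p then 1 else 0 := by
    rintro ⟨x, ω, a⟩
    split_ifs with hV
    · obtain ⟨k, hk1, hk2, hk3⟩ := hV
      refine le_trans ?_ (Finset.single_le_sum (fun j _ => by split_ifs <;> norm_num)
        (Finset.mem_univ k))
      simp [hk1, hk2, hk3]
    · exact Finset.sum_nonneg fun j _ => by split_ifs <;> norm_num
  refine (Finset.sum_le_sum fun p _ => h1 p).trans ?_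
  rw [Finset.sum_comm]
  simp

open Classical in
theorem sum_visitsX_le (τ : Traj X Ω A L) :
    (∑ x, if τ.VisitsX x then (1 : ℝ) else 0) ≤ L + 1 := by
  have h1 : ∀ x, (if τ.VisitsX x then (1 : ℝ) else 0) ≤
      ∑ k : Fin (L + 1), if τ.state k = x then 1 else 0 := by
    intro x
    split_ifs with hV
    · obtain ⟨k, hk⟩ := hV
      refine le_trans ?_ (Finset.single_le_sum (fun j _ => by split_ifs <;> norm_num)
        (Finset.mem_univ k))
      simp [hk]
    · exact Finset.sum_nonneg fun j _ => by split_ifs <;> norm_num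
  refine (Finset.sum_le_sum fun p _ => h1 p).trans ?_
  rw [Finset.sum_comm]
  simp

open Classical in
theorem Traj.Layered.total_eq {τ : Traj X Ω A L} (hl : τ.Layered S) (c : X → Ω → A → ℝ) :
    τ.total c = ∑ p : X × Ω × A, if τ.VisitsXOA p.1 p.2.1 p.2.2 then c p.1 p.2.1 p.2.2 else 0 := by
  have h1 : ∀ p : X × Ω × A, (if τ.VisitsXOA p.1 p.2.1 p.2.2 then c p.1 p.2.1 p.2.2 else 0) =
      ∑ k : Fin L, if (τ.state k.castSucc, τ.outcome k, τ.action k) = p then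
        c p.1 p.2.1 p.2.2 else 0 := by
    rintro ⟨x, ω, a⟩
    simp only [Prod.mk.injEq]
    split_ifs with hV
    · obtain ⟨k, hk⟩ := hV
      rw [Finset.sum_eq_single k]
      · exact (if_pos hk).symm
      · intro j _ hj
        refine if_neg fun hj' => hj (Fin.ext ?_)
        rw [hl.eq_of_castSucc hj'.1, hl.eq_of_castSucc hk.1]
      · simp
    · exact (Finset.sum_eq_zero fun k _ => if_neg fun hk => hV ⟨k, hk⟩).symm
  simp only [h1]
  rw [Finset.sum_comm, Traj.total]
  exact Finset.sum_congr rfl fun k _ => by simp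

open Classical in
-- Only an inequality, because `VisitsX` also counts the final state, where no cost is incurred.
theorem Traj.Layered.total_state_le {τ : Traj X Ω A L} (hl : τ.Layered S) {c : X → ℝ}
    (hc : ∀ x, 0 ≤ c x) :
    τ.total (fun x _ _ => c x) ≤ ∑ x, if τ.VisitsX x then c x else 0 := by
  have h1 : ∀ x, (∑ k : Fin L, if τ.state k.castSucc = x then c x else 0) ≤
      if τ.VisitsX x then c x else 0 := by
    intro x
    split_ifs with hV
    · by_cases hx : S.layer x < L
      · rw [Finset.sum_eq_single ⟨S.layer x, hx⟩]
        · split_ifs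
          exacts [le_rfl, hc x]
        · intro j _ hj
          exact if_neg fun hj' => hj (Fin.ext (hl.eq_of_castSucc hj'))
        · simp
      · refine (Finset.sum_eq_zero fun k _ => if_neg fun hk => hx ?_).le.trans (hc x)
        rw [← hl.eq_of_castSucc hk]; exact k.isLt
    · exact (Finset.sum_eq_zero fun k _ => if_neg fun hk => hV ⟨_, hk⟩).le
  refine le_trans (le_of_eq ?_) (Finset.sum_le_sum fun x _ => h1 x)
  rw [Finset.sum_comm, Traj.total]
  exact Finset.sum_congr rfl fun k _ => by simp

theorem Traj.total_mono (τ : Traj X Ω A L) {c c' : X → Ω → A → ℝ}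
    (h : ∀ x ω a, c x ω a ≤ c' x ω a) : τ.total c ≤ τ.total c' :=
  Finset.sum_le_sum fun _ _ => h _ _ _

theorem Traj.total_add (τ : Traj X Ω A L) (c c' : X → Ω → A → ℝ) :
    τ.total (fun x ω a => c x ω a + c' x ω a) = τ.total c + τ.total c' :=
  Finset.sum_add_distrib

/-- Pathwise bound on the sum of costs that decay with the numbers of visits. -/
theorem sum_total_le {h : History X Ω A L T} (hreg : ∀ s, Episode.Regular S (h s))
    {c : Fin T → X → Ω → A → ℝ} {u v : ℝ} (hu : 0 ≤ u) (hv : 0 ≤ v)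
    (hc : ∀ t x ω a, c t x ω a ≤ u * (1 / √(max 1 (countXOA (h.before t) x ω a : ℝ))) +
      v * (1 / √(max 1 (countX (h.before t) x : ℝ)))) :
    ∑ t, (h t).1.total (c t) ≤
      u * (3 * √(Fintype.card X * Fintype.card Ω * Fintype.card A * (T * L))) +
        v * (3 * √(Fintype.card X * (T * (L + 1)))) := by
  classical
  have h1 := sum_sum_inv_sqrt_visitCount_le
    (fun (p : X × Ω × A) (τ : Traj X Ω A L) => τ.VisitsXOA p.1 p.2.1 p.2.2) h
    fun t => sum_visitsXOA_le _
  have h2 := sum_sum_inv_sqrt_visitCount_le (fun (x : X) (τ : Traj X Ω A L) => τ.VisitsX x) h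
    fun t => sum_visitsX_le _
  rw [Fintype.card_prod, Fintype.card_prod] at h1
  push_cast at h1
  rw [← mul_assoc (Fintype.card X : ℝ)] at h1
  refine le_trans ?_ (add_le_add (mul_le_mul_of_nonneg_left h1 hu) (mul_le_mul_of_nonneg_left h2 hv))
  rw [Finset.mul_sum, Finset.mul_sum, ← Finset.sum_add_distrib]
  refine Finset.sum_le_sum fun t _ => ((h t).1.total_mono (hc t)).trans ?_
  rw [Traj.total_add]
  have hl := (hreg t).1
  refine add_le_add (le_of_eq ?_) ((hl.total_state_le fun x => by positivity).trans (le_of_eq ?_))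
  · rw [hl.total_eq, Finset.mul_sum]
    refine Finset.sum_congr rfl fun p _ => ?_
    rw [mul_ite, mul_zero]
    rfl
  · rw [Finset.mul_sum]
    refine Finset.sum_congr rfl fun p _ => ?_
    rw [mul_ite, mul_zero]
    rfl

/-- The reward width is dominated by the same expression as the transition width, so its coefficient
`2` joins `6 * L` to give `8 * L`. -/
theorem confidenceCost_le {t : ℕ} (hL : 1 ≤ L) {H : ℝ} (h : History X Ω A L t) (x : X) (ω : Ω)
    (a : A) (hH : 0 ≤ H)
    (h1 : Real.log (T * Fintype.card X * Fintype.card Ω * Fintype.card A / δ) ≤ H)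
    (h2 : Real.log (T * Fintype.card X / δ) ≤ H)
    (h3 : Real.log (3 * T * Fintype.card X * Fintype.card Ω * Fintype.card A / δ) ≤ 2 * H) :
    confidenceCost S T δ h x ω a ≤
      8 * L * √(2 * Fintype.card X * H) * (1 / √(max 1 (countXOA h x ω a : ℝ))) +
        6 * L * √(2 * Fintype.card Ω * H) * (1 / √(max 1 (countX h x : ℝ))) := by
  have : Nonempty X := ⟨x⟩
  have hL' : (1 : ℝ) ≤ L := by exact_mod_cast hL
  have hX : (1 : ℝ) ≤ Fintype.card X := by exact_mod_cast Fintype.card_pos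
  have hn : (0 : ℝ) < max 1 (countXOA h x ω a : ℝ) := lt_of_lt_of_le one_pos (le_max_left _ _)
  have hn' : (0 : ℝ) < max 1 (countX h x : ℝ) := lt_of_lt_of_le one_pos (le_max_left _ _)
  have e1 : rewardBound T δ h x ω a ≤
      √(2 * Fintype.card X * H) * (1 / √(max 1 (countXOA h x ω a : ℝ))) := by
    refine (min_le_right _ _).trans ?_
    rw [mul_one_div, ← Real.sqrt_div' _ hn.le]
    refine Real.sqrt_le_sqrt (div_le_div_of_nonneg_right (h3.trans ?_) hn.le)
    nlinarith
  have e2 : transBound S T δ h x ω a ≤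
      √(2 * Fintype.card X * H) * (1 / √(max 1 (countXOA h x ω a : ℝ))) := by
    rw [mul_one_div, ← Real.sqrt_div' _ hn.le]
    refine Real.sqrt_le_sqrt (div_le_div_of_nonneg_right ?_ hn.le)
    have hc : ((S.next x).card : ℝ) ≤ Fintype.card X := by exact_mod_cast Finset.card_le_univ _
    exact (mul_le_mul_of_nonneg_left h1 (by positivity)).trans
      (mul_le_mul_of_nonneg_right (by linarith) hH)
  have e3 : priorBound (Ω := Ω) T δ h x ≤
      √(2 * Fintype.card Ω * H) * (1 / √(max 1 (countX h x : ℝ))) := by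
    rw [mul_one_div, ← Real.sqrt_div' _ hn'.le]
    refine Real.sqrt_le_sqrt (div_le_div_of_nonneg_right ?_ hn'.le)
    exact mul_le_mul_of_nonneg_left h2 (by positivity)
  have e4 : min 2 (2 * priorBound (Ω := Ω) T δ h x) ≤ 2 * priorBound (Ω := Ω) T δ h x :=
    min_le_right _ _
  have e5 : min 2 (2 * transBound S T δ h x ω a) ≤ 2 * transBound S T δ h x ω a :=
    min_le_right _ _
  unfold confidenceCost
  set p := √(2 * Fintype.card X * H) * (1 / √(max 1 (countXOA h x ω a : ℝ))) with hp
  set r := √(2 * Fintype.card Ω * H) * (1 / √(max 1 (countX h x : ℝ)))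
  have hp0 : 0 ≤ p := by positivity
  have e6 : 3 * L * (min 2 (2 * priorBound (Ω := Ω) T δ h x) +
      min 2 (2 * transBound S T δ h x ω a)) ≤ 3 * L * (2 * r + 2 * p) :=
    mul_le_mul_of_nonneg_left (by linarith) (by positivity)
  have e7 : p ≤ L * p := le_mul_of_one_le_left hp0 hL'
  nlinarith

end

/-! ### Assembly of the regret bound. -/

section

variable {X Ω A : Type*} [Fintype X] [Fintype Ω] [Fintype A] {L : ℕ} {S : Layering X L}
  {T : ℕ} {α δ : ℝ}

namespace OPPS

variable {alg : OPPS S Ω A T α δ} {M : MPP S Ω A}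

/-- `M.opt` is a supremum, so it suffices to compete with each persuasive `ψ`, without attaining it.
The sign of `B` covers the case of no persuasive policy, where `sSup ∅ = 0`. -/
theorem regret_le_of_forall {h : History X Ω A L T} {B : ℝ} (hB : 0 ≤ B)
    (hψ : ∀ ψ, IsSignalingPolicy ψ →
      (∀ x a a', 0 ≤ ∑ ω, (M.occ ψ).xoa x ω a * (M.meanR x ω a - M.meanR x ω a')) →
      ∑ t : Fin T, (Occ.value M.meanS (M.occ ψ) -
        Occ.value M.meanS (M.occ (alg.policy t (h.before t)))) ≤ B) :
    alg.regret M h ≤ B := by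
  have hv : 0 ≤ ∑ t : Fin T, Occ.value M.meanS (M.occ (alg.policy t (h.before t))) :=
    Finset.sum_nonneg fun t _ => M.value_occ_nonneg fun x ω a => (M.mean_mem x ω a).1.1
  rw [regret, sub_le_iff_le_add]
  rcases Nat.eq_zero_or_pos T with rfl | hT
  · simp only [Nat.cast_zero, zero_mul]; linarith
  have hT' : (0 : ℝ) < T := by exact_mod_cast hT
  rw [← le_div_iff₀' hT']
  refine Real.sSup_le ?_ (by positivity)
  rintro _ ⟨_, ⟨⟨ψ, hψ1, rfl⟩, hψ2⟩, rfl⟩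
  rw [le_div_iff₀' hT']
  have := hψ ψ hψ1 hψ2
  rw [Finset.sum_sub_distrib] at this
  simp only [Finset.sum_const, Finset.card_univ, Fintype.card_fin, nsmul_eq_mul] at this
  linarith

theorem regret_le_mul (h : History X Ω A L T) : alg.regret M h ≤ T * L := by
  refine regret_le_of_forall (by positivity) fun ψ hψ _ => ?_
  refine (Finset.sum_le_sum (g := fun _ => (L : ℝ)) fun t _ => ?_).trans (by simp)
  have := M.value_occ_nonneg (φ := alg.policy t (h.before t)) fun x ω a => (M.mean_mem x ω a).1.1
  linarith [M.value_occ_le hψ]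

theorem regret_le_of_goodHistory {h : History X Ω A L T} (hL : 1 ≤ L) (hg : GoodHistory alg M h) :
    alg.regret M h ≤ explorationLength X Ω A T α * L +
      (2 * (∑ t : Fin T, (h t).1.total (confidenceCost S T δ (h.before t))) +
        2 * (L * (14 * L)) * Real.log (1 / δ)) := by
  have hc0 : ∀ t : Fin T, 0 ≤ Occ.value (confidenceCost S T δ (h.before t))
      (M.occ (alg.policy t (h.before t))) := fun t =>
    M.value_occ_nonneg fun x ω a => (confidenceCost_mem hL _ x ω a).1
  refine regret_le_of_forall
    (add_nonneg (by positivity) ((Finset.sum_nonneg fun t _ => hc0 t).trans hg.value_le))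
    fun ψ hψ hpers => ?_
  have hstep : ∀ t : Fin T, Occ.value M.meanS (M.occ ψ) -
      Occ.value M.meanS (M.occ (alg.policy t (h.before t))) ≤
      (if (t : ℕ) < explorationLength X Ω A T α then (L : ℝ) else 0) +
        Occ.value (confidenceCost S T δ (h.before t)) (M.occ (alg.policy t (h.before t))) := by
    intro t
    split_ifs with ht
    · have := M.value_occ_nonneg (φ := alg.policy t (h.before t))
        fun x ω a => (M.mean_mem x ω a).1.1
      linarith [M.value_occ_le hψ, hc0 t]
    · rw [zero_add]
      -- The competitor `ψ` itself witnesses that the program is feasible, so the algorithm does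
      -- solve it in this episode.
      have hacc := hg.accurate t
      exact value_sub_value_le_confidenceCost hacc (alg.isSignalingPolicy _ _) hψ hpers
        (alg.solve_exploit t (not_lt.1 ht) _ ⟨_, _, _, M.optOptFeasible_occ hacc hψ hpers⟩)
        (alg.policy_eq t _)
  refine (Finset.sum_le_sum fun t _ => hstep t).trans ?_
  rw [Finset.sum_add_distrib]
  refine add_le_add ?_ hg.value_le
  rw [Fin.sum_univ_eq_sum_range
    (fun t => if t < explorationLength X Ω A T α then (L : ℝ) else 0) T, ← Finset.sum_filter,
    Finset.sum_const, nsmul_eq_mul]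
  refine mul_le_mul_of_nonneg_right ?_ (Nat.cast_nonneg L)
  have : (Finset.range T).filter (· < explorationLength X Ω A T α) ⊆
      Finset.range (explorationLength X Ω A T α) := fun t ht =>
    Finset.mem_range.2 (Finset.mem_filter.1 ht).2
  exact_mod_cast (Finset.card_le_card this).trans (Finset.card_range _).le

theorem ofReal_le_of_goodHistory_subset (alg : OPPS S Ω A T α δ) (M : MPP S Ω A) (hL : 1 ≤ L)
    (hT : 1 ≤ T) (hδ : 0 < δ) (hδ' : δ ≤ 1 / 7) {s : Set (History X Ω A L T)}
    (hs : ∀ h, GoodHistory alg M h → h ∈ s) :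
    ENNReal.ofReal (1 - 7 * δ) ≤ alg.historyLaw M T s := by
  have := alg.isProbabilityMeasure_historyLaw M T
  rw [ENNReal.ofReal_sub _ (by positivity), ENNReal.ofReal_one, tsub_le_iff_right,
    ← measure_univ (μ := alg.historyLaw M T)]
  refine (measure_mono (t := s ∪ {h | ¬ GoodHistory alg M h}) fun h _ => ?_).trans
    ((measure_union_le _ _).trans
      (add_le_add le_rfl (alg.measure_not_goodHistory_le M hL hT hδ hδ')))
  by_cases hg : GoodHistory alg M h
  · exact Or.inl (hs h hg)
  · exact Or.inr hg

end OPPS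

/-- The numerical part of the regret bound: `x, o, a` are cardinalities, `l` and `lam` the
logarithms of `T|X||Ω||A|` and `1/δ`. -/
theorem cost_sum_le {x o a T L l lam H : ℝ} (hx : 1 ≤ x) (ho : 1 ≤ o) (ha : 1 ≤ a) (hT : 1 ≤ T)
    (hL : 1 ≤ L) (hl : 0 < l) (hlam : 0 ≤ lam) (hH : H ≤ (2 * l) ^ 2 * lam) :
    8 * L * √(2 * x * H) * (3 * √(x * o * a * (T * L))) +
      6 * L * √(2 * o * H) * (3 * √(x * (T * (L + 1)))) ≤
    144 * (l * (L ^ 2 * x * √(T * a * o * lam))) := by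
  have hsq : ∀ {y z : ℝ}, 0 ≤ z → y ≤ z ^ 2 → √y ≤ z := fun hz h => by
    rw [← Real.sqrt_sq hz]; exact Real.sqrt_le_sqrt h
  set U := √(T * a * o * lam) with hU
  have hU0 : 0 ≤ U := Real.sqrt_nonneg _
  have hU2 : U ^ 2 = T * a * o * lam := Real.sq_sqrt (by positivity)
  have hlL : L ≤ L ^ 2 := by nlinarith
  have hxx : x ≤ x ^ 2 := by nlinarith
  have e1 : √(2 * x * H) * √(x * o * a * (T * L)) ≤ 3 * (l * (L * x * U)) := by
    rw [← Real.sqrt_mul' _ (by positivity)]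
    refine hsq (by positivity) ?_
    calc 2 * x * H * (x * o * a * (T * L)) ≤
        2 * x * ((2 * l) ^ 2 * lam) * (x * o * a * (T * L)) := by gcongr
      _ = 8 * l ^ 2 * x ^ 2 * (T * a * o * lam) * L := by ring
      _ ≤ 9 * l ^ 2 * x ^ 2 * (T * a * o * lam) * L ^ 2 := by gcongr; norm_num
      _ = (3 * (l * (L * x * U))) ^ 2 := by rw [← hU2]; ring
  have e2 : √(2 * o * H) * √(x * (T * (L + 1))) ≤ 4 * (l * (L * x * U)) := by
    rw [← Real.sqrt_mul' _ (by positivity)]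
    refine hsq (by positivity) ?_
    calc 2 * o * H * (x * (T * (L + 1))) ≤
        2 * o * ((2 * l) ^ 2 * lam) * (x ^ 2 * (T * (L ^ 2 + L ^ 2))) := by
          gcongr; nlinarith
      _ = 16 * l ^ 2 * x ^ 2 * (T * 1 * o * lam) * L ^ 2 := by ring
      _ ≤ 16 * l ^ 2 * x ^ 2 * (T * a * o * lam) * L ^ 2 := by gcongr
      _ = (4 * (l * (L * x * U))) ^ 2 := by rw [← hU2]; ring
  -- The total is `24 * 3 + 18 * 4 = 144`.
  have e3 := mul_le_mul_of_nonneg_left e1 (by positivity : (0 : ℝ) ≤ 24 * L)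
  have e4 := mul_le_mul_of_nonneg_left e2 (by positivity : (0 : ℝ) ≤ 18 * L)
  have : 0 ≤ l * (L ^ 2 * x * U) := by positivity
  nlinarith

namespace OPPS

variable {alg : OPPS S Ω A T α δ} {M : MPP S Ω A}

theorem regret_le_of_goodHistory_of_log_le {h : History X Ω A L T} (hg : GoodHistory alg M h)
    (hL : 1 ≤ L) (hT : 1 ≤ T) (hδ0 : 0 < δ) (hδ7 : δ ≤ 1 / 7) (hΩ : (1 : ℝ) ≤ Fintype.card Ω)
    (hA : (1 : ℝ) ≤ Fintype.card A) (hX2 : (2 : ℝ) ≤ Fintype.card X)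
    (hl2 : 0.69 ≤ Real.log (T * Fintype.card X * Fintype.card Ω * Fintype.card A))
    (hTl : Real.log (1 / δ) ≤ T) :
    alg.regret M h ≤ 400 * Real.log (T * Fintype.card X * Fintype.card Ω * Fintype.card A) *
      (⌈(T : ℝ) ^ α⌉₊ * L * Fintype.card X * Fintype.card Ω * Fintype.card A +
        L ^ 2 * Fintype.card X * √(T * Fintype.card A * Fintype.card Ω * Real.log (1 / δ))) := by
  have hreg := regret_le_of_goodHistory hL hg
  have hexp : (explorationLength X Ω A T α : ℝ) * L =
      ⌈(T : ℝ) ^ α⌉₊ * L * Fintype.card X * Fintype.card Ω * Fintype.card A := by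
    simp only [explorationLength]
    push_cast
    ring
  rw [hexp] at hreg
  have hL' : (1 : ℝ) ≤ L := by exact_mod_cast hL
  have hT' : (1 : ℝ) ≤ T := by exact_mod_cast hT
  have hlam1 : 1 ≤ Real.log (1 / δ) :=
    one_le_log_of_seven_le (by rw [le_div_iff₀ hδ0]; linarith)
  have hdiv : ∀ {K : ℝ}, 0 < K → Real.log (K / δ) = Real.log K + Real.log (1 / δ) :=
    fun {K} hK => by
      rw [div_eq_mul_one_div, Real.log_mul hK.ne' (by positivity)]
  have hH1 : Real.log (T * Fintype.card X * Fintype.card Ω * Fintype.card A / δ) ≤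
      Real.log (T * Fintype.card X * Fintype.card Ω * Fintype.card A) + Real.log (1 / δ) :=
    (hdiv (by positivity)).le
  have hH2 : Real.log (T * Fintype.card X / δ) ≤
      Real.log (T * Fintype.card X * Fintype.card Ω * Fintype.card A) + Real.log (1 / δ) := by
    rw [hdiv (by positivity)]
    refine add_le_add_left (Real.log_le_log (by positivity) ?_) _
    calc (T * Fintype.card X : ℝ) = T * Fintype.card X * 1 * 1 := by ring
      _ ≤ T * Fintype.card X * Fintype.card Ω * Fintype.card A := by gcongr
  have hH3 : Real.log (3 * T * Fintype.card X * Fintype.card Ω * Fintype.card A / δ) ≤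
      2 * (Real.log (T * Fintype.card X * Fintype.card Ω * Fintype.card A) +
        Real.log (1 / δ)) := by
    rw [hdiv (by positivity), show (3 * (T : ℝ) * Fintype.card X * Fintype.card Ω *
      Fintype.card A) = 3 * (T * Fintype.card X * Fintype.card Ω * Fintype.card A) by ring,
      Real.log_mul (by norm_num) (by positivity)]
    have : Real.log 3 ≤ Real.log (1 / δ) :=
      Real.log_le_log (by norm_num) (by rw [le_div_iff₀ hδ0]; linarith)
    linarith
  generalize Real.log (T * Fintype.card X * Fintype.card Ω * Fintype.card A) = l at *
  generalize Real.log (1 / δ) = lam at *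
  have hsum := sum_total_le hg.regular (c := fun t => confidenceCost S T δ (h.before t))
    (u := 8 * L * √(2 * Fintype.card X * (l + lam)))
    (v := 6 * L * √(2 * Fintype.card Ω * (l + lam))) (by positivity) (by positivity)
    fun t y ω b => confidenceCost_le (S := S) hL (h.before t) y ω b (by linarith) hH1 hH2 hH3
  -- With `l ≥ 0.69` and `lam ≥ 1` the sum of logarithms becomes a product, so that only `lam` stays
  -- under the square root.
  have hH : l + lam ≤ (2 * l) ^ 2 * lam := by
    have h1 : l * 1 ≤ l * lam := mul_le_mul_of_nonneg_left hlam1 (by linarith)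
    have h2 : 0.69 * lam ≤ l * lam := mul_le_mul_of_nonneg_right hl2 (by linarith)
    have h3 : 0.69 * (l * lam) ≤ l * (l * lam) :=
      mul_le_mul_of_nonneg_right hl2 (by nlinarith)
    calc l + lam ≤ 4 * (l * (l * lam)) := by linarith
      _ = (2 * l) ^ 2 * lam := by ring
  have hnum := cost_sum_le (x := Fintype.card X) (o := Fintype.card Ω) (a := Fintype.card A)
    (T := T) (L := L) (l := l) (lam := lam) (H := l + lam) (by linarith) hΩ hA hT' hL'
    (by linarith) (by linarith) hH
  generalize ∑ t : Fin T, (h t).1.total (confidenceCost S T δ (h.before t)) = W at *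
  generalize alg.regret M h = reg at *
  have hQ0 : 0 ≤ (⌈(T : ℝ) ^ α⌉₊ * L * Fintype.card X * Fintype.card Ω * Fintype.card A : ℝ) := by
    positivity
  generalize (⌈(T : ℝ) ^ α⌉₊ * L * Fintype.card X * Fintype.card Ω * Fintype.card A : ℝ) = Q at *
  generalize (Fintype.card X : ℝ) = x at *
  generalize (Fintype.card Ω : ℝ) = o at *
  generalize (Fintype.card A : ℝ) = a at *
  -- Here `lam ≤ T` lets the main term absorb the logarithmic term of the cost comparison.
  have hlamU : lam ≤ √(T * a * o * lam) := by
    rw [← Real.sqrt_sq (by linarith : (0 : ℝ) ≤ lam)]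
    refine Real.sqrt_le_sqrt ?_
    rw [Real.sqrt_sq (by linarith)]
    calc lam ^ 2 = lam * (1 * 1) * lam := by ring
      _ ≤ T * (a * o) * lam := by gcongr
      _ = T * a * o * lam := by ring
  generalize √(T * a * o * lam) = U at *
  have hlast : (L : ℝ) * (14 * L) * lam ≤ 14 * (L ^ 2 * x * U) := by
    calc (L : ℝ) * (14 * L) * lam = 14 * (L ^ 2 * 1 * lam) := by ring
      _ ≤ 14 * (L ^ 2 * x * U) := by gcongr; linarith
  have hZ : 0 ≤ L ^ 2 * x * U :=
    mul_nonneg (mul_nonneg (by positivity) (by linarith)) (by linarith)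
  generalize L ^ 2 * x * U = Z at *
  -- The bound is now `Q + 288 * (l * Z) + 28 * Z`, and terms without `l` cost a factor `1 / 0.69`;
  -- this fits into `400`.
  have h1 : 0.69 * Z ≤ l * Z := mul_le_mul_of_nonneg_right hl2 hZ
  have h2 : 0.69 * Q ≤ l * Q := mul_le_mul_of_nonneg_right hl2 hQ0
  have h3 : 400 * l * (Q + Z) = 400 * (l * Q) + 400 * (l * Z) := by ring
  rw [h3]
  linarith

end OPPS

end

end
end MarkovPersuasion

open MarkovPersuasion
theorem mainTheorem3 :
    ∃ (C : ℝ) (p : ℕ), 0 < C ∧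
      ∀ (X Ω A : Type*) [Fintype X] [Fintype Ω] [Fintype A] (L : ℕ) (S : Layering X L)
        (T : ℕ) (α δ : ℝ), 0 ≤ α → α ≤ 1 → 0 < δ → δ < 1 →
      ∀ (alg : OPPS S Ω A T α δ) (M : MPP S Ω A),
        ENNReal.ofReal (1 - 7 * δ) ≤
          alg.historyLaw M T
            {h | alg.regret M h ≤
              C * Real.log (T * Fintype.card X * Fintype.card Ω * Fintype.card A) ^ p *
                (⌈(T : ℝ) ^ α⌉₊ * L * Fintype.card X * Fintype.card Ω * Fintype.card A +
                  L ^ 2 * Fintype.card X *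
                    √(T * Fintype.card A * Fintype.card Ω * Real.log (1 / δ)))} := by
  refine ⟨400, 1, by norm_num, ?_⟩
  intro X Ω A _ _ _ L S T α δ hα0 hα1 hδ0 hδ1 alg M
  rw [pow_one]
  have hprob := alg.isProbabilityMeasure_historyLaw M T
  -- For `δ > 1 / 7` the claimed probability is negative.
  rcases lt_or_ge (1 / 7) δ with hδ7 | hδ7
  · rw [ENNReal.ofReal_of_nonpos (by linarith)]
    exact zero_le
  have : Nonempty X := ⟨S.first⟩
  have : Nonempty Ω := nonempty_of_mem_stdSimplex (M.prior_mem S.first)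
  obtain ⟨h0⟩ := nonempty_of_isProbabilityMeasure (alg.historyLaw M T)
  have : Nonempty A := nonempty_of_mem_stdSimplex
    (alg.isSignalingPolicy T h0 S.first (Classical.arbitrary Ω))
  have hX : (1 : ℝ) ≤ Fintype.card X := by exact_mod_cast Fintype.card_pos
  have hΩ : (1 : ℝ) ≤ Fintype.card Ω := by exact_mod_cast Fintype.card_pos
  have hA : (1 : ℝ) ≤ Fintype.card A := by exact_mod_cast Fintype.card_pos
  have hall : ∀ {B : ℝ}, T * L ≤ B →
      ENNReal.ofReal (1 - 7 * δ) ≤ alg.historyLaw M T {h | alg.regret M h ≤ B} := fun {B} hB => by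
    rw [show {h | alg.regret M h ≤ B} = Set.univ from
      Set.eq_univ_of_forall fun h => (OPPS.regret_le_mul h).trans hB, measure_univ]
    exact ENNReal.ofReal_le_one.2 (by linarith)
  rcases Nat.eq_zero_or_pos L with rfl | hL
  · exact hall (by simp)
  rcases Nat.eq_zero_or_pos T with rfl | hT
  · exact hall (by simp)
  have hL' : (1 : ℝ) ≤ L := by exact_mod_cast hL
  have hT' : (1 : ℝ) ≤ T := by exact_mod_cast hT
  -- For `L ≥ 1` the first and last states differ. This keeps the logarithm in the bound away from
  -- zero, as `log 2 > 0.69`.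
  have hX2 : (2 : ℝ) ≤ Fintype.card X := by
    have : 1 < Fintype.card X := Fintype.one_lt_card_iff.2 ⟨S.first, S.last, fun h => by
      have h1 := (S.layer_eq_zero_iff S.first).2 rfl
      have h2 := (S.layer_eq_last_iff S.last).2 rfl
      rw [h] at h1; omega⟩
    exact_mod_cast this
  have hK : (2 : ℝ) ≤ T * Fintype.card X * Fintype.card Ω * Fintype.card A := by
    calc (2 : ℝ) = 1 * 2 * 1 * 1 := by norm_num
      _ ≤ T * Fintype.card X * Fintype.card Ω * Fintype.card A := by gcongr
  have hl2 : 0.69 ≤ Real.log (T * Fintype.card X * Fintype.card Ω * Fintype.card A) := by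
    have := Real.log_le_log (by norm_num) hK
    linarith [Real.log_two_gt_d9]
  -- If `log (1 / δ)` exceeds `T`, the square root in the bound is at least `T`, and the trivial
  -- regret bound `T * L` suffices.
  rcases le_or_gt (Real.log (1 / δ)) T with hTl | hTl
  · exact alg.ofReal_le_of_goodHistory_subset M hL hT hδ0 hδ7 fun h hg =>
      OPPS.regret_le_of_goodHistory_of_log_le hg hL hT hδ0 hδ7 hΩ hA hX2 hl2 hTl
  refine hall ?_
  have h1 : (T : ℝ) ≤ √(T * Fintype.card A * Fintype.card Ω * Real.log (1 / δ)) := by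
    refine Real.le_sqrt_of_sq_le ?_
    calc (T : ℝ) ^ 2 = T * 1 * 1 * T := by ring
      _ ≤ T * Fintype.card A * Fintype.card Ω * Real.log (1 / δ) := by gcongr
  have h2 : (T : ℝ) * L ≤ L ^ 2 * Fintype.card X *
      √(T * Fintype.card A * Fintype.card Ω * Real.log (1 / δ)) := by
    calc (T : ℝ) * L = L ^ 1 * 1 * T := by ring
      _ ≤ _ := by gcongr; norm_num
  have hQ0 : 0 ≤ (⌈(T : ℝ) ^ α⌉₊ * L * Fintype.card X * Fintype.card Ω * Fintype.card A : ℝ) := by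
    positivity
  refine (h2.trans (le_add_of_nonneg_left hQ0)).trans (le_mul_of_one_le_left ?_ (by linarith))
  exact add_nonneg hQ0 (by positivity)
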